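/- **Conventions.** Fix the signature $\{\cdot,{}^{-1},1\}$ of groups. A *computable tree presentation* consists of a computable subtree $T\subseteq\omega^{<\omega}$ all of whose nodes are extendible to infinite paths, together with operations on the set $[T]$ of infinite paths that are computed by Turing functionals; $\mathcal A_T$ denotes the resulting structure with domain $[T]$. An *enumeration* of $A\subseteq\omega$ is a set $B\subseteq\omega$ with $A=\{x : \exists y\ \langle x,y\rangle\in B\}$. The *positive atomic diagram* of $(X_1,\dots,X_n)\in[T]^n$ is the set of Gödel numbers of the atomic formulas $\alpha(x_1,\dots,x_n)$ with $\mathcal A_T\models\alpha(X_1,\dots,X_n)$. The presentation $T$ is *tree-decidable* if there is one Turing functional $\Phi$ such that for every first-order formula $\alpha(x_1,\dots,x_n)$, every $(X_1,\dots,X_n)\in[T]^n$ and every enumeration $D$ of the positive atomic diagram of $(X_1,\dots,X_n)$, the computation $\Phi^{X_1\oplus\cdots\oplus X_n\oplus D}(\ulcorner\alpha\urcorner)$ halts, with output $1$ if $\mathcal A_T\models\alpha(X_1,\dots,X_n)$ and output $0$ otherwise. **The presentation $T_p^\times$.** Let $p$ be a prime; put $r_p=p-1$ if $p$ is odd, and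 $r_2=2$. Let $T_p^+$ be the tree of all tuples $(k_1,\dots,k_n)$ of natural numbers with $0\le k_i<p^i$ for all $i\le n$ and $k_{i+1}\equiv k_i \pmod{p^i}$ for all $i<n$. The tree $T_p^\times$ consists of the root and all tuples $(x,k_1,\dots,k_n)$ with $n\ge 0$, $0\le x<r_p$ and $(k_1,\dots,k_n)\in T_p^+$. Its paths $(x,y_1,y_2,\dots)$ are multiplied coordinatewise as elements of the additive group $(\mathbb Z/r_p\mathbb Z)\times\mathbb Z_p^+$: addition modulo $r_p$ in the coordinate $x$ and modulo $p^i$ in the coordinate $y_i$. For odd $p$, let $q_1$ be the least generator of $(\mathbb Z/p\mathbb Z)^\times$ and let $q_{n+1}$ be the least generator of $(\mathbb Z/p^{n+1}\mathbb Z)^\times$ with $q_{n+1}\equiv q_n \pmod{p^n}$. The level-$n$ label ($n\ge1$) of a path $X=(x,y_1,y_2,\dots)$ is the element $\ell_n(X)\in\mathbb Z/p^n\mathbb Z$ given, for odd $p$, by $$\ell_n(X)=q_n^{\,x p^{n-1}+y_{n-1}(p-1)}\qquad(\text{with } y_0=0),$$ and for $p=2$ by $\ell_1(X)=1$, $\ell_2(X)=(-1)^x$,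 and $\ell_n(X)=(-1)^x\,5^{\,y_{n-2}}$ for $n\ge3$. **Theorem.** For every prime $p$: 1. $T_p^\times$ is a computable tree presentation. 2. It presents $\mathbb Z_p^\times$: there is a group isomorphism $e$ from $\mathcal A_{T_p^\times}$ onto $\mathbb Z_p^\times$ such that $e(X)\equiv \ell_n(X) \pmod{p^n}$ for every path $X$ and every $n\ge1$. (In particular $\ell_n(XY)=\ell_n(X)\ell_n(Y)$.) 3. $T_p^\times$ is tree-decidable. -/

import Mathlib

open FirstOrder

namespace TreePres

noncomputable section

/-! ### Turing functionals -/

/-- Programs of oracle machines: the partial recursive programs together with one instruction that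
queries the oracle.  A program does not depend on the oracle it is run with, so it is (an index of)
a Turing functional. -/
inductive OracleCode : Type
  | zero : OracleCode
  | succ : OracleCode
  | left : OracleCode
  | right : OracleCode
  | oracle : OracleCode
  | pair : OracleCode → OracleCode → OracleCode
  | comp : OracleCode → OracleCode → OracleCode
  | prec : OracleCode → OracleCode → OracleCode
  | rfind : OracleCode → OracleCode

/-- `c.eval g n` is the (possibly undefined) result of running the program `c` with oracle
`g : ℕ → ℕ` on the input `n`. -/
def OracleCode.eval (g : ℕ → ℕ) : OracleCode → ℕ →. ℕ
  | .zero => fun _ => Part.some 0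
  | .succ => fun n => Part.some (n + 1)
  | .left => fun n => Part.some n.unpair.1
  | .right => fun n => Part.some n.unpair.2
  | .oracle => fun n => Part.some (g n)
  | .pair c d => fun n => Nat.pair <$> c.eval g n <*> d.eval g n
  | .comp c d => fun n => d.eval g n >>= c.eval g
  | .prec c d => fun m =>
      m.unpair.2.rec (c.eval g m.unpair.1) fun y ih => do
        let i ← ih
        d.eval g (Nat.pair m.unpair.1 (Nat.pair y i))
  | .rfind c => fun a =>
      Nat.rfind fun n => (fun m => decide (m = 0)) <$> c.eval g (Nat.pair a n)

/-- The join `X₁ ⊕ ⋯ ⊕ Xₙ` of finitely many functions `ℕ → ℕ`: its value at `⟨i, k⟩` is the `k`-th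
value of the `i`-th function (and `0` if there is no `i`-th function). -/
def joinTuple {n : ℕ} (X : Fin n → ℕ → ℕ) : ℕ → ℕ := fun m =>
  if h : m.unpair.1 < n then X ⟨m.unpair.1, h⟩ m.unpair.2 else 0

/-- The join `f ⊕ g`: `f` on the even numbers and `g` on the odd ones. -/
def join (f g : ℕ → ℕ) : ℕ → ℕ := fun m => if m % 2 = 0 then f (m / 2) else g (m / 2)

open Classical in
/-- The characteristic function of a set of natural numbers. -/
def charFun (D : Set ℕ) : ℕ → ℕ := fun m => if m ∈ D then 1 else 0

/-- `B` is an enumeration of `A`: viewed as a set of pairs, `B` projects onto `A`. -/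
def IsEnumeration (B A : Set ℕ) : Prop := A = {x | ∃ y, Nat.pair x y ∈ B}

/-! ### Gödel numbers of first-order formulas -/

section Goedel

variable {L : FirstOrder.Language.{0, 0}} [Encodable (Σ n, L.Functions n)]

/-- Gödel number of a term, given numbers for the variables. -/
def termCode {α : Type} (v : α → ℕ) : L.Term α → ℕ
  | .var a => Nat.pair 0 (v a)
  | .func (l := l) f ts =>
      Nat.pair 1 (Nat.pair (Encodable.encode (⟨l, f⟩ : Σ n, L.Functions n))
        (Encodable.encode (List.ofFn fun i => termCode v (ts i))))

/-- Numbers of variables: the free variables `x₀, …, xₙ₋₁` get the even numbers, the bound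
variables the odd ones. -/
def varCode {n k : ℕ} : Fin n ⊕ Fin k → ℕ
  | .inl i => 2 * i
  | .inr j => 2 * j + 1

/-- Gödel number of a formula in a language without relation symbols (other than equality). -/
def formulaCode [L.IsAlgebraic] {n : ℕ} : ∀ {k : ℕ}, L.BoundedFormula (Fin n) k → ℕ
  | _, .falsum => Nat.pair 0 0
  | _, .equal t s => Nat.pair 1 (Nat.pair (termCode varCode t) (termCode varCode s))
  | _, .rel R _ => isEmptyElim R
  | _, .imp φ ψ => Nat.pair 2 (Nat.pair (formulaCode φ) (formulaCode ψ))
  | _, .all φ => Nat.pair 3 (formulaCode φ)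

end Goedel

/-! ### Tree presentations -/

/-- The infinite paths through a set of nodes `T ⊆ ω^{<ω}`: all initial segments lie in `T`. -/
def paths (T : Set (List ℕ)) : Set (ℕ → ℕ) :=
  {X | ∀ n, (List.range n).map X ∈ T}

/-- A set `T` of nodes in `ω^{<ω}` with an `L`-structure on its set of paths `[T]`. -/
structure TreeStructure (L : FirstOrder.Language.{0, 0}) where
  tree : Set (List ℕ)
  str : L.Structure (paths tree)

namespace TreeStructure

variable {L : FirstOrder.Language.{0, 0}}

/-- The domain `[T]` of the presented structure `𝒜_T`. -/
abbrev Path (T : TreeStructure L) : Type := paths T.tree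

instance (T : TreeStructure L) : L.Structure T.Path := T.str

/-- `T` is a computable tree presentation: the nodes form a computable subtree of `ω^{<ω}` in which
every node is extendible to a path, and the operations on paths are computed by Turing functionals,
uniformly in the function symbol (which is automatic in a finite signature). -/
structure IsComputablePresentation [Encodable (Σ n, L.Functions n)] (T : TreeStructure L) :
    Prop where
  prefix_closed : ∀ σ τ : List ℕ, σ <+: τ → τ ∈ T.tree → σ ∈ T.tree
  computable_tree : ComputablePred fun σ : List ℕ => σ ∈ T.tree
  extendible : ∀ σ ∈ T.tree, ∃ X : T.Path, (List.range σ.length).map X.1 = σ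
  computable_operations : ∃ Φ : OracleCode, ∀ (n : ℕ) (f : L.Functions n) (X : Fin n → T.Path)
    (k : ℕ), Φ.eval (joinTuple fun i => (X i).1)
        (Nat.pair (Encodable.encode (⟨n, f⟩ : Σ n, L.Functions n)) k) =
      Part.some ((FirstOrder.Language.Structure.funMap f X).1 k)

/-- The positive atomic diagram of a tuple of paths: the Gödel numbers of the atomic formulas that
are true of the tuple.  The free variable `xᵢ` serves as the name of the `i`-th path. -/
def positiveAtomicDiagram [Encodable (Σ n, L.Functions n)] [L.IsAlgebraic] (T : TreeStructure L)
    {n : ℕ} (X : Fin n → T.Path) : Set ℕ :=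
  {m | ∃ α : L.Formula (Fin n), FirstOrder.Language.BoundedFormula.IsAtomic α ∧ α.Realize X ∧
    formulaCode α = m}

/-- `T` is tree-decidable: one Turing functional `Φ`, given a tuple of paths and any enumeration of
its positive atomic diagram as oracle, decides for every formula whether the tuple satisfies it. -/
def TreeDecidable [Encodable (Σ n, L.Functions n)] [L.IsAlgebraic] (T : TreeStructure L) : Prop :=
  ∃ Φ : OracleCode, ∀ (n : ℕ) (α : L.Formula (Fin n)) (X : Fin n → T.Path) (D : Set ℕ),
    IsEnumeration D (T.positiveAtomicDiagram X) →
      (α.Realize X →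
        Φ.eval (join (joinTuple fun i => (X i).1) (charFun D)) (formulaCode α) = Part.some 1) ∧
      (¬ α.Realize X →
        Φ.eval (join (joinTuple fun i => (X i).1) (charFun D)) (formulaCode α) = Part.some 0)

end TreeStructure

/-! ### The signature of groups -/

/-- The function symbols of the signature of groups. -/
inductive GroupFunc : ℕ → Type
  | mul : GroupFunc 2
  | inv : GroupFunc 1
  | one : GroupFunc 0

/-- The first-order language of groups `(·, ⁻¹, 1)`. -/
def groupLang : FirstOrder.Language.{0, 0} := ⟨GroupFunc, fun _ => Empty⟩

instance : groupLang.IsAlgebraic := fun _ => inferInstanceAs (IsEmpty Empty)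

/-- The three symbols `·, ⁻¹, 1` are numbered `0, 1, 2`. -/
instance : Encodable (Σ n, groupLang.Functions n) where
  encode
    | ⟨_, GroupFunc.mul⟩ => 0
    | ⟨_, GroupFunc.inv⟩ => 1
    | ⟨_, GroupFunc.one⟩ => 2
  decode
    | 0 => some ⟨2, GroupFunc.mul⟩
    | 1 => some ⟨1, GroupFunc.inv⟩
    | 2 => some ⟨0, GroupFunc.one⟩
    | _ => none
  encodek := by rintro ⟨_, _ | _ | _⟩ <;> rfl

/-- The structure in the language of groups given by three operations. -/
@[reducible] def mkGroupStructure {M : Type} (mul : M → M → M) (inv : M → M) (one : M) :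
    groupLang.Structure M where
  funMap {_} f :=
    match f with
    | GroupFunc.mul => fun x => mul (x 0) (x 1)
    | GroupFunc.inv => fun x => inv (x 0)
    | GroupFunc.one => fun _ => one
  RelMap {_} r := nomatch r

/-- Every group is a structure in the language of groups. -/
instance (G : Type) [Group G] : groupLang.Structure G :=
  mkGroupStructure (fun a b => a * b) (fun a => a⁻¹) 1

/-! ### The tree `T_p^×` -/

/-- The tree `T_p^+` of the additive group of `p`-adic integers: tuples `(k₁, …, kₙ)` with
`0 ≤ kᵢ < p ^ i` and `kᵢ₊₁ ≡ kᵢ mod p ^ i`; here `kᵢ` is the list entry number `i - 1`. -/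
def plusTree (p : ℕ) : Set (List ℕ) :=
  {σ | (∀ (i : ℕ) (h : i < σ.length), σ[i] < p ^ (i + 1)) ∧
    ∀ (i : ℕ) (h : i + 1 < σ.length), σ[i + 1] ≡ σ[i] [MOD p ^ (i + 1)]}

/-- The order of the finite cyclic factor of `ℤ_pˣ`: `p - 1` for odd `p`, and `2` for `p = 2`. -/
def torsionOrder (p : ℕ) : ℕ := if p = 2 then 2 else p - 1

/-- The tree `T_p^×`: above the root there is one node for each element `x` of the finite cyclic
factor, and each of these nodes is the root of a copy of `T_p^+`. -/
def timesTree (p : ℕ) : Set (List ℕ) :=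
  {τ | ∀ x σ, τ = x :: σ → x < torsionOrder p ∧ σ ∈ plusTree p}

theorem mem_paths_timesTree {p : ℕ} {X : ℕ → ℕ} :
    X ∈ paths (timesTree p) ↔ X 0 < torsionOrder p ∧
      ∀ i, X (i + 1) < p ^ (i + 1) ∧ X (i + 2) ≡ X (i + 1) [MOD p ^ (i + 1)] := by
  have key : ∀ n, (List.range (n + 1)).map X = X 0 :: (List.range n).map (fun i => X (i + 1)) := by
    intro n
    simp [List.range_succ_eq_map, Function.comp_def]
  constructor
  · intro h
    refine ⟨(h 1 (X 0) [] (by simp)).1, fun i => ?_⟩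
    have h2 := (h (i + 3) _ _ (key (i + 2))).2
    have h3 := h2.1 i (by simp)
    have h4 := h2.2 i (by simp)
    simp only [List.getElem_map, List.getElem_range] at h3 h4
    exact ⟨h3, h4⟩
  · rintro ⟨h0, h⟩ n x σ e
    cases n with
    | zero => simp at e
    | succ n =>
      rw [key n] at e
      obtain ⟨rfl, rfl⟩ := List.cons.inj e
      refine ⟨h0, fun i hi => ?_, fun i hi => ?_⟩
      · simpa using (h i).1
      · simpa using (h i).2

section Operations

variable {p : ℕ} [hp : Fact p.Prime]

theorem torsionOrder_pos (p : ℕ) [hp : Fact p.Prime] : 0 < torsionOrder p := by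
  have := hp.out.two_le
  unfold torsionOrder
  split <;> omega

/-- The modulus of the coordinate number `i` of a path: `|torsion|, p, p ^ 2, …`. -/
def modulus (p : ℕ) : ℕ → ℕ
  | 0 => torsionOrder p
  | i + 1 => p ^ (i + 1)

/-- The group operation on paths: coordinatewise addition, that is, the operation of the product
of the finite cyclic factor with `ℤ_p^+`. -/
def timesMul (X Y : paths (timesTree p)) : paths (timesTree p) :=
  ⟨fun i => (X.1 i + Y.1 i) % modulus p i, by
    obtain ⟨-, hX⟩ := mem_paths_timesTree.1 X.2
    obtain ⟨-, hY⟩ := mem_paths_timesTree.1 Y.2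
    refine mem_paths_timesTree.2 ⟨Nat.mod_lt _ (torsionOrder_pos p), fun i =>
      ⟨Nat.mod_lt _ (pow_pos hp.out.pos _), ?_⟩⟩
    have h1 : (X.1 (i + 2) + Y.1 (i + 2)) % p ^ (i + 2) ≡ X.1 (i + 2) + Y.1 (i + 2)
        [MOD p ^ (i + 1)] :=
      (Nat.mod_modEq _ _).of_dvd (pow_dvd_pow p (Nat.le_succ _))
    exact (h1.trans ((hX i).2.add (hY i).2)).trans (Nat.mod_modEq _ _).symm⟩

/-- The inverse of a path: coordinatewise negation. -/
def timesInv (X : paths (timesTree p)) : paths (timesTree p) :=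
  ⟨fun i => (modulus p i - X.1 i) % modulus p i, by
    obtain ⟨-, hX⟩ := mem_paths_timesTree.1 X.2
    refine mem_paths_timesTree.2 ⟨Nat.mod_lt _ (torsionOrder_pos p), fun i =>
      ⟨Nat.mod_lt _ (pow_pos hp.out.pos _), ?_⟩⟩
    have h1 : (p ^ (i + 2) - X.1 (i + 2)) % p ^ (i + 2) ≡ p ^ (i + 2) - X.1 (i + 2)
        [MOD p ^ (i + 1)] :=
      (Nat.mod_modEq _ _).of_dvd (pow_dvd_pow p (Nat.le_succ _))
    have h2 : p ^ (i + 2) - X.1 (i + 2) ≡ p ^ (i + 1) - X.1 (i + 1) [MOD p ^ (i + 1)] := by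
      refine Nat.ModEq.add_right_cancel (hX i).2 ?_
      rw [Nat.sub_add_cancel (hX (i + 1)).1.le, Nat.sub_add_cancel (hX i).1.le]
      have h3 : p ^ (i + 2) ≡ 0 [MOD p ^ (i + 1)] :=
        (Nat.modEq_zero_iff_dvd).2 (pow_dvd_pow p (Nat.le_succ _))
      exact h3.trans ((Nat.modEq_zero_iff_dvd).2 dvd_rfl).symm
    exact (h1.trans h2).trans (Nat.mod_modEq _ _).symm⟩

/-- The identity: the path `(0, 0, 0, …)`. -/
def timesOne : paths (timesTree p) :=
  ⟨fun _ => 0, mem_paths_timesTree.2 ⟨torsionOrder_pos p, fun _ =>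
    ⟨pow_pos hp.out.pos _, Nat.ModEq.refl _⟩⟩⟩

end Operations

/-- The tree presentation `T_p^×`. -/
def timesPresentation (p : ℕ) [Fact p.Prime] : TreeStructure groupLang where
  tree := timesTree p
  str := mkGroupStructure timesMul timesInv timesOne

/-! ### The labels: how the paths of `T_p^×` name the units of `ℤ_p` -/

/-- The residue class of `q` generates the multiplicative group `(ℤ/mℤ)ˣ`. -/
def IsGenerator (m q : ℕ) : Prop :=
  ∃ u : (ZMod m)ˣ, (u : ZMod m) = (q : ZMod m) ∧ ∀ v : (ZMod m)ˣ, v ∈ Subgroup.zpowers u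

/-- For odd `p`, `unitGen p n` is the generator `qₙ` of `(ℤ/pⁿℤ)ˣ` (`n ≥ 1`): `q₁` is the least
generator, and `qₙ₊₁` is the least generator that is congruent to `qₙ` modulo `pⁿ`.
(The value at `n = 0` is not used.) -/
def unitGen (p : ℕ) : ℕ → ℕ
  | 0 => 0
  | 1 => sInf {q | IsGenerator (p ^ 1) q}
  | n + 2 => sInf {q | IsGenerator (p ^ (n + 2)) q ∧ q ≡ unitGen p (n + 1) [MOD p ^ (n + 1)]}

/-- The label in `ℤ/pⁿℤ` (`n ≥ 1`) given by a path `X = (x, y₁, y₂, …)` of `T_p^×`.  For odd `p` it is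
`qₙ ^ (x * p ^ (n - 1) + yₙ₋₁ * (p - 1))`, where `y₀ = 0`.  For `p = 2` it is `1` if `n = 1`, it is
`(-1) ^ x` if `n = 2`, and it is `(-1) ^ x * 5 ^ yₙ₋₂` if `n ≥ 3`. -/
def label (p : ℕ) (X : ℕ → ℕ) (n : ℕ) : ZMod (p ^ n) :=
  if p = 2 then
    if n = 1 then 1
    else if n = 2 then (-1) ^ X 0
    else (-1) ^ X 0 * 5 ^ X (n - 2)
  else
    (unitGen p n : ZMod (p ^ n)) ^
      (X 0 * p ^ (n - 1) + (if n = 1 then 0 else X (n - 1)) * (p - 1))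

end

end TreePres

/-! Computability of the presentation is elementary: membership in the tree is a bounded condition
on a finite list, and each coordinate of a product or an inverse depends only on the same coordinate
of the arguments.

For the isomorphism, `CompatibleGenerators` records integers `a i`, `b i` that split the units
modulo `p ^ (i + d)` into cyclic factors of orders `torsionOrder p` and `p ^ i`. Compatibility makes
the residues `a i ^ x * b i ^ yᵢ` along a path converge to a `p`-adic unit, and bijectivity at each
finite level passes to the limit (`CompatibleGenerators.exists_equiv`). For odd `p` the generators
are the powers `q ^ p ^ i` and `q ^ (p - 1)` of `q = unitGen p (i + 1)`, with `d = 1`; for `p = 2`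
they are `-1` and `5`, with `d = 2`.

Tree-decidability rests on an effective back-and-forth argument in `(ℤ/rℤ) × ℤ_p`, where `r` is
`torsionOrder p`. Two tuples in `ℤ_p` are `Similar` to level `N` if they agree modulo `p ^ N` and
satisfy the same integer linear relations with coefficients up to `N`. Similarity to level `2N² +
2N` lets any new element on one side be matched on the other so that level `N` remains
(`Similar.exists_extension`): either the new element solves a small linear equation, and the same
equation is solvable on the other side because divisibility by a small integer is visible modulo a
power of `p`; or it solves none, and a sufficiently close generic element does the job.

If one side consists of integers, the matching element can be taken from an explicit finite set of
integers, after the tuple is scaled by some `D ≡ 1` modulo a power of `p`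
(`Similar.exists_integer_extension`). Quantifiers over `ℤ_p` thus become finite conjunctions, so
truth at an integer tuple is primitive recursive, and it transfers to every tuple that is similar to
a high enough level (`truthValue_correct`).

It remains to find a similar integer tuple from the oracle. Congruences are read off the paths. A
true relation eventually shows up in the enumerated diagram, once exponents are multiplied by `r` to
kill the torsion part; a false one is refuted by a coordinate. Hence the search for a verified
candidate terminates (`exists_accepts`), and every accepted candidate gives the right answer
(`Accepts.iff_realize`). -/

namespace TreePres

/-! ### Oracle machines: basic programs -/

/-- Every partial recursive function is computed by an oracle program that ignores its oracle. -/
theorem OracleCode.exists_eval_eq_of_partrec {f : ℕ →. ℕ} (hf : Nat.Partrec f) :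
    ∃ c : OracleCode, ∀ g, c.eval g = f := by
  induction hf with
  | zero => exact ⟨.zero, fun g => rfl⟩
  | succ => exact ⟨.succ, fun g => rfl⟩
  | left => exact ⟨.left, fun g => rfl⟩
  | right => exact ⟨.right, fun g => rfl⟩
  | pair _ _ ihf ihh =>
    obtain ⟨c, hc⟩ := ihf
    obtain ⟨d, hd⟩ := ihh
    exact ⟨.pair c d, fun g => by simp only [OracleCode.eval, hc, hd]; rfl⟩
  | comp _ _ ihf ihh =>
    obtain ⟨c, hc⟩ := ihf
    obtain ⟨d, hd⟩ := ihh
    exact ⟨.comp c d, fun g => by simp only [OracleCode.eval, hc, hd]; rfl⟩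
  | prec _ _ ihf ihh =>
    obtain ⟨c, hc⟩ := ihf
    obtain ⟨d, hd⟩ := ihh
    exact ⟨.prec c d, fun g => by simp only [OracleCode.eval, hc, hd]; rfl⟩
  | rfind _ ihf =>
    obtain ⟨c, hc⟩ := ihf
    exact ⟨.rfind c, fun g => by simp only [OracleCode.eval, hc]; rfl⟩

theorem OracleCode.eval_comp_of_eq {g : ℕ → ℕ} {c d : OracleCode} {n x : ℕ} {y : Part ℕ}
    (hd : d.eval g n = Part.some x) (hc : c.eval g x = y) : (comp c d).eval g n = y := by
  simp only [eval, hd]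
  exact (Part.bind_some x _).trans hc

theorem OracleCode.eval_pair_of_eq {g : ℕ → ℕ} {c d : OracleCode} {n x y : ℕ}
    (hc : c.eval g n = Part.some x) (hd : d.eval g n = Part.some y) :
    (pair c d).eval g n = Part.some (Nat.pair x y) := by
  simp [eval, hc, hd, Seq.seq]

/-- `F g n` is computed from the oracle `g` and the input `n` by one total oracle program. -/
def TotalOracleComputable (F : (ℕ → ℕ) → ℕ → ℕ) : Prop :=
  ∃ c : OracleCode, ∀ g n, c.eval g n = Part.some (F g n)

namespace TotalOracleComputable

theorem of_computable {f : ℕ → ℕ} (hf : Computable f) :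
    TotalOracleComputable fun _ n => f n := by
  obtain ⟨c, hc⟩ := OracleCode.exists_eval_eq_of_partrec (Partrec.nat_iff.1 hf)
  exact ⟨c, fun g n => by rw [hc]; rfl⟩

theorem query {F : (ℕ → ℕ) → ℕ → ℕ} (hF : TotalOracleComputable F) :
    TotalOracleComputable fun g n => g (F g n) := by
  obtain ⟨c, hc⟩ := hF
  exact ⟨.comp .oracle c, fun g n => OracleCode.eval_comp_of_eq (hc g n) rfl⟩

theorem pair {F G : (ℕ → ℕ) → ℕ → ℕ} (hF : TotalOracleComputable F)
    (hG : TotalOracleComputable G) :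
    TotalOracleComputable fun g n => Nat.pair (F g n) (G g n) := by
  obtain ⟨c, hc⟩ := hF
  obtain ⟨d, hd⟩ := hG
  exact ⟨.pair c d, fun g n => OracleCode.eval_pair_of_eq (hc g n) (hd g n)⟩

theorem comp {f : ℕ → ℕ} {F : (ℕ → ℕ) → ℕ → ℕ} (hf : Computable f)
    (hF : TotalOracleComputable F) : TotalOracleComputable fun g n => f (F g n) := by
  obtain ⟨c, hc⟩ := hF
  obtain ⟨d, hd⟩ := of_computable hf
  exact ⟨.comp d c, fun g n => OracleCode.eval_comp_of_eq (hc g n) (hd g _)⟩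

end TotalOracleComputable

/-- The initial segment of length `s` of an oracle, in reversed order. -/
def reversedPrefix (g : ℕ → ℕ) : ℕ → List ℕ
  | 0 => []
  | s + 1 => g s :: reversedPrefix g s

theorem reverse_reversedPrefix (g : ℕ → ℕ) (s : ℕ) :
    (reversedPrefix g s).reverse = (List.range s).map g := by
  induction s with
  | zero => rfl
  | succ s ih => simp [reversedPrefix, ih, List.range_succ]

/-- Reversal suits the recursion instruction: putting the next oracle value in front of a list is,
on codes, one pairing followed by a successor. -/
theorem TotalOracleComputable.reversedPrefix :
    TotalOracleComputable fun g n => Encodable.encode (TreePres.reversedPrefix g n.unpair.2) := by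
  have h : TotalOracleComputable fun g m => (Nat.pair (g m.unpair.2.unpair.1)
      m.unpair.2.unpair.2).succ := by
    refine comp (Primrec.succ.to_comp) (pair (query (of_computable ?_)) (of_computable ?_))
    · exact (Primrec.fst.comp (Primrec.unpair.comp (Primrec.snd.comp Primrec.unpair))).to_comp
    · exact (Primrec.snd.comp (Primrec.unpair.comp (Primrec.snd.comp Primrec.unpair))).to_comp
  obtain ⟨c, hc⟩ := h
  refine ⟨.prec .zero c, fun g n => ?_⟩
  simp only [OracleCode.eval]
  induction n.unpair.2 with
  | zero => rfl
  | succ s ih =>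
    simp only [ih]
    refine (Part.bind_some _ _).trans ((hc g _).trans ?_)
    simp [TreePres.reversedPrefix]

/-- An unbounded search, in which every candidate is tested together with a finite initial segment
of the oracle, is carried out by an oracle program.  The result is read off from the input and the
candidate that the search finds. -/
theorem exists_search_program {check : ℕ × ℕ × List ℕ → Bool} {out : ℕ → ℕ → ℕ}
    (hcheck : Computable check) (hout : Computable₂ out) :
    ∃ Φ : OracleCode, ∀ (g : ℕ → ℕ) (a : ℕ),
      (∃ n, check (a, n, (List.range n.unpair.2).map g) = true) →
      ∃ n, check (a, n, (List.range n.unpair.2).map g) = true ∧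
        Φ.eval g a = Part.some (out a n) := by
  -- Success is coded as 0 because minimization looks for a zero. The prefix arrives as the code of
  -- a reversed list, hence the decoding and the second reversal; the default `[]` never occurs on
  -- such codes.
  have hf : Computable fun m : ℕ => cond (check (m.unpair.1.unpair.1, m.unpair.1.unpair.2,
      ((Encodable.decode (α := List ℕ) m.unpair.2).getD []).reverse)) 0 1 := by
    refine Computable.cond (hcheck.comp (Computable.pair ?_ (Computable.pair ?_ ?_)))
      (Computable.const 0) (Computable.const 1)
    · exact (Primrec.fst.comp (Primrec.unpair.comp (Primrec.fst.comp Primrec.unpair))).to_comp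
    · exact (Primrec.snd.comp (Primrec.unpair.comp (Primrec.fst.comp Primrec.unpair))).to_comp
    · exact (Primrec.list_reverse.comp (Primrec.option_getD.comp
        (Primrec.decode.comp (Primrec.snd.comp Primrec.unpair)) (Primrec.const []))).to_comp
  obtain ⟨c, hc⟩ : TotalOracleComputable fun g m =>
      cond (check (m.unpair.1, m.unpair.2, (List.range m.unpair.2.unpair.2).map g)) 0 1 := by
    obtain ⟨d, hd⟩ := TotalOracleComputable.reversedPrefix
    obtain ⟨c, hc⟩ := TotalOracleComputable.of_computable hf
    refine ⟨.comp c (.pair (.pair .left .right) (.comp d .right)), fun g m =>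
      OracleCode.eval_comp_of_eq (OracleCode.eval_pair_of_eq (OracleCode.eval_pair_of_eq rfl rfl)
        (OracleCode.eval_comp_of_eq rfl (hd g _))) ((hc g _).trans ?_)⟩
    simp [reverse_reversedPrefix]
  obtain ⟨o, ho⟩ := TotalOracleComputable.of_computable
    (f := fun m => out m.unpair.1 m.unpair.2)
    (hout.comp (Primrec.fst.comp Primrec.unpair).to_comp (Primrec.snd.comp Primrec.unpair).to_comp)
  refine ⟨.comp o (.pair (.pair .left .right) (.rfind c)), fun g a hex => ?_⟩
  refine ⟨Nat.find hex, Nat.find_spec hex, OracleCode.eval_comp_of_eq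
    (OracleCode.eval_pair_of_eq (OracleCode.eval_pair_of_eq rfl rfl) (?_ :
      (OracleCode.rfind c).eval g a = Part.some (Nat.find hex))) ((ho g _).trans (by simp))⟩
  simp only [OracleCode.eval, hc]
  refine Part.eq_some_iff.2 (Nat.mem_rfind.2 ⟨?_, fun {m} hm => ?_⟩)
  · have h := Nat.find_spec hex
    simp only [Nat.unpair_pair] at h ⊢
    simp [h]
  · have h := Nat.find_min hex hm
    simp only [Nat.unpair_pair, Bool.not_eq_true] at h ⊢
    simp [h]

/-! ### Primitive recursive tools -/

theorem primrec_nat_pow : Primrec₂ ((· ^ ·) : ℕ → ℕ → ℕ) :=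
  Primrec₂.unpaired'.1 Nat.Primrec.pow

theorem primrecPred_forall_lt {α : Type*} [Primcodable α] {f : α → ℕ} {q : α → ℕ → Prop}
    (hf : Primrec f) (hq : PrimrecPred fun x : α × ℕ => q x.1 x.2) :
    PrimrecPred fun a => ∀ i < f a, q a i := by
  have h : PrimrecRel fun (i : ℕ) (a : α) => q a i :=
    PrimrecPred.primrecRel (hq.comp (Primrec.pair Primrec.snd Primrec.fst))
  exact ((PrimrecRel.forall_mem_list h).comp (Primrec.list_range.comp hf) Primrec.id).of_eq
    fun a => by simp

theorem primrecPred_exists_lt {α : Type*} [Primcodable α] {f : α → ℕ} {q : α → ℕ → Prop}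
    (hf : Primrec f) (hq : PrimrecPred fun x : α × ℕ => q x.1 x.2) :
    PrimrecPred fun a => ∃ i < f a, q a i := by
  have h : PrimrecRel fun (i : ℕ) (a : α) => q a i :=
    PrimrecPred.primrecRel (hq.comp (Primrec.pair Primrec.snd Primrec.fst))
  exact ((PrimrecRel.exists_mem_list h).comp (Primrec.list_range.comp hf) Primrec.id).of_eq
    fun a => by simp

/-! ### `T_p^×` is a computable tree presentation -/

/-- With total access through `getD` and all indices bounded by the length, the condition is visibly
primitive recursive. The index here counts from the torsion entry, so it is shifted by one against
`plusTree`. -/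
theorem mem_timesTree_iff (p : ℕ) (σ : List ℕ) :
    σ ∈ timesTree p ↔ (0 < σ.length → σ.getD 0 0 < torsionOrder p) ∧
      ∀ i < σ.length, (i + 1 < σ.length → σ.getD (i + 1) 0 < p ^ (i + 1)) ∧
        (i + 2 < σ.length →
          σ.getD (i + 2) 0 % p ^ (i + 1) = σ.getD (i + 1) 0 % p ^ (i + 1)) := by
  cases σ with
  | nil => simp [timesTree]
  | cons x τ =>
    constructor
    · intro h
      obtain ⟨h0, h1, h2⟩ := h x τ rfl
      refine ⟨by simpa using h0, fun i _ => ⟨fun hi => ?_, fun hi => ?_⟩⟩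
      · have hi' : i < τ.length := by simpa using hi
        simpa [List.getD_eq_getElem?_getD, hi'] using h1 i hi'
      · have hi' : i + 1 < τ.length := by rw [List.length_cons] at hi; omega
        have hi'' : i < τ.length := by omega
        simpa [List.getD_eq_getElem?_getD, hi', hi'', Nat.ModEq] using h2 i hi'
    · rintro ⟨h0, h⟩ x' τ' e
      obtain ⟨rfl, rfl⟩ := List.cons.inj e
      refine ⟨by simpa using h0, fun i hi => ?_, fun i hi => ?_⟩
      · have := (h i (by simp; omega)).1 (by simpa using hi)
        simpa [List.getD_eq_getElem?_getD, hi] using this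
      · have hi'' : i < τ.length := by omega
        have := (h i (by simp; omega)).2 (by rw [List.length_cons]; omega)
        simpa [List.getD_eq_getElem?_getD, hi, hi'', Nat.ModEq] using this

theorem computablePred_mem_timesTree (p : ℕ) :
    ComputablePred fun σ : List ℕ => σ ∈ timesTree p := by
  have hget : Primrec fun x : List ℕ × ℕ => x.1.getD x.2 0 := Primrec.list_getD 0
  have hpow : Primrec fun x : List ℕ × ℕ => p ^ (x.2 + 1) :=
    primrec_nat_pow.comp (Primrec.const p) (Primrec.succ.comp Primrec.snd)
  have hlen : Primrec fun x : List ℕ × ℕ => x.1.length := Primrec.list_length.comp Primrec.fst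
  have hs1 : Primrec fun x : List ℕ × ℕ => x.2 + 1 := Primrec.succ.comp Primrec.snd
  have hs2 : Primrec fun x : List ℕ × ℕ => x.2 + 2 := Primrec.succ.comp hs1
  have hg1 : Primrec fun x : List ℕ × ℕ => x.1.getD (x.2 + 1) 0 :=
    (Primrec.list_getD 0).comp Primrec.fst hs1
  have hg2 : Primrec fun x : List ℕ × ℕ => x.1.getD (x.2 + 2) 0 :=
    (Primrec.list_getD 0).comp Primrec.fst hs2
  have imp : ∀ {α : Type} [Primcodable α] {q r : α → Prop}, PrimrecPred q → PrimrecPred r →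
      PrimrecPred fun a => q a → r a := fun hq hr =>
    (hq.not.or hr).of_eq fun a => imp_iff_not_or.symm
  have key : PrimrecPred fun σ : List ℕ => (0 < σ.length → σ.getD 0 0 < torsionOrder p) ∧
      ∀ i < σ.length, (i + 1 < σ.length → σ.getD (i + 1) 0 < p ^ (i + 1)) ∧
        (i + 2 < σ.length →
          σ.getD (i + 2) 0 % p ^ (i + 1) = σ.getD (i + 1) 0 % p ^ (i + 1)) := by
    refine PrimrecPred.and (imp (Primrec.nat_lt.comp (Primrec.const 0) Primrec.list_length)
      (Primrec.nat_lt.comp ((Primrec.list_getD 0).comp Primrec.id (Primrec.const 0))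
        (Primrec.const _))) (primrecPred_forall_lt Primrec.list_length ?_)
    exact (imp (Primrec.nat_lt.comp hs1 hlen) (Primrec.nat_lt.comp hg1 hpow)).and
      (imp (Primrec.nat_lt.comp hs2 hlen)
        (Primrec.eq.comp (Primrec.nat_mod.comp hg2 hpow) (Primrec.nat_mod.comp hg1 hpow)))
  exact (key.of_eq fun σ => (mem_timesTree_iff p σ).symm).computablePred

theorem timesTree_prefix_closed {p : ℕ} {σ τ : List ℕ} (h : σ <+: τ) (hτ : τ ∈ timesTree p) :
    σ ∈ timesTree p := by
  rintro x κ rfl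
  obtain ⟨ρ, rfl⟩ := h
  obtain ⟨h0, h1, h2⟩ := hτ x (κ ++ ρ) rfl
  refine ⟨h0, fun i hi => ?_, fun i hi => ?_⟩
  · have h3 := h1 i (by simp; omega)
    rwa [List.getElem_append_left hi] at h3
  · have hi' : i < κ.length := by omega
    have h3 := h2 i (by simp; omega)
    rwa [List.getElem_append_left hi, List.getElem_append_left hi'] at h3

section

variable {p : ℕ} [hp : Fact p.Prime]

theorem timesTree_extendible {σ : List ℕ} (hσ : σ ∈ timesTree p) :
    ∃ X : paths (timesTree p), (List.range σ.length).map X.1 = σ := by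
  cases σ with
  | nil => exact ⟨timesOne, rfl⟩
  | cons x κ =>
    obtain ⟨h0, h1, h2⟩ := hσ x κ rfl
    -- The last entry is repeated forever: it stays below the growing bounds and is congruent to
    -- itself. If there is no entry, the default gives the zero sequence.
    set Y : ℕ → ℕ := fun i => κ.getD (min i (κ.length - 1)) 0 with hY
    refine ⟨⟨fun i => Nat.casesOn i x Y, mem_paths_timesTree.2 ⟨h0, fun i => ⟨?_, ?_⟩⟩⟩, ?_⟩
    · change Y i < p ^ (i + 1)
      rcases Nat.eq_zero_or_pos κ.length with hl | hl
      · have : κ = [] := List.length_eq_zero_iff.1 hl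
        subst this
        simpa [hY] using pow_pos hp.out.pos (i + 1)
      · have hm : min i (κ.length - 1) < κ.length := by omega
        have h3 := h1 _ hm
        simp only [hY, List.getD_eq_getElem?_getD, List.getElem?_eq_getElem hm, Option.getD_some]
        exact h3.trans_le (Nat.pow_le_pow_right hp.out.pos (by omega))
    · change Y (i + 1) ≡ Y i [MOD p ^ (i + 1)]
      by_cases hi : i + 1 < κ.length
      · have hi' : i < κ.length := by omega
        have e1 : min i (κ.length - 1) = i := by omega
        have e2 : min (i + 1) (κ.length - 1) = i + 1 := by omega
        simp only [hY, e1, e2, List.getD_eq_getElem?_getD, List.getElem?_eq_getElem hi',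
          List.getElem?_eq_getElem hi, Option.getD_some]
        exact h2 i hi
      · have e : min i (κ.length - 1) = min (i + 1) (κ.length - 1) := by omega
        simp only [hY, e]
        exact Nat.ModEq.refl _
    · refine List.ext_getElem (by simp) fun i hi1 hi2 => ?_
      cases i with
      | zero => simp
      | succ i =>
        have hi : i < κ.length := by simpa using hi2
        have e : min i (κ.length - 1) = i := by omega
        simp [hY, e, hi]

/-- The group operations on paths, coordinatewise, as a function of the number of the function
symbol, the index of the coordinate, and that coordinate of the arguments. -/
def coordinateOperation (p f k a b : ℕ) : ℕ :=
  if f = 0 then (a + b) % modulus p k else if f = 1 then (modulus p k - a) % modulus p k else 0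

theorem primrec_modulus (p : ℕ) : Primrec (modulus p) :=
  (Primrec.ite (Primrec.eq.comp Primrec.id (Primrec.const 0)) (Primrec.const (torsionOrder p))
    (primrec_nat_pow.comp (Primrec.const p) Primrec.id)).of_eq fun n => by
      cases n <;> simp [modulus]

theorem timesPresentation_computable_operations :
    ∃ Φ : OracleCode, ∀ (n : ℕ) (f : groupLang.Functions n)
      (X : Fin n → (timesPresentation p).Path) (k : ℕ),
      Φ.eval (joinTuple fun i => (X i).1)
        (Nat.pair (Encodable.encode (⟨n, f⟩ : Σ n, groupLang.Functions n)) k) =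
      Part.some ((FirstOrder.Language.Structure.funMap f X).1 k) := by
  have hl : Primrec fun n : ℕ => n.unpair.1 := Primrec.fst.comp Primrec.unpair
  have hr : Primrec fun n : ℕ => n.unpair.2 := Primrec.snd.comp Primrec.unpair
  have ha : Primrec fun n : ℕ => n.unpair.2.unpair.1 := hl.comp hr
  have hb : Primrec fun n : ℕ => n.unpair.2.unpair.2 := hr.comp hr
  have hk : Primrec fun n : ℕ => modulus p n.unpair.1.unpair.2 :=
    (primrec_modulus p).comp (hr.comp hl)
  have hF : Primrec fun m : ℕ => coordinateOperation p m.unpair.1.unpair.1 m.unpair.1.unpair.2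
      m.unpair.2.unpair.1 m.unpair.2.unpair.2 := by
    refine Primrec.ite (Primrec.eq.comp (hl.comp hl) (Primrec.const 0))
      (Primrec.nat_mod.comp (Primrec.nat_add.comp ha hb) hk)
      (Primrec.ite (Primrec.eq.comp (hl.comp hl) (Primrec.const 1))
        (Primrec.nat_mod.comp (Primrec.nat_sub.comp hk ha) hk) (Primrec.const 0))
  -- Coordinate `k` of the result needs only coordinate `k` of at most two arguments. An absent
  -- argument is read as 0 by the join, so the same two queries serve all three symbols.
  have hq : ∀ j : ℕ, TotalOracleComputable fun g n => g (Nat.pair j n.unpair.2) := fun j =>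
    .query (.of_computable (Primrec₂.natPair.comp (Primrec.const j) hr).to_comp)
  obtain ⟨Φ, hΦ⟩ := TotalOracleComputable.comp hF.to_comp
    (.pair (.of_computable Computable.id) (.pair (hq 0) (hq 1)))
  refine ⟨Φ, fun n f X k => (hΦ _ _).trans ?_⟩
  cases f with
  | mul =>
    simp only [id, Nat.unpair_pair]
    simp [joinTuple]
    rfl
  | inv =>
    simp only [id, Nat.unpair_pair]
    simp [joinTuple]
    rfl
  | one => 
    simp only [id, Nat.unpair_pair]
    simp [joinTuple]
    rfl

theorem timesPresentation_isComputablePresentation :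
    (timesPresentation p).IsComputablePresentation where
  prefix_closed _ _ := timesTree_prefix_closed
  computable_tree := computablePred_mem_timesTree p
  extendible _ := timesTree_extendible
  computable_operations := timesPresentation_computable_operations

end

/-! ### Limits of compatible residues -/

section Coordinates

variable {p : ℕ}

/-- The coordinate of level `i` of the `ℤ_p^+`-part of a path; at level `0` it is `0`. -/
def plusCoord (X : ℕ → ℕ) (i : ℕ) : ℕ := if i = 0 then 0 else X i

theorem plusCoord_lt (X : paths (timesTree p)) (i : ℕ) : plusCoord X.1 i < p ^ i := by
  cases i with
  | zero => simp [plusCoord]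
  | succ i => exact ((mem_paths_timesTree.1 X.2).2 i).1

theorem plusCoord_succ_modEq (X : paths (timesTree p)) (i : ℕ) :
    plusCoord X.1 (i + 1) ≡ plusCoord X.1 i [MOD p ^ i] := by
  cases i with
  | zero => simp [Nat.modEq_one]
  | succ i => exact ((mem_paths_timesTree.1 X.2).2 i).2

theorem paths_ext {X Y : paths (timesTree p)} (h0 : X.1 0 = Y.1 0)
    (h : ∀ i, plusCoord X.1 i = plusCoord Y.1 i) : X = Y := by
  refine Subtype.ext (funext fun i => ?_)
  cases i with
  | zero => exact h0
  | succ i => exact h (i + 1)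

/-- A path given by its torsion coordinate and by compatible residues. -/
theorem exists_path {x : ℕ} (hx : x < torsionOrder p) {y : ℕ → ℕ} (hy : ∀ i, y i < p ^ i)
    (hyy : ∀ i, y (i + 1) ≡ y i [MOD p ^ i]) :
    ∃ X : paths (timesTree p), X.1 0 = x ∧ ∀ i, plusCoord X.1 i = y i := by
  refine ⟨⟨fun i => if i = 0 then x else y i, mem_paths_timesTree.2 ⟨by simpa using hx,
    fun i => ⟨by simpa using hy (i + 1), by simpa using hyy (i + 1)⟩⟩⟩, by simp, fun i => ?_⟩
  by_cases hi : i = 0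
  · subst hi
    have := hy 0
    simp only [pow_zero, Nat.lt_one_iff] at this
    simp [plusCoord, this]
  · simp [plusCoord, hi]

end Coordinates

section Limits

variable {p : ℕ} [hp : Fact p.Prime]

theorem exists_padicInt_toZModPow_eq (k : ℕ → ℤ) (h : ∀ i, (p : ℤ) ^ i ∣ k (i + 1) - k i) :
    ∃ z : ℤ_[p], ∀ n, PadicInt.toZModPow n z = k n :=
  ⟨_, PadicInt.toZModPow_ofIntSeq_of_pow_dvd_sub k p h⟩

theorem toZModPow_eq_of_le {m n : ℕ} (hmn : m ≤ n) {x y : ℤ_[p]}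
    (h : PadicInt.toZModPow n x = PadicInt.toZModPow n y) :
    PadicInt.toZModPow m x = PadicInt.toZModPow m y := by
  rw [← PadicInt.cast_toZModPow m n hmn, ← PadicInt.cast_toZModPow m n hmn, h]

theorem padicInt_ext_of_toZModPow_add (d : ℕ) {x y : ℤ_[p]}
    (h : ∀ i, PadicInt.toZModPow (i + d) x = PadicInt.toZModPow (i + d) y) : x = y :=
  PadicInt.ext_of_toZModPow.1 fun n => toZModPow_eq_of_le (Nat.le_add_right n d) (h n)

theorem plusCoord_timesMul (X Y : paths (timesTree p)) (i : ℕ) :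
    plusCoord (timesMul X Y).1 i = (plusCoord X.1 i + plusCoord Y.1 i) % p ^ i := by
  cases i with
  | zero => simp [plusCoord]
  | succ i => rfl

theorem plusCoord_timesInv (X : paths (timesTree p)) (i : ℕ) :
    plusCoord (timesInv X).1 i = (p ^ i - plusCoord X.1 i) % p ^ i := by
  cases i with
  | zero => simp [plusCoord]
  | succ i => rfl

theorem plusCoord_timesOne (i : ℕ) : plusCoord (timesOne (p := p)).1 i = 0 := by
  simp [plusCoord, timesOne]

theorem timesMul_timesInv (X : paths (timesTree p)) : timesMul X (timesInv X) = timesOne := by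
  have h1 : X.1 0 < torsionOrder p := (mem_paths_timesTree.1 X.2).1
  refine paths_ext ?_ fun i => ?_
  · change (X.1 0 + (torsionOrder p - X.1 0) % torsionOrder p) % torsionOrder p = 0
    rw [Nat.add_mod_mod, Nat.add_sub_cancel' h1.le, Nat.mod_self]
  · rw [plusCoord_timesMul, plusCoord_timesInv, plusCoord_timesOne, Nat.add_mod_mod,
      Nat.add_sub_cancel' (plusCoord_lt X i).le, Nat.mod_self]

end Limits

/-! ### From compatible generators to an isomorphism onto the units -/

section Units

variable {p : ℕ} [hp : Fact p.Prime]

/-- Integers `a i`, `b i` whose residues exhibit `(ℤ/p^(i+d)ℤ)ˣ` as the direct product of cyclic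
groups of the orders `torsionOrder p` and `p ^ i`, compatibly in `i`. -/
structure CompatibleGenerators (p d : ℕ) (a b : ℕ → ℤ) : Prop where
  torsion_compat : ∀ i, a (i + 1) ≡ a i [ZMOD (p ^ (i + d) : ℕ)]
  free_compat : ∀ i, b (i + 1) ≡ b i [ZMOD (p ^ (i + d) : ℕ)]
  torsion_pow : ∀ i, a i ^ torsionOrder p ≡ 1 [ZMOD (p ^ (i + d) : ℕ)]
  free_pow : ∀ i, b i ^ p ^ i ≡ 1 [ZMOD (p ^ (i + d) : ℕ)]
  independent : ∀ i x y, a i ^ x * b i ^ y ≡ 1 [ZMOD (p ^ (i + d) : ℕ)] →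
    torsionOrder p ∣ x ∧ p ^ i ∣ y
  card_eq : ∀ i, torsionOrder p * p ^ i = (p ^ (i + d)).totient

theorem Int.pow_modEq_of_pow_modEq_one {m b : ℤ} {k x y : ℕ} (hb : b ^ k ≡ 1 [ZMOD m])
    (h : x ≡ y [MOD k]) : b ^ x ≡ b ^ y [ZMOD m] := by
  have key : ∀ z, b ^ z ≡ b ^ (z % k) [ZMOD m] := fun z => by
    conv_lhs => rw [← Nat.div_add_mod z k, pow_add, pow_mul]
    simpa using (hb.pow (z / k)).mul_right (b ^ (z % k))
  have h2 := key x
  rw [show x % k = y % k from h] at h2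
  exact h2.trans (key y).symm

namespace CompatibleGenerators

variable {d : ℕ} {a b : ℕ → ℤ} (H : CompatibleGenerators p d a b)

include H

omit hp in
theorem injective (i : ℕ) {x x' y y' : ℕ} (hx : x < torsionOrder p) (hx' : x' < torsionOrder p)
    (hy : y < p ^ i) (hy' : y' < p ^ i)
    (h : a i ^ x * b i ^ y ≡ a i ^ x' * b i ^ y' [ZMOD (p ^ (i + d) : ℕ)]) :
    x = x' ∧ y = y' := by
  -- Multiplication by the complementary powers turns the right-hand side into 1, so `independent`
  -- applies. The resulting exponent `x + (r - x')` lies strictly between 0 and `2r`, so it must be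
  -- `r`.
  have h1 := h.mul_right (a i ^ (torsionOrder p - x') * b i ^ (p ^ i - y'))
  have e : ∀ u v u' v', a i ^ u * b i ^ v * (a i ^ u' * b i ^ v') =
      a i ^ (u + u') * b i ^ (v + v') := fun u v u' v' => by
    rw [pow_add, pow_add]; ring
  rw [e, e, Nat.add_sub_cancel' hx'.le, Nat.add_sub_cancel' hy'.le] at h1
  have h2 := h1.trans ((H.torsion_pow i).mul (H.free_pow i))
  rw [mul_one] at h2
  obtain ⟨⟨s, hs⟩, ⟨t, ht⟩⟩ := H.independent i _ _ h2
  have key : ∀ {m u v w : ℕ}, u < m → v < m → u + (m - v) = m * w → u = v := by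
    intro m u v w hu hv hw
    have hw1 : w = 1 := by
      have h3 : 0 < w := by
        rcases Nat.eq_zero_or_pos w with rfl | h
        · omega
        · exact h
      have h4 : w < 2 := by
        by_contra h5
        have := Nat.mul_le_mul_left m (not_lt.1 h5)
        omega
      omega
    subst hw1
    omega
  exact ⟨key hx hx' hs, key hy hy' ht⟩

/-- By counting: the exponent pairs inject into the unit group, and `card_eq` says that both sets
have the same size. -/
theorem surjective (i : ℕ) (u : (ZMod (p ^ (i + d)))ˣ) :
    ∃ x < torsionOrder p, ∃ y < p ^ i, (u : ZMod (p ^ (i + d))) = (a i ^ x * b i ^ y : ℤ) := by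
  have : NeZero (p ^ (i + d)) := ⟨pow_ne_zero _ hp.out.ne_zero⟩
  have ha : ((a i : ℤ) : ZMod (p ^ (i + d))) ^ torsionOrder p = 1 := by
    simpa using (ZMod.intCast_eq_intCast_iff _ _ _).2 (H.torsion_pow i)
  have hb : ((b i : ℤ) : ZMod (p ^ (i + d))) ^ p ^ i = 1 := by
    simpa using (ZMod.intCast_eq_intCast_iff _ _ _).2 (H.free_pow i)
  let A := Units.ofPowEqOne _ _ ha (torsionOrder_pos p).ne'
  let B := Units.ofPowEqOne _ _ hb (pow_ne_zero _ hp.out.ne_zero)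
  have hv : ∀ x y : ℕ, ((A ^ x * B ^ y : (ZMod (p ^ (i + d)))ˣ) : ZMod (p ^ (i + d))) =
      (a i ^ x * b i ^ y : ℤ) := fun x y => by simp [A, B]
  let f : Fin (torsionOrder p) × Fin (p ^ i) → (ZMod (p ^ (i + d)))ˣ :=
    fun z => A ^ (z.1 : ℕ) * B ^ (z.2 : ℕ)
  have hf : Function.Injective f := by
    rintro ⟨x, y⟩ ⟨x', y'⟩ h
    have h1 := congrArg (Units.val) h
    rw [hv, hv, ZMod.intCast_eq_intCast_iff] at h1
    obtain ⟨h2, h3⟩ := H.injective i x.2 x'.2 y.2 y'.2 h1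
    exact Prod.ext (Fin.ext h2) (Fin.ext h3)
  have hbij : Function.Bijective f := by
    refine (Fintype.bijective_iff_injective_and_card f).2 ⟨hf, ?_⟩
    rw [ZMod.card_units_eq_totient, Fintype.card_prod, Fintype.card_fin, Fintype.card_fin,
      H.card_eq]
  obtain ⟨⟨x, y⟩, h⟩ := hbij.2 u
  exact ⟨x, x.2, y, y.2, by rw [← h, hv]⟩

omit hp in
-- The exponent of `b i` matters only modulo `p ^ i`, which is precisely what consecutive
-- coordinates of a path share.
theorem value_compat (i x : ℕ) {y y' : ℕ} (h : y' ≡ y [MOD p ^ i]) :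
    a (i + 1) ^ x * b (i + 1) ^ y' ≡ a i ^ x * b i ^ y [ZMOD (p ^ (i + d) : ℕ)] :=
  ((H.torsion_compat i).pow x).mul
    (((H.free_compat i).pow y').trans (Int.pow_modEq_of_pow_modEq_one (H.free_pow i) h))

theorem exists_value (X : paths (timesTree p)) : ∃ z : ℤ_[p], ∀ i,
    PadicInt.toZModPow (i + d) z = (a i ^ X.1 0 * b i ^ plusCoord X.1 i : ℤ) := by
  -- The sequence is indexed by the true exponent of `p`; truncated subtraction makes it constant
  -- below level `d`.
  obtain ⟨z, hz⟩ := exists_padicInt_toZModPow_eq (p := p)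
    (fun n => a (n - d) ^ X.1 0 * b (n - d) ^ plusCoord X.1 (n - d)) fun n => by
      rcases lt_or_ge n d with h | h
      · rw [show n + 1 - d = n - d by omega, sub_self]
        exact dvd_zero _
      · obtain ⟨i, rfl⟩ := Nat.exists_eq_add_of_le' h
        rw [show i + d + 1 - d = i + 1 by omega, Nat.add_sub_cancel]
        have := (H.value_compat i (X.1 0) (plusCoord_succ_modEq X i)).symm.dvd
        exact_mod_cast this
  exact ⟨z, fun i => by rw [hz, Nat.add_sub_cancel]⟩

/-- Everything is checked modulo `p ^ (i + d)`. Surjectivity takes the exponents that represent the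
given unit at each level; their uniqueness forces them to fit together into a path. -/
theorem exists_equiv : ∃ e : (timesPresentation p).Path ≃[groupLang] ℤ_[p]ˣ,
    ∀ (X : (timesPresentation p).Path) (i : ℕ),
      PadicInt.toZModPow (i + d) (e X : ℤ_[p]) = (a i ^ X.1 0 * b i ^ plusCoord X.1 i : ℤ) := by
  choose ψ hψ using H.exists_value
  have hmul : ∀ X Y, ψ (timesMul X Y) = ψ X * ψ Y := fun X Y => by
    refine padicInt_ext_of_toZModPow_add d fun i => ?_
    rw [map_mul, hψ, hψ, hψ, plusCoord_timesMul, ← Int.cast_mul, ZMod.intCast_eq_intCast_iff]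
    have h1 : a i ^ (timesMul X Y).1 0 ≡ a i ^ (X.1 0 + Y.1 0) [ZMOD (p ^ (i + d) : ℕ)] :=
      Int.pow_modEq_of_pow_modEq_one (H.torsion_pow i) (Nat.mod_modEq _ _)
    have h2 := Int.pow_modEq_of_pow_modEq_one (H.free_pow i)
      (Nat.mod_modEq (plusCoord X.1 i + plusCoord Y.1 i) (p ^ i))
    convert h1.mul h2 using 1
    rw [pow_add, pow_add]
    ring
  have hone : ψ timesOne = 1 := by
    refine padicInt_ext_of_toZModPow_add d fun i => ?_
    rw [hψ, plusCoord_timesOne, map_one]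
    simp [timesOne]
  have hinv : ∀ X, ψ X * ψ (timesInv X) = 1 := fun X => by
    rw [← hmul, timesMul_timesInv, hone]
  let f : paths (timesTree p) → ℤ_[p]ˣ := fun X =>
    ⟨ψ X, ψ (timesInv X), hinv X, by rw [mul_comm, hinv X]⟩
  have hf : Function.Bijective f := by
    constructor
    · intro X Y h
      have h1 : ∀ i, X.1 0 = Y.1 0 ∧ plusCoord X.1 i = plusCoord Y.1 i := fun i => by
        have h2 := congrArg (fun u : ℤ_[p]ˣ => PadicInt.toZModPow (i + d) (u : ℤ_[p])) h
        simp only [f, hψ] at h2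
        rw [ZMod.intCast_eq_intCast_iff] at h2
        exact H.injective i (mem_paths_timesTree.1 X.2).1 (mem_paths_timesTree.1 Y.2).1
          (plusCoord_lt X i) (plusCoord_lt Y i) h2
      exact paths_ext (h1 0).1 fun i => (h1 i).2
    · intro u
      have hu := fun i => H.surjective i (Units.map (PadicInt.toZModPow (i + d)).toMonoidHom u)
      choose x hx y hy hxy using hu
      have hxy' : ∀ i, PadicInt.toZModPow (i + d) (u : ℤ_[p]) = (a i ^ x i * b i ^ y i : ℤ) := hxy
      -- Reducing the representation at level `i + 1` gives one at level `i`, which must coincide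
      -- with the chosen one by injectivity.
      have hstep : ∀ i, x (i + 1) = x i ∧ y (i + 1) % p ^ i = y i := fun i => by
        refine H.injective i (hx _) (hx _) (Nat.mod_lt _ (pow_pos hp.out.pos _)) (hy _) ?_
        refine (H.value_compat i _ (Nat.mod_modEq _ _).symm).symm.trans ?_
        rw [← ZMod.intCast_eq_intCast_iff, ← hxy' i,
          ← PadicInt.cast_toZModPow (i + d) (i + 1 + d) (by omega), hxy' (i + 1)]
        exact (ZMod.cast_intCast (pow_dvd_pow p (by omega : i + d ≤ i + 1 + d)) _).symm
      have hx0 : ∀ i, x i = x 0 := fun i => by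
        induction i with
        | zero => rfl
        | succ i ih => rw [(hstep i).1, ih]
      obtain ⟨X, hX0, hX⟩ := exists_path (p := p) (hx 0) hy fun i => by
        change _ % _ = _ % _
        rw [(hstep i).2, Nat.mod_eq_of_lt (hy i)]
      refine ⟨X, Units.ext (padicInt_ext_of_toZModPow_add d fun i => ?_)⟩
      change PadicInt.toZModPow (i + d) (ψ X) = _
      rw [hψ, hX0, hX, hxy' i, hx0 i]
  refine ⟨⟨Equiv.ofBijective f hf, ?_, fun r => nomatch r⟩, fun X i => hψ X i⟩
  intro n g X
  cases g with
  | mul => exact Units.ext (hmul _ _)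
  | inv => exact Units.ext rfl
  | one => exact Units.ext hone

end CompatibleGenerators

end Units

/-! ### Generators of the unit groups modulo odd prime powers -/

/-- If `g₀` generates `G`, then `h = f g₀ ^ k` with `k` prime to the order of `H`. Units modulo
`|H|` lift to units modulo `|G|`, so `k` can be replaced by an exponent prime to `|G|` without
changing the image. -/
theorem exists_generator_lift {G H : Type*} [Group G] [Group H] [Finite G] [IsCyclic G]
    (f : G →* H) (hf : Function.Surjective f) {h : H} (hh : ∀ v, v ∈ Subgroup.zpowers h) :
    ∃ g : G, f g = h ∧ ∀ v, v ∈ Subgroup.zpowers g := by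
  have : Finite H := Finite.of_surjective f hf
  obtain ⟨g₀, hg₀⟩ := IsCyclic.exists_generator (α := G)
  have hfg₀ : ∀ v, v ∈ Subgroup.zpowers (f g₀) := fun v => by
    obtain ⟨w, rfl⟩ := hf v
    obtain ⟨z, rfl⟩ := Subgroup.mem_zpowers_iff.1 (hg₀ w)
    exact Subgroup.mem_zpowers_iff.2 ⟨z, (map_zpow f g₀ z).symm⟩
  have hcard : Nat.card H ∣ Nat.card G := Subgroup.card_dvd_of_surjective f hf
  have hm : orderOf (f g₀) = Nat.card H := orderOf_eq_card_of_forall_mem_zpowers hfg₀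
  have hN : orderOf g₀ = Nat.card G := orderOf_eq_card_of_forall_mem_zpowers hg₀
  have : NeZero (Nat.card G) := ⟨Nat.card_pos.ne'⟩
  obtain ⟨k, hk⟩ := (Submonoid.mem_powers_iff _ _).1
    ((mem_powers_iff_mem_zpowers).2 (hfg₀ h))
  have hkc : k.Coprime (Nat.card H) := by
    have h1 := orderOf_eq_card_of_forall_mem_zpowers hh
    rw [← hk, orderOf_pow, hm] at h1
    have h2 : 0 < Nat.card H := Nat.card_pos
    have h3 : Nat.card H / (Nat.card H).gcd k * (Nat.card H).gcd k = Nat.card H :=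
      Nat.div_mul_cancel (Nat.gcd_dvd_left _ _)
    rw [h1] at h3
    exact (Nat.coprime_comm.1 (Nat.eq_of_mul_eq_mul_left h2 (by rw [h3, mul_one])))
  obtain ⟨u, hu⟩ := ZMod.unitsMap_surjective hcard (ZMod.unitOfCoprime k hkc)
  have hu' : (u : ZMod (Nat.card G)).val ≡ k [MOD Nat.card H] := by
    have h1 := congrArg Units.val hu
    rw [ZMod.unitsMap_val, ZMod.coe_unitOfCoprime] at h1
    rw [← ZMod.natCast_eq_natCast_iff, ← h1, ZMod.natCast_val]
  refine ⟨g₀ ^ (u : ZMod (Nat.card G)).val, ?_, ?_⟩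
  · rw [map_pow, ← hk, pow_eq_pow_iff_modEq, hm]
    exact hu'
  · have hc : (u : ZMod (Nat.card G)).val.Coprime (Nat.card G) := ZMod.val_coe_unit_coprime u
    have h1 : orderOf (g₀ ^ (u : ZMod (Nat.card G)).val) = Nat.card G := by
      rw [Nat.Coprime.orderOf_pow, hN]
      rw [hN]; exact hc.symm
    intro v
    rw [(Subgroup.card_eq_iff_eq_top _).1 ((Nat.card_zpowers _).trans h1)]
    exact Subgroup.mem_top v

section

variable {p : ℕ} [hp : Fact p.Prime]

theorem IsGenerator.pow_modEq_one_iff {i q : ℕ}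
    (h : IsGenerator (p ^ (i + 1)) q) (m : ℕ) :
    (q : ℤ) ^ m ≡ 1 [ZMOD (p ^ (i + 1) : ℕ)] ↔ p ^ i * (p - 1) ∣ m := by
  obtain ⟨u, hu, hgen⟩ := h
  have ho : orderOf u = p ^ i * (p - 1) := by
    have : NeZero (p ^ (i + 1)) := ⟨pow_ne_zero _ hp.out.ne_zero⟩
    rw [orderOf_eq_card_of_forall_mem_zpowers hgen, Nat.card_eq_fintype_card,
      ZMod.card_units_eq_totient, Nat.totient_prime_pow_succ hp.out]
  rw [← ho, orderOf_dvd_iff_pow_eq_one, ← ZMod.intCast_eq_intCast_iff, Units.ext_iff]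
  simp [hu]

/-- The infimum of an empty set would be the junk value 0, so the point is that each set of
candidates is nonempty. That holds because the unit groups are cyclic and generators lift along
surjections. -/
theorem isGenerator_unitGen (hp2 : p ≠ 2) : ∀ i, IsGenerator (p ^ (i + 1)) (unitGen p (i + 1)) ∧
    (0 < i → unitGen p (i + 1) ≡ unitGen p i [MOD p ^ i])
  | 0 => by
    suffices h : ({q | IsGenerator (p ^ 1) q} : Set ℕ).Nonempty by
      refine ⟨?_, fun h => absurd h (lt_irrefl 0)⟩
      simp only [unitGen]
      exact Nat.sInf_mem h
    have : IsCyclic (ZMod (p ^ 1))ˣ := ZMod.isCyclic_units_of_prime_pow p hp.out hp2 1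
    obtain ⟨u, hu⟩ := IsCyclic.exists_generator (α := (ZMod (p ^ 1))ˣ)
    have : NeZero (p ^ 1) := ⟨pow_ne_zero _ hp.out.ne_zero⟩
    exact ⟨(u : ZMod (p ^ 1)).val, u, by simp, hu⟩
  | i + 1 => by
    suffices h : ({q | IsGenerator (p ^ (i + 2)) q ∧
        q ≡ unitGen p (i + 1) [MOD p ^ (i + 1)]} : Set ℕ).Nonempty from
      ⟨(Nat.sInf_mem h).1, fun _ => (Nat.sInf_mem h).2⟩
    obtain ⟨u, hu, hgen⟩ := (isGenerator_unitGen hp2 i).1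
    have : IsCyclic (ZMod (p ^ (i + 2)))ˣ := ZMod.isCyclic_units_of_prime_pow p hp.out hp2 _
    have : NeZero (p ^ (i + 2)) := ⟨pow_ne_zero _ hp.out.ne_zero⟩
    have hd : p ^ (i + 1) ∣ p ^ (i + 2) := pow_dvd_pow p (Nat.le_succ _)
    obtain ⟨g, hg, hgg⟩ := exists_generator_lift (ZMod.unitsMap hd) (ZMod.unitsMap_surjective hd)
      hgen
    refine ⟨(g : ZMod (p ^ (i + 2))).val, ⟨g, by simp, hgg⟩, ?_⟩
    rw [← ZMod.natCast_eq_natCast_iff, ← hu, ← hg, ZMod.unitsMap_val, ZMod.natCast_val]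

/-- A cyclic group of order `p ^ i * (p - 1)` is the product of its subgroups of the two coprime
orders, and these are generated by the complementary powers of a generator. -/
theorem compatibleGenerators_of_ne_two (hp2 : p ≠ 2) :
    CompatibleGenerators p 1 (fun i => (unitGen p (i + 1) : ℤ) ^ p ^ i)
      (fun i => (unitGen p (i + 1) : ℤ) ^ (p - 1)) := by
  have hg := fun i => (isGenerator_unitGen hp2 i).1
  have hr : torsionOrder p = p - 1 := if_neg hp2
  have hp1 : 0 < p - 1 := by have := hp.out.two_le; omega
  have hcop : ∀ i, (p ^ i).Coprime (p - 1) := fun i => by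
    refine Nat.Coprime.pow_left i ?_
    exact ((Nat.coprime_self_sub_right hp.out.one_lt.le).2 (Nat.coprime_one_right p))
  have hcompat : ∀ i, (unitGen p (i + 1 + 1) : ℤ) ≡ unitGen p (i + 1) [ZMOD (p ^ (i + 1) : ℕ)] :=
    fun i => Int.natCast_modEq_iff.2 ((isGenerator_unitGen hp2 (i + 1)).2 (Nat.succ_pos i))
  refine ⟨fun i => ?_, fun i => (hcompat i).pow _, fun i => ?_, fun i => ?_, fun i x y h => ?_,
    fun i => ?_⟩
  -- The exponents `p ^ (i + 1)` and `p ^ i` differ by `p ^ i * (p - 1)`, the order of the generator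
  -- at the lower level.
  · refine ((hcompat i).pow _).trans (Int.pow_modEq_of_pow_modEq_one
      (((hg i).pow_modEq_one_iff _).2 dvd_rfl) ?_)
    refine ((Nat.modEq_iff_dvd' (Nat.pow_le_pow_right hp.out.pos (Nat.le_succ i))).2 ?_).symm
    rw [pow_succ, Nat.mul_sub, mul_one]
  · rw [← pow_mul, (hg i).pow_modEq_one_iff, hr]
  · rw [← pow_mul, (hg i).pow_modEq_one_iff, mul_comm]
  · rw [← pow_mul, ← pow_mul, ← pow_add, (hg i).pow_modEq_one_iff] at h
    rw [hr]
    constructor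
    · have h1 := (Nat.dvd_add_left (Dvd.intro _ rfl : p - 1 ∣ (p - 1) * y)).1
        ((Dvd.intro_left _ rfl).trans h)
      exact ((hcop i).symm).dvd_of_dvd_mul_left h1
    · have h1 := (Nat.dvd_add_right (Dvd.intro _ rfl : p ^ i ∣ p ^ i * x)).1
        ((Dvd.intro _ rfl).trans h)
      exact (hcop i).dvd_of_dvd_mul_left h1
  · rw [Nat.totient_prime_pow_succ hp.out, hr, mul_comm]

/-- `5` has order `2 ^ i` modulo `2 ^ (i + 2)`, and `-1` is not among its powers since these are 1
modulo 4. Seeing this needs the modulus 4, hence the shift by 2. -/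
theorem compatibleGenerators_two : CompatibleGenerators 2 2 (fun _ => -1) (fun _ => 5) := by
  have h5 : ∀ i y, (5 : ℤ) ^ y ≡ 1 [ZMOD (2 ^ (i + 2) : ℕ)] ↔ 2 ^ i ∣ y := fun i y => by
    have h : orderOf (5 : ZMod (2 ^ (i + 2))) = 2 ^ i := ZMod.orderOf_five i
    rw [← h, orderOf_dvd_iff_pow_eq_one, ← ZMod.intCast_eq_intCast_iff]
    simp
  have hr : torsionOrder 2 = 2 := if_pos rfl
  refine ⟨fun _ => rfl, fun _ => rfl, fun i => by rw [hr]; rfl, fun i => (h5 i _).2 dvd_rfl,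
    fun i x y h => ?_, fun i => ?_⟩
  · rw [hr]
    have hx : 2 ∣ x := by
      have h1 : (-1 : ℤ) ^ x * 5 ^ y ≡ 1 [ZMOD 4] :=
        h.of_dvd (by exact_mod_cast (pow_dvd_pow 2 (Nat.le_add_left 2 i) : 2 ^ 2 ∣ 2 ^ (i + 2)))
      have h2 : (5 : ℤ) ^ y ≡ 1 [ZMOD 4] := by
        simpa using (show (5 : ℤ) ≡ 1 [ZMOD 4] by decide).pow y
      rcases Nat.even_or_odd x with hx | hx
      · exact hx.two_dvd
      · rw [hx.neg_one_pow] at h1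
        have h3 := (h2.mul_left (-1)).symm.trans h1
        exact absurd h3 (by decide)
    refine ⟨hx, (h5 i y).1 ?_⟩
    rw [(even_iff_two_dvd.2 hx).neg_one_pow, one_mul] at h
    exact h
  · rw [hr, Nat.totient_prime_pow_succ Nat.prime_two]
    ring

/-- The isomorphism from the structure presented by `T_p^×` onto the units of `ℤ_p` that realizes
the labels. -/
theorem exists_equiv_label (p : ℕ) [hp : Fact p.Prime] :
    ∃ e : (timesPresentation p).Path ≃[groupLang] ℤ_[p]ˣ,
      ∀ (X : (timesPresentation p).Path) (n : ℕ), 1 ≤ n →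
        PadicInt.toZModPow n (e X : ℤ_[p]) = label p X.1 n := by
  by_cases hp2 : p = 2
  · subst hp2
    obtain ⟨e, he⟩ := compatibleGenerators_two.exists_equiv
    refine ⟨e, fun X n hn => ?_⟩
    rcases Nat.lt_or_ge 1 n with h | h
    · obtain ⟨i, rfl⟩ := Nat.exists_eq_add_of_le' h
      rw [he X i]
      cases i with
      | zero => simp [label, plusCoord]
      | succ i => simp [label, plusCoord]
    -- The construction only speaks of levels from 2 on; at level 1 there is just one unit modulo 2.
    · obtain rfl : n = 1 := le_antisymm h hn
      have h1 := (Units.map (PadicInt.toZModPow (p := 2) 1).toMonoidHom (e X)).isUnit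
      have h2 : ∀ z : ZMod (2 ^ 1), IsUnit z → z = 1 := by
        change ∀ z : ZMod 2, IsUnit z → z = 1
        clear he X hn h h1
        decide +revert
      exact (h2 _ h1).trans (by simp [label])
  · obtain ⟨e, he⟩ := (compatibleGenerators_of_ne_two hp2).exists_equiv
    refine ⟨e, fun X n hn => ?_⟩
    obtain ⟨i, rfl⟩ := Nat.exists_eq_add_of_le' hn
    rw [he X i]
    simp only [label, if_neg hp2, plusCoord]
    cases i with
    | zero => simp [mul_comm]
    | succ i =>
      simp [← pow_mul, ← pow_add, mul_comm]

end

/-! ### Tuples of `p`-adic integers that satisfy the same small linear equations -/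

section Similar

open Finset

variable {p : ℕ} [hp : Fact p.Prime]

theorem padicInt_isUnit_intCast {b : ℤ} (hb : ¬ (p : ℤ) ∣ b) : IsUnit (b : ℤ_[p]) := by
  rw [PadicInt.isUnit_iff]
  refine le_antisymm (PadicInt.norm_le_one _) (not_lt.1 fun h => hb ?_)
  exact (PadicInt.norm_int_lt_one_iff_dvd b).1 h

/-- An integer `b ≠ 0` is a product of a power of `p`, with an exponent below `|b|`, and an integer
prime to `p`. -/
theorem exists_eq_pow_mul_not_dvd {b : ℤ} (hb : b ≠ 0) :
    ∃ (v : ℕ) (b' : ℤ), b = (p : ℤ) ^ v * b' ∧ ¬ (p : ℤ) ∣ b' ∧ (v : ℤ) ≤ |b| ∧ |b'| ≤ |b| := by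
  obtain ⟨v, n', hn', h⟩ := Nat.exists_eq_pow_mul_and_not_dvd (Int.natAbs_ne_zero.2 hb) p
    hp.out.ne_one
  obtain ⟨s, hs⟩ : ∃ s : ℤ, b = s * b.natAbs ∧ |s| = 1 := by
    rcases Int.natAbs_eq b with h | h
    · exact ⟨1, by rw [one_mul]; exact h, abs_one⟩
    · exact ⟨-1, by rw [neg_one_mul]; exact h, by simp⟩
  have hn0 : n' ≠ 0 := by rintro rfl; exact hn' (dvd_zero _)
  have hb' : |b| = (p ^ v * n' : ℕ) := by rw [Int.abs_eq_natAbs, h]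
  refine ⟨v, s * n', ?_, ?_, ?_, ?_⟩
  · rw [mul_left_comm, ← Nat.cast_pow, ← Nat.cast_mul, ← h]
    exact hs.1
  · rw [← dvd_abs, abs_mul, hs.2, one_mul, Nat.abs_cast, Int.natCast_dvd_natCast]
    exact hn'
  · rw [hb']
    have h1 : v < p ^ v := Nat.lt_pow_self hp.out.one_lt
    exact_mod_cast h1.le.trans (Nat.le_mul_of_pos_right _ (Nat.pos_of_ne_zero hn0))
  · rw [hb', abs_mul, hs.2, one_mul, Nat.abs_cast]
    exact_mod_cast Nat.le_mul_of_pos_left _ (pow_pos hp.out.pos v)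

/-- Cancelling `b` costs as many factors `p` as divide `b`, and these are at most `|b| ≤ N` in
number. -/
theorem pow_dvd_of_pow_dvd_intCast_mul {N N' : ℕ} {b : ℤ} (hb : b ≠ 0) (hbN : |b| ≤ N)
    (hN : N + N ≤ N') {w : ℤ_[p]} (h : (p : ℤ_[p]) ^ N' ∣ (b : ℤ_[p]) * w) :
    (p : ℤ_[p]) ^ N ∣ w := by
  obtain ⟨v, b', rfl, hb', hv, -⟩ := exists_eq_pow_mul_not_dvd (p := p) hb
  have hvN : v ≤ N := by exact_mod_cast hv.trans hbN
  have hp0 : (p : ℤ_[p]) ≠ 0 := by exact_mod_cast hp.out.ne_zero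
  obtain ⟨M, rfl⟩ := Nat.exists_eq_add_of_le (hvN.trans ((Nat.le_add_right N N).trans hN))
  push_cast at h
  rw [pow_add, mul_assoc, mul_dvd_mul_iff_left (pow_ne_zero _ hp0),
    (padicInt_isUnit_intCast hb').dvd_mul_left] at h
  exact (pow_dvd_pow _ (by omega)).trans h

/-- Up to a unit of `ℤ_p`, `b` is a power `p ^ v` with `v ≤ N`, so divisibility by `b` depends only
on the residue modulo `p ^ N`. -/
theorem intCast_dvd_of_dvd_of_pow_dvd_sub {N : ℕ} {b : ℤ} (hb : b ≠ 0) (hbN : |b| ≤ N)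
    {s t : ℤ_[p]} (hs : (b : ℤ_[p]) ∣ s) (h : (p : ℤ_[p]) ^ N ∣ s - t) : (b : ℤ_[p]) ∣ t := by
  obtain ⟨v, b', rfl, hb', hv, -⟩ := exists_eq_pow_mul_not_dvd (p := p) hb
  have hvN : v ≤ N := by exact_mod_cast hv.trans hbN
  push_cast at hs ⊢
  rw [(padicInt_isUnit_intCast hb').mul_right_dvd] at hs ⊢
  exact (dvd_sub_right hs).1 ((pow_dvd_pow _ hvN).trans h)

/-- Two tuples of length `m` of `p`-adic integers are similar to the level `N` if they are
congruent modulo `p ^ N` and satisfy the same homogeneous linear equations with integer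
coefficients of absolute value at most `N`. -/
structure Similar (N m : ℕ) (y y' : ℕ → ℤ_[p]) : Prop where
  congr : ∀ i < m, (p : ℤ_[p]) ^ N ∣ y i - y' i
  relations : ∀ a : ℕ → ℤ, (∀ i, |a i| ≤ N) →
    (∑ i ∈ range m, (a i : ℤ_[p]) * y i = 0 ↔ ∑ i ∈ range m, (a i : ℤ_[p]) * y' i = 0)

namespace Similar

variable {N N' m : ℕ} {y y' : ℕ → ℤ_[p]}

theorem symm (h : Similar N m y y') : Similar N m y' y :=
  ⟨fun i hi => by rw [← neg_sub, dvd_neg]; exact h.congr i hi,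
    fun a ha => (h.relations a ha).symm⟩

theorem mono (h : Similar N' m y y') (hN : N ≤ N') : Similar N m y y' :=
  ⟨fun i hi => (pow_dvd_pow _ hN).trans (h.congr i hi),
    fun a ha => h.relations a fun i => (ha i).trans (by exact_mod_cast hN)⟩

/-- The relations are homogeneous, so a nonzero factor does not affect them, and a factor that is 1
modulo `p ^ N` does not affect the congruences. This is what later allows denominators prime to `p`
to be cleared. -/
theorem smul_right (h : Similar N m y y') {D : ℤ} (hD : D ≠ 0) (hD1 : (p : ℤ) ^ N ∣ D - 1) :
    Similar N m y fun i => D * y' i := by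
  refine ⟨fun i hi => ?_, fun a ha => (h.relations a ha).trans ?_⟩
  · have h1 : (p : ℤ_[p]) ^ N ∣ (D : ℤ_[p]) - 1 := by
      have := (Int.castRingHom ℤ_[p]).map_dvd hD1
      simpa using this
    have e : y i - D * y' i = (y i - y' i) - (D - 1) * y' i := by ring
    rw [e]
    exact dvd_sub (h.congr i hi) (h1.mul_right _)
  · have e : ∑ i ∈ range m, (a i : ℤ_[p]) * (D * y' i) =
        D * ∑ i ∈ range m, (a i : ℤ_[p]) * y' i := by
      rw [mul_sum]
      exact sum_congr rfl fun i _ => by ring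
    rw [e, mul_eq_zero, or_iff_right (Int.cast_ne_zero.2 hD)]

theorem dvd_sum_sub (h : Similar N m y y') (a : ℕ → ℤ) : (p : ℤ_[p]) ^ N ∣
    ∑ i ∈ range m, (a i : ℤ_[p]) * y i - ∑ i ∈ range m, (a i : ℤ_[p]) * y' i := by
  rw [← sum_sub_distrib]
  refine dvd_sum fun i hi => ?_
  rw [← mul_sub]
  exact (h.congr i (mem_range.1 hi)).mul_left _

theorem congr_extend (h : Similar N' m y y') (hN : N ≤ N') {z z' : ℤ_[p]}
    (hz : (p : ℤ_[p]) ^ N ∣ z - z') (i : ℕ) (hi : i < m + 1) :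
    (p : ℤ_[p]) ^ N ∣ Function.update y m z i - Function.update y' m z' i := by
  rcases Nat.lt_succ_iff_lt_or_eq.1 hi with hi | rfl
  · rw [Function.update_of_ne hi.ne, Function.update_of_ne hi.ne]
    exact (pow_dvd_pow _ hN).trans (h.congr i hi)
  · simpa using hz

omit hp in
theorem _root_.TreePres.sum_range_succ_update [Fact p.Prime] (a : ℕ → ℤ) (y : ℕ → ℤ_[p]) (m : ℕ)
    (z : ℤ_[p]) : ∑ i ∈ range (m + 1), (a i : ℤ_[p]) * Function.update y m z i =
      ∑ i ∈ range m, (a i : ℤ_[p]) * y i + a m * z := by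
  rw [sum_range_succ, Function.update_self]
  congr 1
  refine sum_congr rfl fun i hi => ?_
  rw [Function.update_of_ne (mem_range.1 hi).ne]

/-- Similar tuples stay similar when both are extended by the solution of the same linear
equation. -/
theorem extend_of_relation (h : Similar N' m y y') (hN : 2 * N * N + 2 * N ≤ N') {a : ℕ → ℤ}
    (ha : ∀ i, |a i| ≤ N) {b : ℤ} (hb : b ≠ 0) (hbN : |b| ≤ N) {z z' : ℤ_[p]}
    (hz : b * z = ∑ i ∈ range m, (a i : ℤ_[p]) * y i)
    (hz' : b * z' = ∑ i ∈ range m, (a i : ℤ_[p]) * y' i) :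
    Similar N (m + 1) (Function.update y m z) (Function.update y' m z') := by
  have hN1 : N + N ≤ N' := by nlinarith
  refine ⟨h.congr_extend (by omega) ?_, fun c hc => ?_⟩
  · refine pow_dvd_of_pow_dvd_intCast_mul hb hbN hN1 ?_
    rw [mul_sub, hz, hz']
    exact h.dvd_sum_sub a
  -- Multiplying a relation by `b` and eliminating `b * z` yields a relation of the old tuple with
  -- the coefficients `b * c i + c m * a i`, of size at most `2N²`. The remaining `2N` in `hN` pays
  -- for the congruence.
  · have key : ∀ (y : ℕ → ℤ_[p]) (z : ℤ_[p]), b * z = ∑ i ∈ range m, (a i : ℤ_[p]) * y i →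
        (∑ i ∈ range (m + 1), (c i : ℤ_[p]) * Function.update y m z i = 0 ↔
          ∑ i ∈ range m, ((b * c i + c m * a i : ℤ) : ℤ_[p]) * y i = 0) := fun y z hz => by
      have e : ∑ i ∈ range m, ((b * c i + c m * a i : ℤ) : ℤ_[p]) * y i =
          b * (∑ i ∈ range m, (c i : ℤ_[p]) * y i + c m * z) := by
        rw [mul_add, mul_left_comm, hz, mul_sum, mul_sum, ← sum_add_distrib]
        refine sum_congr rfl fun i _ => ?_
        push_cast
        ring
      rw [sum_range_succ_update, e, mul_eq_zero, or_iff_right (Int.cast_ne_zero.2 hb)]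
    rw [key y z hz, key y' z' hz']
    refine h.relations (fun i => b * c i + c m * a i) fun i => ?_
    have h1 : |b * c i| ≤ N * N := by
      rw [abs_mul]; exact mul_le_mul hbN (hc i) (abs_nonneg _) (by positivity)
    have h2 : |c m * a i| ≤ N * N := by
      rw [abs_mul]; exact mul_le_mul (hc m) (ha i) (abs_nonneg _) (by positivity)
    have h3 : ((2 * N * N + 2 * N : ℕ) : ℤ) ≤ N' := by exact_mod_cast hN
    push_cast at h3
    have h4 := abs_add_le (b * c i) (c m * a i)
    have h5 : (0 : ℤ) ≤ N := by positivity
    change |b * c i + c m * a i| ≤ _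
    nlinarith

/-- `z` satisfies no nontrivial linear equation over `y` with coefficients up to `N`. -/
def _root_.TreePres.IsGenericOver (N m : ℕ) (y : ℕ → ℤ_[p]) (z : ℤ_[p]) : Prop :=
  ∀ (a : ℕ → ℤ) (b : ℤ), (∀ i, |a i| ≤ N) → b ≠ 0 → |b| ≤ N →
    b * z ≠ ∑ i ∈ range m, (a i : ℤ_[p]) * y i

/-- A relation that really involves the new element fails on both sides; one that does not is a
relation of the old tuples. -/
theorem extend_of_generic (h : Similar N' m y y') (hN : N ≤ N') {z z' : ℤ_[p]}
    (hz : IsGenericOver N m y z) (hz' : IsGenericOver N m y' z')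
    (hzz' : (p : ℤ_[p]) ^ N ∣ z - z') :
    Similar N (m + 1) (Function.update y m z) (Function.update y' m z') := by
  refine ⟨h.congr_extend hN hzz', fun c hc => ?_⟩
  rw [sum_range_succ_update, sum_range_succ_update]
  by_cases hm : c m = 0
  · simpa [hm] using h.relations c fun i => (hc i).trans (by exact_mod_cast hN)
  · have key : ∀ (y : ℕ → ℤ_[p]) (z : ℤ_[p]), IsGenericOver N m y z →
        ¬ ∑ i ∈ range m, (c i : ℤ_[p]) * y i + c m * z = 0 := fun y z hz h0 => by
      refine hz (fun i => - c i) (c m) (fun i => by simpa using hc i) hm (hc m) ?_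
      simp only [Int.cast_neg, neg_mul, sum_neg_distrib]
      exact eq_neg_of_add_eq_zero_right h0
    exact iff_of_false (key y z hz) (key y' z' hz')

end Similar

/-- There are infinitely many coefficient functions, but only their first `m` values, each from a
finite interval, enter the sum. -/
theorem finite_small_combinations (N m : ℕ) (y : ℕ → ℤ_[p]) :
    {s : ℤ_[p] | ∃ a : ℕ → ℤ, (∀ i, |a i| ≤ N) ∧
      s = ∑ i ∈ range m, (a i : ℤ_[p]) * y i}.Finite := by
  induction m with
  | zero =>
    refine (Set.finite_singleton (0 : ℤ_[p])).subset ?_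
    rintro s ⟨a, -, rfl⟩
    simp
  | succ m ih =>
    refine (Set.Finite.image2 (fun s (c : ℤ) => s + c * y m) ih
      (Set.finite_Icc (-(N : ℤ)) N)).subset ?_
    rintro s ⟨a, ha, rfl⟩
    exact ⟨_, ⟨a, ha, rfl⟩, a m, abs_le.1 (ha m), (sum_range_succ _ _).symm⟩

/-- The non-generic elements form a finite set, since multiplication by `b ≠ 0` is injective,
whereas a residue class modulo `p ^ N` is infinite. -/
theorem exists_isGenericOver (N m : ℕ) (y : ℕ → ℤ_[p]) (z : ℤ_[p]) :
    ∃ z', IsGenericOver N m y z' ∧ (p : ℤ_[p]) ^ N ∣ z - z' := by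
  have hp0 : (p : ℤ_[p]) ≠ 0 := by exact_mod_cast hp.out.ne_zero
  have hfin : (⋃ b ∈ Set.Icc (-(N : ℤ)) N \ {0}, {z' : ℤ_[p] | b * z' ∈
      {s : ℤ_[p] | ∃ a : ℕ → ℤ, (∀ i, |a i| ≤ N) ∧
        s = ∑ i ∈ range m, (a i : ℤ_[p]) * y i}}).Finite := by
    refine Set.Finite.biUnion ((Set.finite_Icc _ _).sdiff) fun b hb => ?_
    refine (finite_small_combinations N m y).preimage fun z _ z' _ h => ?_
    exact mul_left_cancel₀ (Int.cast_ne_zero.2 hb.2) h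
  have hinj : Function.Injective fun k : ℕ => z + (p : ℤ_[p]) ^ N * k := fun k l h =>
    Nat.cast_injective (mul_left_cancel₀ (pow_ne_zero N hp0) (add_left_cancel h))
  obtain ⟨z', ⟨k, rfl⟩, hk⟩ := (Set.infinite_range_of_injective hinj).exists_notMem_finite hfin
  refine ⟨z + (p : ℤ_[p]) ^ N * k, fun a b ha hb hbN h => hk ?_, ⟨-(k : ℤ_[p]), by ring⟩⟩
  exact Set.mem_biUnion (⟨abs_le.1 hbN, hb⟩ : b ∈ Set.Icc (-(N : ℤ)) N \ {0}) ⟨a, ha, h⟩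

/-- The back-and-forth property of similarity. -/
theorem Similar.exists_extension {N N' m : ℕ} {y y' : ℕ → ℤ_[p]} (h : Similar N' m y y')
    (hN : 2 * N * N + 2 * N ≤ N') (z : ℤ_[p]) :
    ∃ z', Similar N (m + 1) (Function.update y m z) (Function.update y' m z') := by
  by_cases hz : IsGenericOver N m y z
  · obtain ⟨z', hz', hzz'⟩ := exists_isGenericOver N m y' z
    exact ⟨z', h.extend_of_generic (by omega) hz hz' hzz'⟩
  · simp only [IsGenericOver, not_forall, not_not, exists_prop] at hz
    obtain ⟨a, b, ha, hb, hbN, hz⟩ := hz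
    obtain ⟨z', hz'⟩ := intCast_dvd_of_dvd_of_pow_dvd_sub (N := N') hb
      (hbN.trans (by exact_mod_cast (by omega : N ≤ N'))) (Dvd.intro _ hz) (h.dvd_sum_sub a)
    exact ⟨z', h.extend_of_relation hN ha hb hbN hz hz'.symm⟩

/-- A bound for the test elements that decide a quantifier over `ℤ_p`, for parameters that are
integers with the sum `S` of their absolute values. -/
def testBound (p N S : ℕ) : ℕ := N ^ p ^ N * (N * S) + N ^ p ^ N + p ^ N * (N * S + 2)

/-- The back-and-forth property of similarity to a tuple of integers, with an explicit bound for
the integers that are needed. -/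
theorem Similar.exists_integer_extension {N N' m : ℕ} {y : ℕ → ℤ_[p]} {w : ℕ → ℤ}
    (h : Similar N' m y fun i => w i) (hN : 2 * N * N + 2 * N ≤ N') (z : ℤ_[p]) {S : ℕ}
    (hS : ∑ i ∈ range m, |w i| ≤ S) :
    ∃ (D : ℕ) (u : ℤ), D ≤ testBound p N' S ∧ |u| ≤ testBound p N' S ∧ D ≠ 0 ∧
      D ≡ 1 [MOD p ^ N'] ∧
      Similar N (m + 1) (Function.update y m z)
        (Function.update (fun i => ((D * w i : ℤ) : ℤ_[p])) m u) := by
  have hNN : N ≤ N' := by omega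
  have hsum : ∀ a : ℕ → ℤ, (∀ i, |a i| ≤ N) → |∑ i ∈ range m, a i * w i| ≤ N * S := fun a ha => by
    refine (abs_sum_le_sum_abs _ _).trans ?_
    refine le_trans (sum_le_sum fun i _ => ?_) ((mul_sum (range m) (fun i => |w i|) (N : ℤ)).symm.le.trans
      (mul_le_mul_of_nonneg_left hS (by positivity)))
    rw [abs_mul]
    exact mul_le_mul_of_nonneg_right (ha i) (abs_nonneg _)
  have hNS : N * S ≤ N' * S := Nat.mul_le_mul_right _ hNN
  have hpos : 0 < p ^ N' := pow_pos hp.out.pos _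
  by_cases hz : IsGenericOver N m y z
  -- For integers, genericity can be forced by size: `u` exceeds `N * S`, a bound for all small
  -- combinations of `w`. The shift is a multiple of `p ^ N`, so `u` keeps the residue of `z`; no
  -- scaling is needed, and `D = 1`.
  · set u : ℕ := z.appr N + p ^ N * (N * S + 1) with hu
    have hpN : 0 < p ^ N := pow_pos hp.out.pos _
    have hle : u ≤ p ^ N' * (N' * S + 2) := by
      have h1 : z.appr N < p ^ N := PadicInt.appr_lt z N
      have h2 : p ^ N ≤ p ^ N' := Nat.pow_le_pow_right hp.out.pos hNN
      calc u ≤ p ^ N * (N * S + 2) := by rw [hu]; nlinarith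
        _ ≤ _ := Nat.mul_le_mul h2 (by omega)
    refine ⟨1, u, ?_, ?_, one_ne_zero, rfl, ?_⟩
    · have : 1 ≤ p ^ N' * (N' * S + 2) := Nat.mul_pos hpos (by omega)
      unfold testBound; omega
    · rw [Nat.abs_cast]
      have : u ≤ testBound p N' S := by unfold testBound; omega
      exact_mod_cast this
    · simp only [Nat.cast_one, one_mul]
      refine h.extend_of_generic hNN hz (fun a b ha hb hbN he => ?_) ?_
      · have he' : b * (u : ℤ) = ∑ i ∈ range m, a i * w i := by
          beta_reduce at he
          exact_mod_cast he
        have h1 := hsum a ha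
        rw [← he', abs_mul, Nat.abs_cast] at h1
        have h2 : 1 ≤ |b| := Int.one_le_abs hb
        have h3 : (N * S + 1 : ℕ) ≤ u :=
          (Nat.le_mul_of_pos_left _ hpN).trans (Nat.le_add_left _ _)
        have h4 : ((N * S + 1 : ℕ) : ℤ) ≤ u := by exact_mod_cast h3
        push_cast at h4
        nlinarith
      · have h1 := Ideal.mem_span_singleton.1 (PadicInt.appr_spec N z)
        have e : z - ((u : ℤ) : ℤ_[p]) = (z - (z.appr N : ℕ)) - (p : ℤ_[p]) ^ N * (N * S + 1) := by
          rw [hu]; push_cast; ring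
        rw [e]
        exact dvd_sub h1 (Dvd.intro _ rfl)
  · simp only [IsGenericOver, not_forall, not_not, exists_prop] at hz
    obtain ⟨a, b, ha, hb, hbN, hz⟩ := hz
    obtain ⟨v, b', hbv, hb', hv, hb'N⟩ := exists_eq_pow_mul_not_dvd (p := p) hb
    have hN1 : 1 ≤ N := by
      have := Int.one_le_abs hb
      exact_mod_cast this.trans hbN
    -- The solution of `b * u = ∑ a i * w i` may have the denominator `b'`, the part of `b` prime to
    -- `p`. By Euler's theorem this power of `|b'|` is 1 modulo `p ^ N'`, so scaling by it clears
    -- the denominator harmlessly.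
    set D : ℕ := b'.natAbs ^ (p ^ N').totient with hD
    have hcop : b'.natAbs.Coprime (p ^ N') := by
      refine Nat.Coprime.pow_right _ (Nat.Coprime.symm ((Nat.Prime.coprime_iff_not_dvd hp.out).2 ?_))
      rwa [← Int.natCast_dvd_natCast, Int.dvd_natAbs]
    have hD1 : D ≡ 1 [MOD p ^ N'] := Nat.ModEq.pow_totient hcop
    have hb'0 : b'.natAbs ≠ 0 := by
      rw [Int.natAbs_ne_zero]
      rintro rfl
      exact hb' (dvd_zero _)
    have hD0 : D ≠ 0 := pow_ne_zero _ hb'0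
    have hb'D : b' ∣ D := by
      rw [hD, Nat.cast_pow]
      exact (Int.dvd_natAbs.2 dvd_rfl).trans
        (dvd_pow_self _ (Nat.totient_pos.2 hpos).ne')
    have hDle : D ≤ N' ^ p ^ N' := by
      have h1 : b'.natAbs ≤ N' := by
        have : |b'| ≤ N' := hb'N.trans (hbN.trans (by exact_mod_cast hNN))
        rw [Int.abs_eq_natAbs] at this
        exact_mod_cast this
      exact (Nat.pow_le_pow_left h1 _).trans
        (Nat.pow_le_pow_right (hN1.trans hNN) (Nat.totient_le _))
    -- The `p`-part of the denominator does not occur: `b` divides the combination of the `y i`, and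
    -- the combination of the `w i` is congruent to it.
    have hpv : (p : ℤ) ^ v ∣ ∑ i ∈ range m, a i * w i := by
      have h1 := intCast_dvd_of_dvd_of_pow_dvd_sub (N := N') hb
        (hbN.trans (by exact_mod_cast hNN)) (Dvd.intro _ hz) (h.dvd_sum_sub a)
      rw [← PadicInt.pow_p_dvd_int_iff]
      push_cast
      refine dvd_trans ?_ h1
      rw [hbv]
      push_cast
      exact Dvd.intro _ rfl
    obtain ⟨u, hu⟩ : b ∣ D * ∑ i ∈ range m, a i * w i := by
      rw [hbv, mul_comm (D : ℤ)]
      exact mul_dvd_mul hpv hb'D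
    have hule : |u| ≤ (N' ^ p ^ N' * (N' * S) : ℕ) := by
      have h1 : |u| ≤ |b * u| := by
        rw [abs_mul]
        exact le_mul_of_one_le_left (abs_nonneg _) (Int.one_le_abs hb)
      rw [← hu, abs_mul, Nat.abs_cast] at h1
      refine h1.trans ?_
      rw [Nat.cast_mul]
      refine mul_le_mul (by exact_mod_cast hDle) ((hsum a ha).trans (by exact_mod_cast hNS))
        (abs_nonneg _) (by positivity)
    refine ⟨D, u, ?_, hule.trans ?_, hD0, hD1, ?_⟩
    · unfold testBound; omega
    · have : N' ^ p ^ N' * (N' * S) ≤ testBound p N' S := by unfold testBound; omega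
      exact_mod_cast this
    · have h1 : (p : ℤ) ^ N' ∣ (D : ℤ) - 1 := by
        have := hD1.symm.dvd
        exact_mod_cast this
      have h2 := h.smul_right (D := D) (by exact_mod_cast hD0) h1
      simp only [Int.cast_mul]
      refine h2.extend_of_relation hN ha hb hbN hz ?_
      have h3 := congrArg (Int.cast : ℤ → ℤ_[p]) hu
      push_cast at h3 ⊢
      rw [← h3, mul_sum]
      exact sum_congr rfl fun i _ => by ring

end Similar

/-! ### The evaluator: definition -/

/-- A name `(x, u, v)` of the element `(x, u - v)` of `(ℤ/rℤ) × ℤ_p`. -/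
abbrev Raw : Type := ℕ × ℕ × ℕ

namespace Raw

def mul (a b : Raw) : Raw := (a.1 + b.1, a.2.1 + b.2.1, a.2.2 + b.2.2)

/-- For `r > 0`, the factor `r - 1` acts as `-1` modulo `r`, and exchanging the two entries negates
their difference, so all arithmetic stays in `ℕ`. -/
def inv (r : ℕ) (a : Raw) : Raw := ((r - 1) * a.1, a.2.2, a.2.1)

def one : Raw := (0, 0, 0)

/-- Two names denote the same element. -/
def Equal (r : ℕ) (a b : Raw) : Prop := a.1 % r = b.1 % r ∧ a.2.1 + b.2.2 = b.2.1 + a.2.2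

instance (r : ℕ) (a b : Raw) : Decidable (Equal r a b) := inferInstanceAs (Decidable (_ ∧ _))

/-- Multiplication of the `ℤ_p`-part by a natural number. -/
def scale (D : ℕ) (a : Raw) : Raw := (a.1, D * a.2.1, D * a.2.2)

end Raw

/-- The value of the variable number `c`, where the first `n` entries of the list `E` belong to the
free variables and the others to the bound variables. -/
def lookupVar (n : ℕ) (E : List Raw) (c : ℕ) : Option Raw :=
  -- The length of the tuple is only guessed by the search. If the guess is too small, the guard
  -- keeps a free variable from reading the entry of a bound one.
  if c % 2 = 0 then (if c / 2 < n then E[c / 2]? else none) else E[n + c / 2]?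

/-- The number of the first argument in the number of a list of arguments. -/
def firstArg (c : ℕ) : ℕ := (c.unpair.2.unpair.2 - 1).unpair.1

/-- The number of the second argument in the number of a list of arguments. -/
def secondArg (c : ℕ) : ℕ := ((c.unpair.2.unpair.2 - 1).unpair.2 - 1).unpair.1

/-- Supplies termination of the evaluators: the decrease is strict only for a nonzero tag, and tag 0
marks the leaves. -/
theorem unpair_right_lt {c : ℕ} (h : c.unpair.1 ≠ 0) : c.unpair.2 < c := by
  have h1 := Nat.add_le_pair c.unpair.1 c.unpair.2
  rw [Nat.pair_unpair] at h1
  omega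

theorem firstArg_lt {c : ℕ} (h : c.unpair.1 ≠ 0) : firstArg c < c :=
  ((Nat.unpair_left_le _).trans ((Nat.sub_le _ _).trans (Nat.unpair_right_le _))).trans_lt
    (unpair_right_lt h)

theorem secondArg_lt {c : ℕ} (h : c.unpair.1 ≠ 0) : secondArg c < c :=
  ((Nat.unpair_left_le _).trans ((Nat.sub_le _ _).trans ((Nat.unpair_right_le _).trans
    ((Nat.sub_le _ _).trans (Nat.unpair_right_le _))))).trans_lt (unpair_right_lt h)

/-- The value of the term number `c` in the environment `E`. -/
def termValue (r n : ℕ) (E : List Raw) (c : ℕ) : Option Raw :=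
  if _h : c.unpair.1 = 0 then lookupVar n E c.unpair.2
  else
    if c.unpair.2.unpair.1 = 0 then
      (termValue r n E (firstArg c)).bind fun a =>
        (termValue r n E (secondArg c)).map fun b => a.mul b
    else if c.unpair.2.unpair.1 = 1 then (termValue r n E (firstArg c)).map (Raw.inv r)
    else some Raw.one
  termination_by c
  decreasing_by
  · exact firstArg_lt _h
  · exact secondArg_lt _h
  · exact firstArg_lt _h

/-- The precision that is needed for the evaluation of the formula number `c`. -/
def precision (c : ℕ) : ℕ := 2 ^ 4 ^ (c + 1)

/-- The sum of the `ℤ_p`-entries of the names in an environment. -/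
def envSize (E : List Raw) : ℕ := E.foldr (fun a s => a.2.1 + a.2.2 + s) 0

/-- The environment `E`, scaled and extended by one entry, that is described by the number `j`. -/
def testEnv (E : List Raw) (j : ℕ) : List Raw :=
  E.map (Raw.scale j.unpair.1.unpair.1) ++ [(j.unpair.1.unpair.2, j.unpair.2.unpair)]

/-- The environments that have to be tested for the evaluation of a quantifier, with the precision
`N`. -/
def testEnvs (p N : ℕ) (E : List Raw) : List (List Raw) :=
  (List.range ((testBound p N (envSize E) + 1) ^ 4)).flatMap fun j =>
    if j.unpair.1.unpair.1 ≠ 0 ∧ j.unpair.1.unpair.1 % p ^ N = 1 % p ^ N then [testEnv E j] else []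

/-- The conjunction of a list of truth values, provided that all of them are defined. -/
def conjunction (l : List (Option Bool)) : Option Bool :=
  l.foldr (fun o s => o.bind fun a => s.map fun b => a && b) (some true)

/-- The truth value of the formula number `c` in the environment `E`. -/
def truthValue (p n : ℕ) (c : ℕ) (E : List Raw) : Option Bool :=
  if _h : c.unpair.1 = 0 then some false
  else
    if c.unpair.1 = 1 then
      (termValue (torsionOrder p) n E c.unpair.2.unpair.1).bind fun a =>
        (termValue (torsionOrder p) n E c.unpair.2.unpair.2).map fun b =>
          decide (Raw.Equal (torsionOrder p) a b)
    else if c.unpair.1 = 2 then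
      (truthValue p n c.unpair.2.unpair.1 E).bind fun a =>
        (truthValue p n c.unpair.2.unpair.2 E).map fun b => !a || b
    -- The tests use the precision of the quantified formula itself, which exceeds that of its body
    -- by enough for one back-and-forth step.
    else conjunction ((testEnvs p (precision c) E).map (truthValue p n c.unpair.2))
  termination_by c
  decreasing_by
  · exact (Nat.unpair_left_le _).trans_lt (unpair_right_lt _h)
  · exact (Nat.unpair_right_le _).trans_lt (unpair_right_lt _h)
  · exact unpair_right_lt _h

/-! ### The evaluator is primitive recursive -/

section Primrec

variable {α : Type*} [Primcodable α]

theorem primrec_rawMul : Primrec₂ Raw.mul := by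
  have h1 : Primrec fun x : Raw × Raw => x.1.1 := Primrec.fst.comp Primrec.fst
  have h2 : Primrec fun x : Raw × Raw => x.1.2 := Primrec.snd.comp Primrec.fst
  have h3 : Primrec fun x : Raw × Raw => x.2.1 := Primrec.fst.comp Primrec.snd
  have h4 : Primrec fun x : Raw × Raw => x.2.2 := Primrec.snd.comp Primrec.snd
  exact Primrec.pair (Primrec.nat_add.comp h1 h3) (Primrec.pair
    (Primrec.nat_add.comp (Primrec.fst.comp h2) (Primrec.fst.comp h4))
    (Primrec.nat_add.comp (Primrec.snd.comp h2) (Primrec.snd.comp h4)))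

theorem primrec_rawInv (r : ℕ) : Primrec (Raw.inv r) :=
  Primrec.pair (Primrec.nat_mul.comp (Primrec.const (r - 1)) Primrec.fst)
    (Primrec.pair (Primrec.snd.comp Primrec.snd) (Primrec.fst.comp Primrec.snd))

theorem primrecRel_rawEqual (r : ℕ) : PrimrecRel (Raw.Equal r) := by
  have h1 : Primrec fun x : Raw × Raw => x.1.1 := Primrec.fst.comp Primrec.fst
  have h2 : Primrec fun x : Raw × Raw => x.1.2 := Primrec.snd.comp Primrec.fst
  have h3 : Primrec fun x : Raw × Raw => x.2.1 := Primrec.fst.comp Primrec.snd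
  have h4 : Primrec fun x : Raw × Raw => x.2.2 := Primrec.snd.comp Primrec.snd
  refine PrimrecPred.primrecRel (PrimrecPred.and (Primrec.eq.comp
    (Primrec.nat_mod.comp h1 (Primrec.const r)) (Primrec.nat_mod.comp h3 (Primrec.const r)))
    (Primrec.eq.comp (Primrec.nat_add.comp (Primrec.fst.comp h2) (Primrec.snd.comp h4))
      (Primrec.nat_add.comp (Primrec.fst.comp h4) (Primrec.snd.comp h2))))

theorem primrec_scale : Primrec₂ Raw.scale :=
  Primrec.pair (Primrec.fst.comp Primrec.snd) (Primrec.pair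
    (Primrec.nat_mul.comp Primrec.fst (Primrec.fst.comp (Primrec.snd.comp Primrec.snd)))
    (Primrec.nat_mul.comp Primrec.fst (Primrec.snd.comp (Primrec.snd.comp Primrec.snd))))

theorem primrec_unpair_fst : Primrec fun c : ℕ => c.unpair.1 := Primrec.fst.comp Primrec.unpair

theorem primrec_unpair_snd : Primrec fun c : ℕ => c.unpair.2 := Primrec.snd.comp Primrec.unpair

theorem primrec_firstArg : Primrec firstArg :=
  primrec_unpair_fst.comp (Primrec.nat_sub.comp (primrec_unpair_snd.comp primrec_unpair_snd)
    (Primrec.const 1))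

theorem primrec_secondArg : Primrec secondArg :=
  primrec_unpair_fst.comp (Primrec.nat_sub.comp (primrec_unpair_snd.comp (Primrec.nat_sub.comp
    (primrec_unpair_snd.comp primrec_unpair_snd) (Primrec.const 1))) (Primrec.const 1))

theorem primrec_precision : Primrec precision :=
  primrec_nat_pow.comp (Primrec.const 2) (primrec_nat_pow.comp (Primrec.const 4) Primrec.succ)

theorem primrec_lookupVar :
    Primrec fun x : (ℕ × List Raw) × ℕ => lookupVar x.1.1 x.1.2 x.2 := by
  have hn : Primrec fun x : (ℕ × List Raw) × ℕ => x.1.1 := Primrec.fst.comp Primrec.fst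
  have hE : Primrec fun x : (ℕ × List Raw) × ℕ => x.1.2 := Primrec.snd.comp Primrec.fst
  have hd : Primrec fun x : (ℕ × List Raw) × ℕ => x.2 / 2 :=
    Primrec.nat_div.comp Primrec.snd (Primrec.const 2)
  exact Primrec.ite (Primrec.eq.comp (Primrec.nat_mod.comp Primrec.snd (Primrec.const 2))
    (Primrec.const 0)) (Primrec.ite (Primrec.nat_lt.comp hd hn) (Primrec.list_getElem?.comp hE hd)
      (Primrec.const none)) (Primrec.list_getElem?.comp hE (Primrec.nat_add.comp hn hd))

/-- Course-of-values recursion on the code: `l` lists the recursive calls and `g` combines their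
results. At a leaf there are no calls. -/
theorem primrec_termValue (r : ℕ) :
    Primrec fun x : (ℕ × List Raw) × ℕ => termValue r x.1.1 x.1.2 x.2 := by
  have hctx : Primrec fun x : (ℕ × List Raw) × ℕ => x.1 := Primrec.fst
  have hc : Primrec fun x : (ℕ × List Raw) × ℕ => x.2 := Primrec.snd
  have htag : Primrec fun x : (ℕ × List Raw) × ℕ => x.2.unpair.1 := primrec_unpair_fst.comp hc
  have hfun : Primrec fun x : ((ℕ × List Raw) × ℕ) × List (Option Raw) =>
      x.1.2.unpair.2.unpair.1 :=
    primrec_unpair_fst.comp (primrec_unpair_snd.comp (hc.comp Primrec.fst))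
  have hget : ∀ i, Primrec fun x : ((ℕ × List Raw) × ℕ) × List (Option Raw) =>
      x.2.getD i none := fun i => (Primrec.list_getD none).comp Primrec.snd (Primrec.const i)
  refine Primrec.nat_omega_rec' (m := fun x => x.2)
    (l := fun x => if x.2.unpair.1 = 0 then [] else [(x.1, firstArg x.2), (x.1, secondArg x.2)])
    (g := fun x l => some (if x.2.unpair.1 = 0 then lookupVar x.1.1 x.1.2 x.2.unpair.2 else
      if x.2.unpair.2.unpair.1 = 0 then
        (l.getD 0 none).bind fun a => (l.getD 1 none).map fun b => a.mul b
      else if x.2.unpair.2.unpair.1 = 1 then (l.getD 0 none).map (Raw.inv r) else some Raw.one))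
    _ hc ?_ ?_ ?_ ?_
  · refine Primrec.ite (Primrec.eq.comp htag (Primrec.const 0)) (Primrec.const [])
      (Primrec.list_cons.comp (Primrec.pair hctx (primrec_firstArg.comp hc))
        (Primrec.list_cons.comp (Primrec.pair hctx (primrec_secondArg.comp hc))
          (Primrec.const [])))
  · refine Primrec.option_some.comp (Primrec.ite
      (Primrec.eq.comp (htag.comp Primrec.fst) (Primrec.const 0))
      (primrec_lookupVar.comp (Primrec.pair (hctx.comp Primrec.fst)
        (primrec_unpair_snd.comp (hc.comp Primrec.fst))))
      (Primrec.ite (Primrec.eq.comp hfun (Primrec.const 0)) ?_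
        (Primrec.ite (Primrec.eq.comp hfun (Primrec.const 1))
          (Primrec.option_map (hget 0) ((primrec_rawInv r).comp Primrec.snd))
          (Primrec.const _))))
    exact Primrec.option_bind (hget 0) (Primrec.option_map ((hget 1).comp Primrec.fst)
      (primrec_rawMul.comp (Primrec.snd.comp Primrec.fst) Primrec.snd))
  · intro x y hy
    split_ifs at hy with h
    · simp at hy
    · rcases List.mem_cons.1 hy with rfl | hy
      · exact firstArg_lt h
      · rw [List.mem_singleton.1 hy]
        exact secondArg_lt h
  · intro x
    rw [termValue]
    by_cases h : x.2.unpair.1 = 0 <;> simp [h]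

theorem primrec_envSize : Primrec envSize := by
  refine Primrec.list_foldr (h := fun _ x => x.1.2.1 + x.1.2.2 + x.2)
    (Primrec.id (α := List Raw)) (Primrec.const 0) ?_
  have h : Primrec fun x : List Raw × Raw × ℕ => x.2.1.2 :=
    Primrec.snd.comp (Primrec.fst.comp Primrec.snd)
  exact Primrec.nat_add.comp (Primrec.nat_add.comp (Primrec.fst.comp h) (Primrec.snd.comp h))
    (Primrec.snd.comp Primrec.snd)

theorem primrec_testBound (p : ℕ) : Primrec₂ (testBound p) := by
  have hN : Primrec fun x : ℕ × ℕ => x.1 := Primrec.fst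
  have hp : Primrec fun x : ℕ × ℕ => p ^ x.1 := primrec_nat_pow.comp (Primrec.const p) hN
  have hNp : Primrec fun x : ℕ × ℕ => x.1 ^ p ^ x.1 := primrec_nat_pow.comp hN hp
  have hS : Primrec fun x : ℕ × ℕ => x.1 * x.2 := Primrec.nat_mul.comp hN Primrec.snd
  exact Primrec.nat_add.comp (Primrec.nat_add.comp (Primrec.nat_mul.comp hNp hS) hNp)
    (Primrec.nat_mul.comp hp (Primrec.nat_add.comp hS (Primrec.const 2)))

theorem primrec_testEnv : Primrec₂ testEnv := by
  have h1 : Primrec fun x : List Raw × ℕ => x.2.unpair.1.unpair :=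
    Primrec.unpair.comp (primrec_unpair_fst.comp Primrec.snd)
  have h2 : Primrec fun x : List Raw × ℕ => x.2.unpair.2.unpair :=
    Primrec.unpair.comp (primrec_unpair_snd.comp Primrec.snd)
  exact Primrec.list_concat.comp (Primrec.list_map Primrec.fst
    (primrec_scale.comp ((Primrec.fst.comp h1).comp Primrec.fst) Primrec.snd))
    (Primrec.pair (Primrec.snd.comp h1) h2)

theorem primrec_testEnvs (p : ℕ) : Primrec₂ (testEnvs p) := by
  have hB : Primrec fun x : ℕ × List Raw => (testBound p x.1 (envSize x.2) + 1) ^ 4 :=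
    primrec_nat_pow.comp (Primrec.succ.comp ((primrec_testBound p).comp Primrec.fst
      (primrec_envSize.comp Primrec.snd))) (Primrec.const 4)
  have hD : Primrec fun x : (ℕ × List Raw) × ℕ => x.2.unpair.1.unpair.1 :=
    primrec_unpair_fst.comp (primrec_unpair_fst.comp Primrec.snd)
  have hp : Primrec fun x : (ℕ × List Raw) × ℕ => p ^ x.1.1 :=
    primrec_nat_pow.comp (Primrec.const p) (Primrec.fst.comp Primrec.fst)
  refine Primrec.list_flatMap (Primrec.list_range.comp hB) (Primrec.ite ?_ ?_ (Primrec.const []))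
  · exact ((Primrec.eq.comp hD (Primrec.const 0)).not).and (Primrec.eq.comp
      (Primrec.nat_mod.comp hD hp) (Primrec.nat_mod.comp (Primrec.const 1) hp))
  · exact Primrec.list_cons.comp (primrec_testEnv.comp (Primrec.snd.comp Primrec.fst) Primrec.snd)
      (Primrec.const [])

theorem primrec_conjunction : Primrec conjunction := by
  refine Primrec.list_foldr (h := fun _ x => x.1.bind fun a => x.2.map fun b => a && b)
    (Primrec.id (α := List (Option Bool))) (Primrec.const _) ?_
  exact Primrec.option_bind (Primrec.fst.comp Primrec.snd) (Primrec.option_map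
    (Primrec.snd.comp (Primrec.snd.comp Primrec.fst))
    ((Primrec.dom_bool₂ and).comp (Primrec.snd.comp Primrec.fst) Primrec.snd))

/-- The recursive calls for a quantifier change the environment and vary in number. The recursion
therefore runs over pairs of a context and a code, with the code alone as the measure. -/
theorem primrec_truthValue (p : ℕ) :
    Primrec fun x : (ℕ × List Raw) × ℕ => truthValue p x.1.1 x.2 x.1.2 := by
  have hctx : Primrec fun x : (ℕ × List Raw) × ℕ => x.1 := Primrec.fst
  have hn : Primrec fun x : (ℕ × List Raw) × ℕ => x.1.1 := Primrec.fst.comp Primrec.fst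
  have hE : Primrec fun x : (ℕ × List Raw) × ℕ => x.1.2 := Primrec.snd.comp Primrec.fst
  have hc : Primrec fun x : (ℕ × List Raw) × ℕ => x.2 := Primrec.snd
  have htag : Primrec fun x : (ℕ × List Raw) × ℕ => x.2.unpair.1 := primrec_unpair_fst.comp hc
  have harg : Primrec fun x : (ℕ × List Raw) × ℕ => x.2.unpair.2 := primrec_unpair_snd.comp hc
  have harg1 : Primrec fun x : (ℕ × List Raw) × ℕ => x.2.unpair.2.unpair.1 :=
    primrec_unpair_fst.comp harg
  have harg2 : Primrec fun x : (ℕ × List Raw) × ℕ => x.2.unpair.2.unpair.2 :=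
    primrec_unpair_snd.comp harg
  have hget : ∀ i, Primrec fun x : ((ℕ × List Raw) × ℕ) × List (Option Bool) =>
      x.2.getD i none := fun i => (Primrec.list_getD none).comp Primrec.snd (Primrec.const i)
  have htests : Primrec fun x : (ℕ × List Raw) × ℕ => testEnvs p (precision x.2) x.1.2 :=
    (primrec_testEnvs p).comp (primrec_precision.comp hc) hE
  have heq : Primrec fun x : (ℕ × List Raw) × ℕ =>
      (termValue (torsionOrder p) x.1.1 x.1.2 x.2.unpair.2.unpair.1).bind fun a =>
        (termValue (torsionOrder p) x.1.1 x.1.2 x.2.unpair.2.unpair.2).map fun b =>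
          decide (Raw.Equal (torsionOrder p) a b) :=
    Primrec.option_bind ((primrec_termValue _).comp (Primrec.pair hctx harg1))
      (Primrec.option_map (((primrec_termValue _).comp (Primrec.pair hctx harg2)).comp Primrec.fst)
        ((primrecRel_rawEqual _).decide.comp (Primrec.snd.comp Primrec.fst) Primrec.snd))
  refine Primrec.nat_omega_rec' (m := fun x => x.2)
    (l := fun x => if x.2.unpair.1 = 0 then [] else if x.2.unpair.1 = 1 then [] else
      if x.2.unpair.1 = 2 then [(x.1, x.2.unpair.2.unpair.1), (x.1, x.2.unpair.2.unpair.2)] else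
        (testEnvs p (precision x.2) x.1.2).map fun E => ((x.1.1, E), x.2.unpair.2))
    (g := fun x l => some (if x.2.unpair.1 = 0 then some false else if x.2.unpair.1 = 1 then
      (termValue (torsionOrder p) x.1.1 x.1.2 x.2.unpair.2.unpair.1).bind fun a =>
        (termValue (torsionOrder p) x.1.1 x.1.2 x.2.unpair.2.unpair.2).map fun b =>
          decide (Raw.Equal (torsionOrder p) a b)
      else if x.2.unpair.1 = 2 then
        (l.getD 0 none).bind fun a => (l.getD 1 none).map fun b => !a || b
      else conjunction l))
    _ hc ?_ ?_ ?_ ?_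
  · refine Primrec.ite (Primrec.eq.comp htag (Primrec.const 0)) (Primrec.const [])
      (Primrec.ite (Primrec.eq.comp htag (Primrec.const 1)) (Primrec.const [])
        (Primrec.ite (Primrec.eq.comp htag (Primrec.const 2))
          (Primrec.list_cons.comp (Primrec.pair hctx harg1)
            (Primrec.list_cons.comp (Primrec.pair hctx harg2) (Primrec.const [])))
          (Primrec.list_map htests (Primrec.pair (Primrec.pair (hn.comp Primrec.fst) Primrec.snd)
            (harg.comp Primrec.fst)))))
  · refine Primrec.option_some.comp (Primrec.ite
      (Primrec.eq.comp (htag.comp Primrec.fst) (Primrec.const 0)) (Primrec.const _)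
      (Primrec.ite (Primrec.eq.comp (htag.comp Primrec.fst) (Primrec.const 1))
        (heq.comp Primrec.fst)
        (Primrec.ite (Primrec.eq.comp (htag.comp Primrec.fst) (Primrec.const 2)) ?_
          (primrec_conjunction.comp Primrec.snd))))
    exact Primrec.option_bind (hget 0) (Primrec.option_map ((hget 1).comp Primrec.fst)
      ((Primrec.dom_bool₂ fun a b => !a || b).comp (Primrec.snd.comp Primrec.fst) Primrec.snd))
  · intro x y hy
    split_ifs at hy with h h1 h2
    · simp at hy
    · simp at hy
    · rcases List.mem_cons.1 hy with rfl | hy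
      · exact (Nat.unpair_left_le _).trans_lt (unpair_right_lt h)
      · rw [List.mem_singleton.1 hy]
        exact (Nat.unpair_right_le _).trans_lt (unpair_right_lt h)
    · obtain ⟨E, -, rfl⟩ := List.mem_map.1 hy
      exact unpair_right_lt h
  · intro x
    rw [truthValue]
    by_cases h : x.2.unpair.1 = 0
    · simp [h]
    · by_cases h1 : x.2.unpair.1 = 1
      · simp [h1]
      · by_cases h2 : x.2.unpair.1 = 2
        · simp [h2]
        · simp [h, h1, h2, Function.comp_def]

end Primrec

/-! ### Paths as pairs of a residue and a `p`-adic integer -/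

section PathValue

variable {p : ℕ} [hp : Fact p.Prime]

theorem exists_plusValue (X : paths (timesTree p)) :
    ∃ z : ℤ_[p], ∀ i, PadicInt.toZModPow i z = (plusCoord X.1 i : ZMod (p ^ i)) := by
  obtain ⟨z, hz⟩ := exists_padicInt_toZModPow_eq (p := p) (fun i => plusCoord X.1 i) fun i => by
    have := (plusCoord_succ_modEq X i).symm.dvd
    exact_mod_cast this
  exact ⟨z, fun i => by rw [hz, Int.cast_natCast]⟩

/-- The element of `(ℤ/rℤ) × ℤ_p` that a path names. -/
noncomputable def pathValue (X : paths (timesTree p)) : ZMod (torsionOrder p) × ℤ_[p] :=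
  (X.1 0, (exists_plusValue X).choose)

theorem toZModPow_pathValue (X : paths (timesTree p)) (i : ℕ) :
    PadicInt.toZModPow i (pathValue X).2 = (plusCoord X.1 i : ZMod (p ^ i)) :=
  (exists_plusValue X).choose_spec i

theorem pathValue_injective : Function.Injective (pathValue (p := p)) := by
  intro X Y h
  refine paths_ext ?_ fun i => ?_
  · have h1 : ((X.1 0 : ℕ) : ZMod (torsionOrder p)) = (Y.1 0 : ℕ) := congrArg Prod.fst h
    rw [ZMod.natCast_eq_natCast_iff] at h1
    exact h1.eq_of_lt_of_lt (mem_paths_timesTree.1 X.2).1 (mem_paths_timesTree.1 Y.2).1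
  · have h1 := toZModPow_pathValue X i
    rw [h, toZModPow_pathValue, ZMod.natCast_eq_natCast_iff] at h1
    exact (h1.eq_of_lt_of_lt (plusCoord_lt Y i) (plusCoord_lt X i)).symm

theorem pathValue_surjective : Function.Surjective (pathValue (p := p)) := by
  rintro ⟨x, z⟩
  have : NeZero (torsionOrder p) := ⟨(torsionOrder_pos p).ne'⟩
  have hne : ∀ i, NeZero (p ^ i) := fun i => ⟨pow_ne_zero _ hp.out.ne_zero⟩
  obtain ⟨X, hX0, hX⟩ := exists_path (p := p) (ZMod.val_lt x)
    (y := fun i => (PadicInt.toZModPow i z).val) (fun i => ZMod.val_lt _) fun i => by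
      rw [← ZMod.natCast_eq_natCast_iff, ZMod.natCast_zmod_val, ZMod.natCast_val]
      exact PadicInt.cast_toZModPow i (i + 1) (Nat.le_succ i) z
  refine ⟨X, Prod.ext ?_ (PadicInt.ext_of_toZModPow.1 fun i => ?_)⟩
  · simp [pathValue, hX0]
  · rw [toZModPow_pathValue, hX, ZMod.natCast_zmod_val]

theorem pathValue_timesMul (X Y : paths (timesTree p)) :
    pathValue (timesMul X Y) = pathValue X + pathValue Y := by
  refine Prod.ext ?_ (PadicInt.ext_of_toZModPow.1 fun i => ?_)
  · change (((X.1 0 + Y.1 0) % torsionOrder p : ℕ) : ZMod (torsionOrder p)) = _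
    rw [ZMod.natCast_mod, Nat.cast_add]
    rfl
  · rw [Prod.snd_add, map_add, toZModPow_pathValue, toZModPow_pathValue, toZModPow_pathValue,
      plusCoord_timesMul, ZMod.natCast_mod, Nat.cast_add]

theorem pathValue_timesOne : pathValue (timesOne (p := p)) = 0 := by
  have h := pathValue_timesMul (timesOne (p := p)) timesOne
  have e : timesMul (timesOne (p := p)) timesOne = timesOne := by
    refine paths_ext ?_ fun i => ?_
    · simp [timesMul, timesOne]
    · rw [plusCoord_timesMul, plusCoord_timesOne, Nat.add_zero, Nat.zero_mod]
  rw [e] at h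
  exact left_eq_add.1 h

theorem pathValue_timesInv (X : paths (timesTree p)) :
    pathValue (timesInv X) = -pathValue X := by
  have h := pathValue_timesMul X (timesInv X)
  rw [timesMul_timesInv, pathValue_timesOne] at h
  exact eq_neg_of_add_eq_zero_right h.symm

/-- The integer `u - v` of a name `(x, u, v)`. -/
def Raw.toInt (a : Raw) : ℤ := a.2.1 - a.2.2

/-- The element of `(ℤ/rℤ) × ℤ_p` with the name `(x, u, v)`. -/
noncomputable def rawValue (p : ℕ) [Fact p.Prime] (a : Raw) : ZMod (torsionOrder p) × ℤ_[p] :=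
  (a.1, (a.toInt : ℤ_[p]))

theorem rawValue_mul (a b : Raw) : rawValue p (a.mul b) = rawValue p a + rawValue p b := by
  refine Prod.ext ?_ ?_
  · simp [rawValue, Raw.mul]
  · simp only [rawValue, Raw.mul, Raw.toInt, Prod.snd_add]
    push_cast
    ring

theorem rawValue_inv (a : Raw) : rawValue p (a.inv (torsionOrder p)) = -rawValue p a := by
  refine Prod.ext ?_ ?_
  · simp [rawValue, Raw.inv, Nat.cast_sub (torsionOrder_pos p)]
  · simp [rawValue, Raw.inv, Raw.toInt]

theorem rawValue_one : rawValue p Raw.one = 0 := by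
  simp [rawValue, Raw.one, Raw.toInt]

/-- Since `ℤ` embeds into `ℤ_p`, equality of the named elements is an exact equation between
integers, here written without subtraction. -/
theorem rawEqual_iff (a b : Raw) :
    Raw.Equal (torsionOrder p) a b ↔ rawValue p a = rawValue p b := by
  rw [Prod.ext_iff, Raw.Equal]
  refine and_congr (ZMod.natCast_eq_natCast_iff _ _ _).symm ?_
  rw [rawValue, rawValue, Int.cast_inj, Raw.toInt, Raw.toInt]
  omega

end PathValue

/-! ### The evaluator is correct -/

section Evaluator

open Finset FirstOrder.Language

variable {p : ℕ} [hp : Fact p.Prime]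

/-- The entry number `i` of an environment. -/
def envEntry (E : List Raw) (i : ℕ) : Raw := E.getD i Raw.one

/-- The names in the environment `E` approximate the elements `X 0, X 1, …` with precision `N`. -/
structure Approximates (N : ℕ) (X : ℕ → ZMod (torsionOrder p) × ℤ_[p]) (E : List Raw) : Prop where
  fst_eq : ∀ i < E.length, (X i).1 = (rawValue p (envEntry E i)).1
  similar : Similar N E.length (fun i => (X i).2) fun i => ((envEntry E i).toInt : ℤ_[p])

theorem Approximates.mono {N N' : ℕ} {X : ℕ → ZMod (torsionOrder p) × ℤ_[p]} {E : List Raw}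
    (h : Approximates N' X E) (hN : N ≤ N') : Approximates N X E :=
  ⟨h.fst_eq, h.similar.mono hN⟩

theorem Similar.of_eq {N m : ℕ} {y y' z z' : ℕ → ℤ_[p]} (h : Similar N m y y')
    (hz : ∀ i < m, y i = z i) (hz' : ∀ i < m, y' i = z' i) : Similar N m z z' := by
  refine ⟨fun i hi => by rw [← hz i hi, ← hz' i hi]; exact h.congr i hi, fun a ha => ?_⟩
  have e : ∀ {y z : ℕ → ℤ_[p]}, (∀ i < m, y i = z i) →
      ∑ i ∈ range m, (a i : ℤ_[p]) * z i = ∑ i ∈ range m, (a i : ℤ_[p]) * y i := fun hyz =>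
    sum_congr rfl fun i hi => by rw [hyz i (mem_range.1 hi)]
  rw [e hz, e hz']
  exact h.relations a ha

theorem toInt_scale (D : ℕ) (a : Raw) : (a.scale D).toInt = D * a.toInt := by
  simp only [Raw.scale, Raw.toInt]
  push_cast
  ring

theorem envEntry_scaled_append {E : List Raw} (D : ℕ) (a : Raw) {i : ℕ} (hi : i < E.length) :
    envEntry (E.map (Raw.scale D) ++ [a]) i = (envEntry E i).scale D := by
  simp [envEntry, List.getD_eq_getElem?_getD, List.getElem?_append, hi]

theorem envEntry_scaled_append_self (E : List Raw) (D : ℕ) (a : Raw) :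
    envEntry (E.map (Raw.scale D) ++ [a]) E.length = a := by
  simp [envEntry, List.getD_eq_getElem?_getD]

theorem sum_abs_toInt_le (E : List Raw) :
    ∑ i ∈ range E.length, |(envEntry E i).toInt| ≤ envSize E := by
  induction E with
  | nil => simp [envSize]
  | cons a E ih =>
    have e : ∀ i, envEntry (a :: E) (i + 1) = envEntry E i := fun i => by simp [envEntry]
    have e0 : envEntry (a :: E) 0 = a := by simp [envEntry]
    have h : |a.toInt| ≤ a.2.1 + a.2.2 := by
      rw [Raw.toInt, abs_le]
      constructor <;> omega
    rw [List.length_cons, sum_range_succ', e0]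
    simp only [e]
    have h2 : envSize (a :: E) = a.2.1 + a.2.2 + envSize E := rfl
    rw [h2]
    push_cast
    linarith

/-- An approximating environment for an extended tuple is found among the scaled and extended
environments. -/
theorem Approximates.of_similar_update {N : ℕ} {X : ℕ → ZMod (torsionOrder p) × ℤ_[p]}
    {E : List Raw} {D : ℕ} {a : Raw} {z : ZMod (torsionOrder p) × ℤ_[p]}
    (h1 : ∀ i < E.length, (X i).1 = (rawValue p (envEntry E i)).1) (ha : z.1 = (a.1 : ℕ))
    (h : Similar N (E.length + 1) (Function.update (fun i => (X i).2) E.length z.2)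
      (Function.update (fun i => ((D * (envEntry E i).toInt : ℤ) : ℤ_[p])) E.length a.toInt)) :
    Approximates N (Function.update X E.length z) (E.map (Raw.scale D) ++ [a]) := by
  have hl : (E.map (Raw.scale D) ++ [a]).length = E.length + 1 := by simp
  refine ⟨fun i hi => ?_, ?_⟩
  · rw [hl] at hi
    rcases Nat.lt_succ_iff_lt_or_eq.1 hi with hi | rfl
    · rw [Function.update_of_ne hi.ne, h1 i hi, envEntry_scaled_append D a hi]
      rfl
    · rw [Function.update_self, envEntry_scaled_append_self, ha]
      rfl
  · rw [hl]
    refine h.of_eq (fun i hi => ?_) fun i hi => ?_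
    · rcases Nat.lt_succ_iff_lt_or_eq.1 hi with hi | rfl
      · rw [Function.update_of_ne hi.ne, Function.update_of_ne hi.ne]
      · rw [Function.update_self, Function.update_self]
    · rcases Nat.lt_succ_iff_lt_or_eq.1 hi with hi | rfl
      · rw [Function.update_of_ne hi.ne, envEntry_scaled_append D a hi, toInt_scale]
      · rw [Function.update_self, envEntry_scaled_append_self]

/-- One half of the game: no element escapes the finite list of tests, so passing all of them proves
a universal statement. -/
theorem Approximates.exists_test {N N' : ℕ} {X : ℕ → ZMod (torsionOrder p) × ℤ_[p]}
    {E : List Raw} (h : Approximates N' X E) (hN : 2 * N * N + 2 * N < N')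
    (z : ZMod (torsionOrder p) × ℤ_[p]) :
    ∃ E' ∈ testEnvs p N' E, Approximates N (Function.update X E.length z) E' ∧
      E'.length = E.length + 1 := by
  obtain ⟨D, u, hDle, hule, hD0, hD1, hsim⟩ :=
    h.similar.exists_integer_extension hN.le z.2 (sum_abs_toInt_le E)
  have : NeZero (torsionOrder p) := ⟨(torsionOrder_pos p).ne'⟩
  set B := testBound p N' (envSize E) with hB
  have hx : z.1.val ≤ B := by
    have h1 : z.1.val < torsionOrder p := ZMod.val_lt _
    have h2 : torsionOrder p ≤ p := by
      unfold torsionOrder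
      have := hp.out.two_le
      split <;> omega
    -- The last summand of `testBound` also covers the torsion coordinate, because `torsionOrder p ≤
    -- p ≤ p ^ N'`. This uses `N' > 0`, which the strict inequality `hN` provides.
    have h3 : p ^ N' * 2 ≤ B := by
      rw [hB, testBound]
      have := Nat.mul_le_mul_left (p ^ N') (Nat.le_add_left 2 (N' * envSize E))
      omega
    have h4 : p ≤ p ^ N' := Nat.le_self_pow (Nat.zero_lt_of_lt hN).ne' p
    omega
  have hu1 : u.toNat ≤ B := by rw [abs_le] at hule; omega
  have hu2 : (-u).toNat ≤ B := by rw [abs_le] at hule; omega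
  set j := Nat.pair (Nat.pair D z.1.val) (Nat.pair u.toNat (-u).toNat) with hj
  -- Pairing numbers up to `B` stays below `(B + 1) ^ 2`; two nested pairings give the fourth power
  -- that bounds the test range.
  have hjB : j < (B + 1) ^ 4 := by
    have h1 := Nat.pair_lt_max_add_one_sq D z.1.val
    have h2 := Nat.pair_lt_max_add_one_sq u.toNat (-u).toNat
    have h3 := Nat.pair_lt_max_add_one_sq (Nat.pair D z.1.val) (Nat.pair u.toNat (-u).toNat)
    have h4 : (max D z.1.val + 1) ^ 2 ≤ (B + 1) ^ 2 := Nat.pow_le_pow_left (by omega) 2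
    have h5 : (max u.toNat (-u).toNat + 1) ^ 2 ≤ (B + 1) ^ 2 := Nat.pow_le_pow_left (by omega) 2
    refine h3.trans_le ?_
    rw [show (B + 1) ^ 4 = ((B + 1) ^ 2) ^ 2 by ring]
    exact Nat.pow_le_pow_left (by omega) 2
  have hE' : testEnv E j = E.map (Raw.scale D) ++ [(z.1.val, u.toNat, (-u).toNat)] := by
    simp [testEnv, hj]
  refine ⟨testEnv E j, ?_, ?_, by simp [hE']⟩
  · refine List.mem_flatMap.2 ⟨j, List.mem_range.2 hjB, ?_⟩
    have : j.unpair.1.unpair.1 = D := by simp [hj]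
    rw [this, if_pos ⟨hD0, hD1⟩]
    exact List.mem_singleton.2 rfl
  · rw [hE']
    refine Approximates.of_similar_update h.fst_eq (by simp) ?_
    have e : Raw.toInt (z.1.val, u.toNat, (-u).toNat) = u := by
      simp only [Raw.toInt]; omega
    rw [e]
    exact hsim

/-- The other half: every test on the list is the shadow of an actual element, so one failing test
refutes a universal statement. By symmetry of similarity the extension step is played from the
integers towards `ℤ_p`. -/
theorem Approximates.exists_of_test {N N' : ℕ} {X : ℕ → ZMod (torsionOrder p) × ℤ_[p]}
    {E E' : List Raw} (h : Approximates N' X E) (hN : 2 * N * N + 2 * N ≤ N')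
    (hE' : E' ∈ testEnvs p N' E) :
    ∃ z, Approximates N (Function.update X E.length z) E' ∧ E'.length = E.length + 1 := by
  obtain ⟨j, -, hj⟩ := List.mem_flatMap.1 hE'
  split_ifs at hj with hD
  · obtain rfl := List.mem_singleton.1 hj
    set D := j.unpair.1.unpair.1
    have hD1 : (p : ℤ) ^ N' ∣ (D : ℤ) - 1 := by
      have := (show 1 ≡ D [MOD p ^ N'] from hD.2.symm).dvd
      exact_mod_cast this
    have h1 := (h.similar.smul_right (D := D) (by exact_mod_cast hD.1) hD1).symm
    obtain ⟨z, hz⟩ := h1.exists_extension hN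
      ((Raw.toInt (j.unpair.1.unpair.2, j.unpair.2.unpair) : ℤ) : ℤ_[p])
    refine ⟨((j.unpair.1.unpair.2 : ℕ), z), Approximates.of_similar_update h.fst_eq rfl ?_,
      by simp [testEnv]⟩
    simp only [Int.cast_mul]
    exact hz.symm
  · simp at hj

/-- Every tuple is approximated by an environment. -/
theorem exists_approximates (X : ℕ → ZMod (torsionOrder p) × ℤ_[p]) (n : ℕ) :
    ∀ N, ∃ E : List Raw, E.length = n ∧ Approximates N X E := by
  induction n with
  | zero =>
    refine fun N => ⟨[], rfl, ⟨fun i hi => absurd hi (by simp), ⟨fun i hi => absurd hi (by simp),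
      fun a _ => by simp⟩⟩⟩
  | succ n ih =>
    intro N
    -- Each further entry costs one back-and-forth step, so the shorter tuple is approximated with
    -- more precision; the final 1 makes the inequality strict.
    obtain ⟨E, rfl, hE⟩ := ih (2 * N * N + 2 * N + 1)
    obtain ⟨E', -, hE', hl⟩ := hE.exists_test (Nat.lt_succ_self _) (X E.length)
    exact ⟨E', hl, by simpa using hE'⟩

end Evaluator

section Terms

open Finset FirstOrder.Language

variable {p : ℕ} [hp : Fact p.Prime]

/-! ### Codes of terms and formulas -/

/-- The number of the product of the terms with the numbers `c` and `d`. -/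
def mulCode (c d : ℕ) : ℕ := Nat.pair 1 (Nat.pair 0 (Nat.pair c (Nat.pair d 0 + 1) + 1))

/-- The number of the inverse of the term with the number `c`. -/
def invCode (c : ℕ) : ℕ := Nat.pair 1 (Nat.pair 1 (Nat.pair c 0 + 1))

/-- The number of the constant term. -/
def oneCode : ℕ := Nat.pair 1 (Nat.pair 2 0)

theorem termCode_mul {α : Type} (v : α → ℕ) (ts : Fin 2 → groupLang.Term α) :
    termCode v (Term.func (L := groupLang) GroupFunc.mul ts) =
      mulCode (termCode v (ts 0)) (termCode v (ts 1)) := by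
  rw [termCode.eq_def]
  simp [List.ofFn_succ, Encodable.encode_list_cons, mulCode]
  rfl

theorem termCode_inv {α : Type} (v : α → ℕ) (ts : Fin 1 → groupLang.Term α) :
    termCode v (Term.func (L := groupLang) GroupFunc.inv ts) =
      invCode (termCode v (ts 0)) := by
  rw [termCode.eq_def]
  simp [List.ofFn_succ, Encodable.encode_list_cons, invCode]
  rfl

theorem termCode_one {α : Type} (v : α → ℕ) (ts : Fin 0 → groupLang.Term α) :
    termCode v (Term.func (L := groupLang) GroupFunc.one ts) = oneCode := by
  rw [termCode.eq_def]
  simp [oneCode]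
  rfl

theorem termValue_var (r n : ℕ) (E : List Raw) (c : ℕ) :
    termValue r n E (Nat.pair 0 c) = lookupVar n E c := by
  rw [termValue]; simp

theorem termValue_mulCode (r n : ℕ) (E : List Raw) (c d : ℕ) :
    termValue r n E (mulCode c d) =
      (termValue r n E c).bind fun a => (termValue r n E d).map fun b => a.mul b := by
  rw [termValue]; simp [mulCode, firstArg, secondArg]

theorem termValue_invCode (r n : ℕ) (E : List Raw) (c : ℕ) :
    termValue r n E (invCode c) = (termValue r n E c).map (Raw.inv r) := by
  rw [termValue]; simp [invCode, firstArg]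

theorem termValue_oneCode (r n : ℕ) (E : List Raw) :
    termValue r n E oneCode = some Raw.one := by
  rw [termValue]; simp [oneCode]

/-- Coefficients add up when terms are multiplied. That codes grow faster keeps every coefficient
bounded by the code of the term. -/
theorem add_lt_mulCode (c d : ℕ) : c + d + 1 < mulCode c d := by
  unfold mulCode
  have h1 := Nat.add_le_pair 1 (Nat.pair 0 (Nat.pair c (Nat.pair d 0 + 1) + 1))
  have h2 := Nat.add_le_pair 0 (Nat.pair c (Nat.pair d 0 + 1) + 1)
  have h3 := Nat.add_le_pair c (Nat.pair d 0 + 1)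
  have h4 := Nat.add_le_pair d 0
  omega

theorem lt_invCode (c : ℕ) : c < invCode c := by
  unfold invCode
  have h1 := Nat.add_le_pair 1 (Nat.pair 1 (Nat.pair c 0 + 1))
  have h2 := Nat.add_le_pair 1 (Nat.pair c 0 + 1)
  have h3 := Nat.add_le_pair c 0
  omega

/-- The values `X` of the positions of an environment agree with the values of the variables. -/
def Agree (n₀ : ℕ) {n k : ℕ} (v : Fin n ⊕ Fin k → paths (timesTree p))
    (X : ℕ → ZMod (torsionOrder p) × ℤ_[p]) : Prop :=
  (∀ i : Fin n, i < n₀ → X i = pathValue (v (.inl i))) ∧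
    ∀ j : Fin k, X (n₀ + j) = pathValue (v (.inr j))

theorem lookupVar_varCode {n₀ n k : ℕ} {E : List Raw} {s : Fin n ⊕ Fin k} {e : Raw}
    {v : Fin n ⊕ Fin k → paths (timesTree p)} {X : ℕ → ZMod (torsionOrder p) × ℤ_[p]}
    (hX : Agree n₀ v X) (h : lookupVar n₀ E (varCode s) = some e) :
    ∃ i < E.length, envEntry E i = e ∧ X i = pathValue (v s) := by
  have key : ∀ i, E[i]? = some e → i < E.length ∧ envEntry E i = e := fun i hi => by
    obtain ⟨h1, h2⟩ := List.getElem?_eq_some_iff.1 hi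
    exact ⟨h1, by simp [envEntry, List.getD_eq_getElem?_getD, hi]⟩
  cases s with
  | inl i =>
    simp only [lookupVar, varCode, Nat.mul_mod_right, if_true,
      Nat.mul_div_cancel_left _ (Nat.succ_pos 1)] at h
    split_ifs at h with hi
    exact ⟨i, (key _ h).1, (key _ h).2, hX.1 i hi⟩
  | inr j =>
    have h1 : (2 * (j : ℕ) + 1) % 2 ≠ 0 := by omega
    have h2 : (2 * (j : ℕ) + 1) / 2 = j := by omega
    simp only [lookupVar, varCode, h1, if_false, h2] at h
    exact ⟨n₀ + j, (key _ h).1, (key _ h).2, hX.2 j⟩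

/-- The value of a term in an environment, and its value in the structure, are the same integer
linear combination of the values of the variables, with small coefficients. -/
theorem exists_coefficients {n₀ n k : ℕ} {E : List Raw}
    {v : Fin n ⊕ Fin k → paths (timesTree p)} {X : ℕ → ZMod (torsionOrder p) × ℤ_[p]}
    (hX : Agree n₀ v X) (t : groupLang.Term (Fin n ⊕ Fin k)) :
    ∀ e, termValue (torsionOrder p) n₀ E (termCode varCode t) = some e →
      ∃ a : ℕ → ℤ, (∀ i, |a i| ≤ (termCode varCode t : ℕ) + 1) ∧
        rawValue p e = ∑ i ∈ range E.length, a i • rawValue p (envEntry E i) ∧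
        pathValue (t.realize (M := (timesPresentation p).Path) v) =
          ∑ i ∈ range E.length, a i • X i := by
  induction t with
  | var s =>
    intro e he
    rw [termCode, termValue_var] at he
    obtain ⟨i, hi, hei, hXi⟩ := lookupVar_varCode hX he
    refine ⟨fun j => if j = i then 1 else 0, fun j => ?_, ?_, ?_⟩
    · beta_reduce
      split_ifs
      · simp
      · rw [abs_zero]
        positivity
    · simp [ite_smul, hi, hei]
    · simp only [ite_smul, one_smul, zero_smul, sum_ite_eq', mem_range, hi, if_true, hXi]
      rfl
  | func f ts ih =>
    intro e he
    cases f with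
    | mul =>
      rw [termCode_mul] at he ⊢
      rw [termValue_mulCode] at he
      obtain ⟨e₀, h0, he⟩ := Option.bind_eq_some_iff.1 he
      obtain ⟨e₁, h1, rfl⟩ := Option.map_eq_some_iff.1 he
      obtain ⟨a₀, hb₀, hr₀, hp₀⟩ := ih 0 _ h0
      obtain ⟨a₁, hb₁, hr₁, hp₁⟩ := ih 1 _ h1
      refine ⟨fun i => a₀ i + a₁ i, fun i => ?_, ?_, ?_⟩
      · have h3 : ((termCode varCode (ts 0) + termCode varCode (ts 1) + 1 : ℕ) : ℤ) <
            mulCode (termCode varCode (ts 0)) (termCode varCode (ts 1)) := by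
          exact_mod_cast add_lt_mulCode _ _
        push_cast at h3
        have := abs_add_le (a₀ i) (a₁ i)
        have := hb₀ i
        have := hb₁ i
        beta_reduce
        linarith
      · simp only [rawValue_mul, hr₀, hr₁, add_smul, sum_add_distrib]
      · refine (pathValue_timesMul _ _).trans ?_
        simp only [add_smul, sum_add_distrib]
        exact congrArg₂ (· + ·) hp₀ hp₁
    | inv =>
      rw [termCode_inv] at he ⊢
      rw [termValue_invCode] at he
      obtain ⟨e₀, h0, rfl⟩ := Option.map_eq_some_iff.1 he
      obtain ⟨a₀, hb₀, hr₀, hp₀⟩ := ih 0 _ h0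
      refine ⟨fun i => - a₀ i, fun i => ?_, ?_, ?_⟩
      · have h3 : ((termCode varCode (ts 0) : ℕ) : ℤ) < invCode (termCode varCode (ts 0)) := by
          exact_mod_cast lt_invCode _
        have := hb₀ i
        rw [abs_neg]
        linarith
      · simp only [rawValue_inv, hr₀, neg_smul, sum_neg_distrib]
      · refine (pathValue_timesInv _).trans ?_
        simp only [neg_smul, sum_neg_distrib]
        exact congrArg Neg.neg hp₀
    | one =>
      rw [termCode_one] at he ⊢
      rw [termValue_oneCode] at he
      obtain rfl := Option.some.inj he
      refine ⟨fun _ => 0, fun i => ?_, ?_, ?_⟩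
      · simp only [abs_zero]
        positivity
      · simp [rawValue_one]
      · simp only [zero_smul, sum_const_zero]
        exact pathValue_timesOne

end Terms

/-! ### Correctness and totality of the evaluator on formulas -/

section Formulas

open Finset FirstOrder.Language

variable {p : ℕ} [hp : Fact p.Prime]

theorem precision_mono {c d : ℕ} (h : c ≤ d) : precision c ≤ precision d :=
  Nat.pow_le_pow_right two_pos (Nat.pow_le_pow_right (by norm_num) (by omega))

theorem add_two_le_precision (c : ℕ) : c + 2 ≤ precision c := by
  have h1 : 4 ^ (c + 1) < precision c := Nat.lt_pow_self (by norm_num)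
  have h2 : c + 1 < 4 ^ (c + 1) := Nat.lt_pow_self (by norm_num)
  omega

/-- Passing to the next code raises the precision to its fourth power, which beats `2N² + 2N` for `N
≥ 2`. Subformulas have smaller codes. -/
theorem precision_step {c d : ℕ} (h : c < d) :
    2 * precision c * precision c + 2 * precision c < precision d := by
  refine lt_of_lt_of_le ?_ (precision_mono (Nat.succ_le_of_lt h))
  have e : precision (c + 1) = precision c ^ 4 := by
    unfold precision
    rw [← pow_mul]
    ring_nf
  rw [e]
  have h2 := add_two_le_precision c
  have h3 : 4 ≤ precision c ^ 2 := by nlinarith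
  have h1 : 2 ≤ precision c := by omega
  calc 2 * precision c * precision c + 2 * precision c
      < 4 * precision c ^ 2 := by
        have h4 := Nat.mul_le_mul_right (precision c) h1
        have h5 : 0 < precision c * precision c := by positivity
        rw [pow_two, mul_assoc]
        omega
    _ ≤ precision c ^ 2 * precision c ^ 2 := Nat.mul_le_mul_right _ h3
    _ = _ := by ring

theorem formulaCode_falsum {n k : ℕ} :
    formulaCode (BoundedFormula.falsum : groupLang.BoundedFormula (Fin n) k) = Nat.pair 0 0 := by
  rw [formulaCode.eq_def]

theorem formulaCode_equal {n k : ℕ} (t s : groupLang.Term (Fin n ⊕ Fin k)) :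
    formulaCode (BoundedFormula.equal t s) =
      Nat.pair 1 (Nat.pair (termCode varCode t) (termCode varCode s)) := by
  rw [formulaCode.eq_def]

theorem formulaCode_imp {n k : ℕ} (φ ψ : groupLang.BoundedFormula (Fin n) k) :
    formulaCode (φ.imp ψ) = Nat.pair 2 (Nat.pair (formulaCode φ) (formulaCode ψ)) := by
  rw [formulaCode.eq_def]

theorem formulaCode_all {n k : ℕ} (φ : groupLang.BoundedFormula (Fin n) (k + 1)) :
    formulaCode φ.all = Nat.pair 3 (formulaCode φ) := by
  rw [formulaCode.eq_def]

omit hp in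
theorem truthValue_falsum (n : ℕ) (E : List Raw) :
    truthValue p n (Nat.pair 0 0) E = some false := by
  rw [truthValue]; simp

omit hp in
theorem truthValue_equal (n c d : ℕ) (E : List Raw) :
    truthValue p n (Nat.pair 1 (Nat.pair c d)) E =
      (termValue (torsionOrder p) n E c).bind fun a =>
        (termValue (torsionOrder p) n E d).map fun b =>
          decide (Raw.Equal (torsionOrder p) a b) := by
  rw [truthValue]; simp

omit hp in
theorem truthValue_imp (n c d : ℕ) (E : List Raw) :
    truthValue p n (Nat.pair 2 (Nat.pair c d)) E =
      (truthValue p n c E).bind fun a => (truthValue p n d E).map fun b => !a || b := by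
  rw [truthValue]; simp

omit hp in
theorem truthValue_all (n c : ℕ) (E : List Raw) :
    truthValue p n (Nat.pair 3 c) E = conjunction
      ((testEnvs p (precision (Nat.pair 3 c)) E).map (truthValue p n c)) := by
  rw [truthValue]; simp

theorem conjunction_eq_some_true {l : List (Option Bool)} (h : conjunction l = some true) :
    ∀ o ∈ l, o = some true := by
  induction l with
  | nil => simp
  | cons o l ih =>
    change o.bind (fun a => (conjunction l).map fun b => a && b) = some true at h
    obtain ⟨a, rfl, h⟩ := Option.bind_eq_some_iff.1 h
    obtain ⟨b, hb, h⟩ := Option.map_eq_some_iff.1 h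
    rw [Bool.and_eq_true] at h
    obtain ⟨rfl, rfl⟩ := h
    simpa using ih hb

theorem conjunction_eq_some_false {l : List (Option Bool)} (h : conjunction l = some false) :
    some false ∈ l := by
  induction l with
  | nil => simp [conjunction] at h
  | cons o l ih =>
    change o.bind (fun a => (conjunction l).map fun b => a && b) = some false at h
    obtain ⟨a, rfl, h⟩ := Option.bind_eq_some_iff.1 h
    obtain ⟨b, hb, h⟩ := Option.map_eq_some_iff.1 h
    rw [Bool.and_eq_false_iff] at h
    rcases h with rfl | rfl
    · simp
    · exact List.mem_cons_of_mem _ (ih hb)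

theorem exists_conjunction_eq_some {l : List (Option Bool)} (h : ∀ o ∈ l, ∃ b, o = some b) :
    ∃ b, conjunction l = some b := by
  induction l with
  | nil => exact ⟨true, rfl⟩
  | cons o l ih =>
    obtain ⟨a, rfl⟩ := h o (by simp)
    obtain ⟨b, hb⟩ := ih fun o ho => h o (List.mem_cons_of_mem _ ho)
    refine ⟨a && b, ?_⟩
    change (some a).bind (fun a => (conjunction l).map fun b => a && b) = _
    simp [hb]

theorem Agree.extend {n₀ n k : ℕ} {v : Fin n → paths (timesTree p)}
    {xs : Fin k → paths (timesTree p)} {X : ℕ → ZMod (torsionOrder p) × ℤ_[p]}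
    (hX : Agree n₀ (Sum.elim v xs) X) (y : paths (timesTree p)) :
    Agree n₀ (Sum.elim v (Fin.snoc xs y : Fin (k + 1) → paths (timesTree p)))
      (Function.update X (n₀ + k) (pathValue y)) := by
  refine ⟨fun i hi => ?_, fun j => ?_⟩
  · rw [Function.update_of_ne (by omega)]
    exact hX.1 i hi
  · refine Fin.lastCases ?_ (fun j => ?_) j
    · simp
    · have hj : n₀ + (j.castSucc : Fin (k + 1)).val ≠ n₀ + k := by
        have := j.2
        simp only [Fin.val_castSucc]
        omega
      rw [Function.update_of_ne hj]
      simpa using hX.2 j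

/-- An equation between small linear combinations holds for the approximated elements if and only
if it holds for their names. -/
theorem Approximates.combination_eq_iff {N : ℕ} {X : ℕ → ZMod (torsionOrder p) × ℤ_[p]}
    {E : List Raw} (hE : Approximates N X E) {a a' : ℕ → ℤ} (h : ∀ i, |a i - a' i| ≤ N) :
    ∑ i ∈ range E.length, a i • rawValue p (envEntry E i) =
        ∑ i ∈ range E.length, a' i • rawValue p (envEntry E i) ↔
      ∑ i ∈ range E.length, a i • X i = ∑ i ∈ range E.length, a' i • X i := by
  rw [← sub_eq_zero, ← sum_sub_distrib, ← sub_eq_zero (a := ∑ i ∈ range E.length, a i • X i),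
    ← sum_sub_distrib]
  simp only [← sub_smul, Prod.ext_iff, Prod.fst_sum, Prod.snd_sum, Prod.smul_fst, Prod.smul_snd,
    Prod.fst_zero, Prod.snd_zero]
  refine and_congr ?_ ?_
  · rw [sum_congr rfl fun i hi => (by rw [hE.fst_eq i (mem_range.1 hi)] :
      (a i - a' i) • (rawValue p (envEntry E i)).1 = (a i - a' i) • (X i).1)]
  · simp only [zsmul_eq_mul]
    exact (hE.similar.relations (fun i => a i - a' i) h).symm

/-- The evaluator is correct in environments that approximate the values of the variables. -/
theorem truthValue_correct {n₀ n k : ℕ} (φ : groupLang.BoundedFormula (Fin n) k) :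
    ∀ (v : Fin n → (timesPresentation p).Path) (xs : Fin k → (timesPresentation p).Path)
      (E : List Raw) (X : ℕ → ZMod (torsionOrder p) × ℤ_[p]) (b : Bool),
      E.length = n₀ + k → Approximates (precision (formulaCode φ)) X E →
      Agree n₀ (Sum.elim v xs) X →
      truthValue p n₀ (formulaCode φ) E = some b → (b = true ↔ φ.Realize v xs) := by
  induction φ with
  | falsum =>
    intro v xs E X b _ _ _ h
    rw [formulaCode_falsum, truthValue_falsum] at h
    obtain rfl := Option.some.inj h
    exact iff_of_false (by simp) id
  | equal t s =>
    intro v xs E X b _ hE hX h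
    rw [formulaCode_equal] at h hE
    rw [truthValue_equal] at h
    obtain ⟨e, he, h⟩ := Option.bind_eq_some_iff.1 h
    obtain ⟨e', he', rfl⟩ := Option.map_eq_some_iff.1 h
    obtain ⟨a, ha, hr, hv⟩ := exists_coefficients hX t e he
    obtain ⟨a', ha', hr', hv'⟩ := exists_coefficients hX s e' he'
    rw [decide_eq_true_iff, rawEqual_iff, hr, hr']
    refine (hE.combination_eq_iff fun i => ?_).trans
      ((Iff.of_eq (congrArg₂ Eq hv.symm hv'.symm)).trans pathValue_injective.eq_iff)
    -- The two coefficients are at most the codes of their terms plus 1. The sum of these bounds is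
    -- at most the code of the equation plus 1, hence below its precision.
    have h1 := Nat.add_le_pair 1 (Nat.pair (termCode varCode t) (termCode varCode s))
    have h2 := Nat.add_le_pair (termCode varCode t) (termCode varCode s)
    have h3 := add_two_le_precision
      (Nat.pair 1 (Nat.pair (termCode varCode t) (termCode varCode s)))
    have h4 := abs_sub (a i) (a' i)
    have h5 := ha i
    have h6 := ha' i
    omega
  | rel R => exact isEmptyElim R
  | imp φ ψ ihφ ihψ =>
    intro v xs E X b hl hE hX h
    rw [formulaCode_imp] at h hE
    rw [truthValue_imp] at h
    obtain ⟨b₁, h₁, h⟩ := Option.bind_eq_some_iff.1 h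
    obtain ⟨b₂, h₂, rfl⟩ := Option.map_eq_some_iff.1 h
    have hφ := ihφ v xs E X b₁ hl (hE.mono (precision_mono ((Nat.left_le_pair _ _).trans
      (Nat.right_le_pair _ _)))) hX h₁
    have hψ := ihψ v xs E X b₂ hl (hE.mono (precision_mono ((Nat.right_le_pair _ _).trans
      (Nat.right_le_pair _ _)))) hX h₂
    rw [BoundedFormula.realize_imp, ← hφ, ← hψ]
    cases b₁ <;> simp
  | @all k φ ih =>
    intro v xs E X b hl hE hX h
    rw [formulaCode_all] at h hE
    rw [truthValue_all] at h
    have hlt : formulaCode φ < Nat.pair 3 (formulaCode φ) := by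
      have := Nat.add_le_pair 3 (formulaCode φ)
      omega
    have hstep := precision_step hlt
    rw [BoundedFormula.realize_all]
    cases b with
    | true =>
      refine iff_of_true rfl fun y => ?_
      obtain ⟨E', hE't, hE', hl'⟩ := hE.exists_test hstep (pathValue y)
      have h1 := conjunction_eq_some_true h _ (List.mem_map_of_mem hE't)
      rw [hl] at hE' hl'
      exact (ih v (Fin.snoc xs y) E' _ true hl' hE' (hX.extend y) h1).1 rfl
    | false =>
      refine iff_of_false (by simp) fun hall => ?_
      obtain ⟨E', hE't, h1⟩ := List.mem_map.1 (conjunction_eq_some_false h)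
      obtain ⟨z, hE', hl'⟩ := hE.exists_of_test hstep.le hE't
      obtain ⟨y, rfl⟩ := pathValue_surjective z
      rw [hl] at hE' hl'
      -- The failing test approximates an actual element, and that element is the value of a path,
      -- so the body fails at a genuine witness.
      exact absurd ((ih v (Fin.snoc xs y) E' _ false hl' hE' (hX.extend y) h1).2 (hall y)) (by simp)

theorem exists_termValue_eq_some (r : ℕ) {n k : ℕ} {E : List Raw} (hE : E.length = n + k)
    (t : groupLang.Term (Fin n ⊕ Fin k)) : ∃ e, termValue r n E (termCode varCode t) = some e := by
  induction t with
  | var s =>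
    simp only [termCode, termValue_var]
    cases s with
    | inl i =>
      simp only [lookupVar, varCode, Nat.mul_mod_right, if_true,
        Nat.mul_div_cancel_left _ (Nat.succ_pos 1), i.2]
      exact ⟨_, List.getElem?_eq_getElem (by omega)⟩
    | inr j =>
      have h1 : (2 * (j : ℕ) + 1) % 2 ≠ 0 := by omega
      have h2 : (2 * (j : ℕ) + 1) / 2 = j := by omega
      simp only [lookupVar, varCode, h1, if_false, h2]
      exact ⟨_, List.getElem?_eq_getElem (by omega)⟩
  | func f ts ih =>
    cases f with
    | mul =>
      obtain ⟨e₀, h₀⟩ := ih 0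
      obtain ⟨e₁, h₁⟩ := ih 1
      rw [termCode_mul, termValue_mulCode, h₀, h₁]
      exact ⟨_, rfl⟩
    | inv =>
      obtain ⟨e₀, h₀⟩ := ih 0
      rw [termCode_inv, termValue_invCode, h₀]
      exact ⟨_, rfl⟩
    | one =>
      rw [termCode_one, termValue_oneCode]
      exact ⟨_, rfl⟩

omit hp in
theorem length_of_mem_testEnvs {N : ℕ} {E E' : List Raw} (h : E' ∈ testEnvs p N E) :
    E'.length = E.length + 1 := by
  obtain ⟨j, -, hj⟩ := List.mem_flatMap.1 h
  split_ifs at hj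
  · rw [List.mem_singleton.1 hj]
    simp [testEnv]
  · simp at hj

omit hp in
/-- The evaluator yields a truth value if the environment has an entry for every variable. -/
theorem exists_truthValue_eq_some {n k : ℕ} (φ : groupLang.BoundedFormula (Fin n) k) :
    ∀ E : List Raw, E.length = n + k → ∃ b, truthValue p n (formulaCode φ) E = some b := by
  induction φ with
  | falsum => exact fun E _ => ⟨false, by rw [formulaCode_falsum, truthValue_falsum]⟩
  | equal t s =>
    intro E hE
    obtain ⟨e, he⟩ := exists_termValue_eq_some (torsionOrder p) hE t
    obtain ⟨e', he'⟩ := exists_termValue_eq_some (torsionOrder p) hE s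
    rw [formulaCode_equal, truthValue_equal, he, he']
    exact ⟨_, rfl⟩
  | rel R => exact isEmptyElim R
  | imp φ ψ ihφ ihψ =>
    intro E hE
    obtain ⟨b₁, h₁⟩ := ihφ E hE
    obtain ⟨b₂, h₂⟩ := ihψ E hE
    rw [formulaCode_imp, truthValue_imp, h₁, h₂]
    exact ⟨_, rfl⟩
  | all φ ih =>
    intro E hE
    rw [formulaCode_all, truthValue_all]
    refine exists_conjunction_eq_some fun o ho => ?_
    obtain ⟨E', hE', rfl⟩ := List.mem_map.1 ho
    exact ih E' (by rw [length_of_mem_testEnvs hE', hE]; omega)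

end Formulas

/-! ### Checking an approximation against the oracle -/

/-- The digit number `i` of `w` to the base `B`. -/
def digit (B w i : ℕ) : ℕ := w / B ^ i % B

/-- The linear combination of the entries of a list with the digits of `w` as coefficients. -/
def digitSum (B w : ℕ) (l : List ℕ) : ℕ :=
  ((List.range l.length).map fun i => digit B w i * l.getD i 0).sum

/-- The number of the term `xᵢ ^ e`. -/
def powCode (i : ℕ) : ℕ → ℕ
  | 0 => oneCode
  | e + 1 => mulCode (powCode i e) (Nat.pair 0 (2 * i))

/-- The number of the product of the terms `xᵢ ^ (r * dᵢ)`, `i < m`, where the `dᵢ` are the digits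
of `w` to the base `B`. -/
def prodCode (r B w : ℕ) : ℕ → ℕ
  | 0 => oneCode
  | m + 1 => mulCode (prodCode r B w m) (powCode m (r * digit B w m))

/-- The `k`-th coordinates of the first `m` paths, according to the initial segment `σ` of the
oracle. -/
def oracleRow (σ : List ℕ) (m k : ℕ) : List ℕ :=
  (List.range m).map fun i => σ.getD (2 * Nat.pair i k) 0

/-- The names in `E` agree with the paths modulo `p ^ N`. -/
def CoordinatesAgree (p N : ℕ) (E : List Raw) (σ : List ℕ) : Prop :=
  ∀ i < E.length, (2 * Nat.pair i N < σ.length ∧ 2 * Nat.pair i 0 < σ.length) ∧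
    (envEntry E i).1 % torsionOrder p = σ.getD (2 * Nat.pair i 0) 0 % torsionOrder p ∧
    (envEntry E i).2.1 % p ^ N = (σ.getD (2 * Nat.pair i N) 0 + (envEntry E i).2.2) % p ^ N

/-- The linear equation with the coefficients `w` and `w'` holds for the names in `E`. -/
def RelationHolds (B : ℕ) (E : List Raw) (w w' : ℕ) : Prop :=
  digitSum B w (E.map fun a => a.2.1) + digitSum B w' (E.map fun a => a.2.2) =
    digitSum B w' (E.map fun a => a.2.1) + digitSum B w (E.map fun a => a.2.2)

/-- The equation with the coefficients `w` and `w'` has been enumerated into the positive diagram. -/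
def RelationSeen (r B m : ℕ) (σ : List ℕ) (w w' : ℕ) : Prop :=
  ∃ t < σ.length,
    σ.getD (2 * Nat.pair (Nat.pair 1 (Nat.pair (prodCode r B w m) (prodCode r B w' m))) t + 1) 0 = 1

/-- The equation with the coefficients `w` and `w'` is refuted by coordinates of the paths. -/
def RelationRefuted (p B m : ℕ) (σ : List ℕ) (w w' : ℕ) : Prop :=
  ∃ k < σ.length, (∀ i < m, 2 * Nat.pair i (k + 1) < σ.length) ∧
    digitSum B w (oracleRow σ m (k + 1)) % p ^ (k + 1) ≠
      digitSum B w' (oracleRow σ m (k + 1)) % p ^ (k + 1)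

/-- The initial segment `σ` of the oracle shows that `E` approximates the paths with
precision `N`. -/
def Verified (p N : ℕ) (E : List Raw) (σ : List ℕ) : Prop :=
  CoordinatesAgree p N E σ ∧
    ∀ w < (N + 1) ^ E.length, ∀ w' < (N + 1) ^ E.length,
      (RelationHolds (N + 1) E w w' ∧ RelationSeen (torsionOrder p) (N + 1) E.length σ w w') ∨
      (¬ RelationHolds (N + 1) E w w' ∧ RelationRefuted p (N + 1) E.length σ w w')

section Primrec

variable {α : Type*} [Primcodable α]

theorem primrec_digit {B w i : α → ℕ} (hB : Primrec B) (hw : Primrec w) (hi : Primrec i) :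
    Primrec fun a => digit (B a) (w a) (i a) :=
  Primrec.nat_mod.comp (Primrec.nat_div.comp hw (primrec_nat_pow.comp hB hi)) hB

theorem primrec_listSum : Primrec fun l : List ℕ => l.sum :=
  (Primrec.list_foldr (h := fun _ x => x.1 + x.2) (Primrec.id (α := List ℕ)) (Primrec.const 0)
    (Primrec.nat_add.comp (Primrec.fst.comp Primrec.snd) (Primrec.snd.comp Primrec.snd))).of_eq
    fun _ => List.sum_eq_foldr.symm

theorem primrec_digitSum {B w : α → ℕ} {l : α → List ℕ} (hB : Primrec B) (hw : Primrec w)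
    (hl : Primrec l) : Primrec fun a => digitSum (B a) (w a) (l a) :=
  primrec_listSum.comp (Primrec.list_map (Primrec.list_range.comp (Primrec.list_length.comp hl))
    (Primrec.nat_mul.comp (primrec_digit (hB.comp Primrec.fst) (hw.comp Primrec.fst) Primrec.snd)
      ((Primrec.list_getD 0).comp (hl.comp Primrec.fst) Primrec.snd)))

theorem primrec_mulCode : Primrec₂ mulCode :=
  Primrec₂.natPair.comp (Primrec.const 1) (Primrec₂.natPair.comp (Primrec.const 0)
    (Primrec.succ.comp (Primrec₂.natPair.comp Primrec.fst
      (Primrec.succ.comp (Primrec₂.natPair.comp Primrec.snd (Primrec.const 0))))))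

theorem primrec_powCode : Primrec₂ powCode := by
  refine (Primrec.nat_rec (f := fun _ : ℕ => oneCode)
    (g := fun i x => mulCode x.2 (Nat.pair 0 (2 * i))) (Primrec.const _) ?_).of_eq fun i e => ?_
  · exact primrec_mulCode.comp (Primrec.snd.comp Primrec.snd) (Primrec₂.natPair.comp
      (Primrec.const 0) (Primrec.nat_mul.comp (Primrec.const 2) Primrec.fst))
  · induction e with
    | zero => rfl
    | succ e ih => simp only [powCode, ← ih]

theorem primrec_prodCode (r : ℕ) {B w m : α → ℕ} (hB : Primrec B) (hw : Primrec w)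
    (hm : Primrec m) : Primrec fun a => prodCode r (B a) (w a) (m a) := by
  refine (Primrec.nat_rec' (g := fun _ : α => oneCode)
    (h := fun a x => mulCode x.2 (powCode x.1 (r * digit (B a) (w a) x.1))) hm (Primrec.const _)
    ?_).of_eq fun a => ?_
  · have h1 : Primrec fun x : α × ℕ × ℕ => x.2.1 := Primrec.fst.comp Primrec.snd
    exact primrec_mulCode.comp (Primrec.snd.comp Primrec.snd) (primrec_powCode.comp h1
      (Primrec.nat_mul.comp (Primrec.const r)
        (primrec_digit (hB.comp Primrec.fst) (hw.comp Primrec.fst) h1)))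
  · induction m a with
    | zero => rfl
    | succ e ih => simp only [prodCode, ← ih]

theorem primrec_oracleIndex {i k : α → ℕ} (hi : Primrec i) (hk : Primrec k) :
    Primrec fun a => 2 * Nat.pair (i a) (k a) :=
  Primrec.nat_mul.comp (Primrec.const 2) (Primrec₂.natPair.comp hi hk)

theorem primrec_oracleRow {σ : α → List ℕ} {m k : α → ℕ} (hσ : Primrec σ) (hm : Primrec m)
    (hk : Primrec k) : Primrec fun a => oracleRow (σ a) (m a) (k a) :=
  Primrec.list_map (Primrec.list_range.comp hm) ((Primrec.list_getD 0).comp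
    (hσ.comp Primrec.fst) (primrec_oracleIndex Primrec.snd (hk.comp Primrec.fst)))

theorem primrec_envEntry {E : α → List Raw} {i : α → ℕ} (hE : Primrec E) (hi : Primrec i) :
    Primrec fun a => envEntry (E a) (i a) :=
  (Primrec.list_getD Raw.one).comp hE hi

theorem primrecPred_coordinatesAgree (p : ℕ) {N : α → ℕ} {E : α → List Raw} {σ : α → List ℕ}
    (hN : Primrec N) (hE : Primrec E) (hσ : Primrec σ) :
    PrimrecPred fun a => CoordinatesAgree p (N a) (E a) (σ a) := by
  refine primrecPred_forall_lt (Primrec.list_length.comp hE) ?_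
  have hN' : Primrec fun x : α × ℕ => N x.1 := hN.comp Primrec.fst
  have hσ' : Primrec fun x : α × ℕ => σ x.1 := hσ.comp Primrec.fst
  have hl : Primrec fun x : α × ℕ => (σ x.1).length := Primrec.list_length.comp hσ'
  have h0 : Primrec fun x : α × ℕ => 2 * Nat.pair x.2 0 :=
    primrec_oracleIndex Primrec.snd (Primrec.const 0)
  have h1 : Primrec fun x : α × ℕ => 2 * Nat.pair x.2 (N x.1) :=
    primrec_oracleIndex Primrec.snd hN'
  have hE' : Primrec fun x : α × ℕ => envEntry (E x.1) x.2 :=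
    primrec_envEntry (hE.comp Primrec.fst) Primrec.snd
  have hp : Primrec fun x : α × ℕ => p ^ N x.1 := primrec_nat_pow.comp (Primrec.const p) hN'
  exact ((Primrec.nat_lt.comp h1 hl).and (Primrec.nat_lt.comp h0 hl)).and
    ((Primrec.eq.comp (Primrec.nat_mod.comp (Primrec.fst.comp hE') (Primrec.const _))
      (Primrec.nat_mod.comp ((Primrec.list_getD 0).comp hσ' h0) (Primrec.const _))).and
    (Primrec.eq.comp (Primrec.nat_mod.comp (Primrec.fst.comp (Primrec.snd.comp hE')) hp)
      (Primrec.nat_mod.comp (Primrec.nat_add.comp ((Primrec.list_getD 0).comp hσ' h1)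
        (Primrec.snd.comp (Primrec.snd.comp hE'))) hp)))

theorem primrecPred_relationHolds {B w w' : α → ℕ} {E : α → List Raw} (hB : Primrec B)
    (hE : Primrec E) (hw : Primrec w) (hw' : Primrec w') :
    PrimrecPred fun a => RelationHolds (B a) (E a) (w a) (w' a) := by
  have hu : Primrec fun a => (E a).map fun e => e.2.1 :=
    Primrec.list_map hE (Primrec.fst.comp (Primrec.snd.comp Primrec.snd))
  have hv : Primrec fun a => (E a).map fun e => e.2.2 :=
    Primrec.list_map hE (Primrec.snd.comp (Primrec.snd.comp Primrec.snd))
  exact Primrec.eq.comp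
    (Primrec.nat_add.comp (primrec_digitSum hB hw hu) (primrec_digitSum hB hw' hv))
    (Primrec.nat_add.comp (primrec_digitSum hB hw' hu) (primrec_digitSum hB hw hv))

theorem primrecPred_relationSeen (r : ℕ) {B m w w' : α → ℕ} {σ : α → List ℕ} (hB : Primrec B)
    (hm : Primrec m) (hσ : Primrec σ) (hw : Primrec w) (hw' : Primrec w') :
    PrimrecPred fun a => RelationSeen r (B a) (m a) (σ a) (w a) (w' a) := by
  refine primrecPred_exists_lt (Primrec.list_length.comp hσ) ?_
  have h : Primrec fun a => Nat.pair 1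
      (Nat.pair (prodCode r (B a) (w a) (m a)) (prodCode r (B a) (w' a) (m a))) :=
    Primrec₂.natPair.comp (Primrec.const 1) (Primrec₂.natPair.comp (primrec_prodCode r hB hw hm)
      (primrec_prodCode r hB hw' hm))
  exact Primrec.eq.comp ((Primrec.list_getD 0).comp (hσ.comp Primrec.fst)
    (Primrec.succ.comp (primrec_oracleIndex (h.comp Primrec.fst) Primrec.snd))) (Primrec.const 1)

theorem primrecPred_relationRefuted (p : ℕ) {B m w w' : α → ℕ} {σ : α → List ℕ} (hB : Primrec B)
    (hm : Primrec m) (hσ : Primrec σ) (hw : Primrec w) (hw' : Primrec w') :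
    PrimrecPred fun a => RelationRefuted p (B a) (m a) (σ a) (w a) (w' a) := by
  refine primrecPred_exists_lt (Primrec.list_length.comp hσ) ?_
  have hk : Primrec fun x : α × ℕ => x.2 + 1 := Primrec.succ.comp Primrec.snd
  have hp : Primrec fun x : α × ℕ => p ^ (x.2 + 1) := primrec_nat_pow.comp (Primrec.const p) hk
  have hrow : Primrec fun x : α × ℕ => oracleRow (σ x.1) (m x.1) (x.2 + 1) :=
    primrec_oracleRow (hσ.comp Primrec.fst) (hm.comp Primrec.fst) hk
  refine PrimrecPred.and (primrecPred_forall_lt (hm.comp Primrec.fst) ?_) (PrimrecPred.not ?_)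
  · exact Primrec.nat_lt.comp (primrec_oracleIndex Primrec.snd (hk.comp Primrec.fst))
      (Primrec.list_length.comp (hσ.comp (Primrec.fst.comp Primrec.fst)))
  · exact Primrec.eq.comp (Primrec.nat_mod.comp
      (primrec_digitSum (hB.comp Primrec.fst) (hw.comp Primrec.fst) hrow) hp)
      (Primrec.nat_mod.comp
        (primrec_digitSum (hB.comp Primrec.fst) (hw'.comp Primrec.fst) hrow) hp)

theorem primrecPred_verified (p : ℕ) {N : α → ℕ} {E : α → List Raw} {σ : α → List ℕ}
    (hN : Primrec N) (hE : Primrec E) (hσ : Primrec σ) :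
    PrimrecPred fun a => Verified p (N a) (E a) (σ a) := by
  refine (primrecPred_coordinatesAgree p hN hE hσ).and ?_
  have hW : Primrec fun a => (N a + 1) ^ (E a).length :=
    primrec_nat_pow.comp (Primrec.succ.comp hN) (Primrec.list_length.comp hE)
  refine primrecPred_forall_lt hW (primrecPred_forall_lt (hW.comp Primrec.fst) ?_)
  have h1 : Primrec fun x : (α × ℕ) × ℕ => x.1.1 := Primrec.fst.comp Primrec.fst
  have hB : Primrec fun x : (α × ℕ) × ℕ => N x.1.1 + 1 := Primrec.succ.comp (hN.comp h1)
  have hE' := hE.comp h1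
  have hσ' := hσ.comp h1
  have hm : Primrec fun x : (α × ℕ) × ℕ => (E x.1.1).length := Primrec.list_length.comp hE'
  have hw : Primrec fun x : (α × ℕ) × ℕ => x.1.2 := Primrec.snd.comp Primrec.fst
  have hw' : Primrec fun x : (α × ℕ) × ℕ => x.2 := Primrec.snd
  have hh := primrecPred_relationHolds hB hE' hw hw'
  exact (hh.and (primrecPred_relationSeen _ hB hm hσ' hw hw')).or
    (hh.not.and (primrecPred_relationRefuted p hB hm hσ' hw hw'))

end Primrec

section Verification

open Finset FirstOrder.Language

variable {p : ℕ} [hp : Fact p.Prime]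

/-! ### Soundness and completeness of the check -/

theorem digit_lt {B : ℕ} (hB : 0 < B) (w i : ℕ) : digit B w i < B := Nat.mod_lt _ hB

/-- A vector of small coefficients becomes a single number below `B ^ m`, so quantifying over all
vectors is a bounded quantifier. -/
theorem exists_digits {B : ℕ} (hB : 0 < B) {d : ℕ → ℕ} (hd : ∀ i, d i < B) (m : ℕ) :
    ∃ w < B ^ m, ∀ i < m, digit B w i = d i := by
  induction m with
  | zero => exact ⟨0, by simp, fun i hi => absurd hi (Nat.not_lt_zero i)⟩
  | succ m ih =>
    obtain ⟨w, hw, h⟩ := ih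
    refine ⟨w + B ^ m * d m, ?_, fun i hi => ?_⟩
    · rw [pow_succ]
      have h1 := Nat.mul_le_mul_left (B ^ m) (Nat.succ_le_of_lt (hd m))
      rw [Nat.mul_succ] at h1
      omega
    · rcases Nat.lt_succ_iff_lt_or_eq.1 hi with hi | rfl
      · rw [← h i hi, digit, digit]
        obtain ⟨k, rfl⟩ := Nat.exists_eq_add_of_lt hi
        rw [show B ^ (i + k + 1) * d (i + k + 1) = B ^ i * (B * (B ^ k * d (i + k + 1))) by ring,
          Nat.add_mul_div_left _ _ (pow_pos hB i), Nat.add_mul_mod_self_left]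
      · rw [digit, Nat.add_mul_div_left _ _ (pow_pos hB i), Nat.div_eq_of_lt hw, zero_add,
          Nat.mod_eq_of_lt (hd i)]

theorem digitSum_eq_sum (B w : ℕ) (l : List ℕ) :
    digitSum B w l = ∑ i ∈ range l.length, digit B w i * l.getD i 0 := by
  have h : ∀ (f : ℕ → ℕ) n, ((List.range n).map f).sum = ∑ i ∈ range n, f i := fun f n => by
    induction n with
    | zero => rfl
    | succ n ih => simp [List.range_succ, sum_range_succ, ih]
  exact h _ _

theorem relationHolds_iff (B : ℕ) (E : List Raw) (w w' : ℕ) : RelationHolds B E w w' ↔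
    ∑ i ∈ range E.length, ((digit B w i : ℤ) - digit B w' i) * (envEntry E i).toInt = 0 := by
  have e1 : ∀ w, (digitSum B w (E.map fun a => a.2.1) : ℤ) =
      ∑ i ∈ range E.length, (digit B w i : ℤ) * (envEntry E i).2.1 := fun w => by
    rw [digitSum_eq_sum, List.length_map]
    push_cast
    refine sum_congr rfl fun i hi => ?_
    rw [mem_range] at hi
    simp [envEntry, List.getD_eq_getElem?_getD, hi]
  have e2 : ∀ w, (digitSum B w (E.map fun a => a.2.2) : ℤ) =
      ∑ i ∈ range E.length, (digit B w i : ℤ) * (envEntry E i).2.2 := fun w => by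
    rw [digitSum_eq_sum, List.length_map]
    push_cast
    refine sum_congr rfl fun i hi => ?_
    rw [mem_range] at hi
    simp [envEntry, List.getD_eq_getElem?_getD, hi]
  rw [RelationHolds, ← Int.natCast_inj, Nat.cast_add, Nat.cast_add, e1, e1, e2, e2, ← sub_eq_zero,
    ← sum_add_distrib, ← sum_add_distrib, ← sum_sub_distrib]
  refine Iff.of_eq (congrArg (· = 0) (sum_congr rfl fun i _ => ?_))
  rw [Raw.toInt]
  ring

section Codes

variable {n : ℕ} {v : Fin n → (timesPresentation p).Path}

/-- A finite tuple of paths, extended by the identity. -/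
noncomputable def extendTuple (v : Fin n → (timesPresentation p).Path) (i : ℕ) :
    paths (timesTree p) :=
  if h : i < n then v ⟨i, h⟩ else timesOne

theorem extendTuple_val (v : Fin n → (timesPresentation p).Path) (i : Fin n) :
    extendTuple v i = v i := dif_pos i.2

theorem joinTuple_pair (v : Fin n → (timesPresentation p).Path) (i k : ℕ) :
    joinTuple (fun i => (v i).1) (Nat.pair i k) = (extendTuple v i).1 k := by
  by_cases h : i < n <;> simp [joinTuple, extendTuple, h, timesOne]

/-- The element of `(ℤ/rℤ) × ℤ_p` that is the value of a term. -/
noncomputable def termPathValue {α : Type} (x : α → (timesPresentation p).Path)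
    (t : groupLang.Term α) : ZMod (torsionOrder p) × ℤ_[p] :=
  pathValue (t.realize (M := (timesPresentation p).Path) x)

/-- Membership in the diagram only provides some formula with the given code. Peeling the code apart
recovers the value of its terms, so that injectivity of the whole numbering is not needed. -/
theorem exists_of_termCode_eq_mulCode {α : Type} {u : α → ℕ} {t : groupLang.Term α} {c d : ℕ}
    (h : termCode u t = mulCode c d) : ∃ t₀ t₁ : groupLang.Term α, termCode u t₀ = c ∧
      termCode u t₁ = d ∧ ∀ x : α → (timesPresentation p).Path,
        termPathValue x t = termPathValue x t₀ + termPathValue x t₁ := by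
  cases t with
  | var a => simp [termCode, mulCode] at h
  | func f ts =>
    cases f with
    | mul =>
      rw [termCode_mul] at h
      simp only [mulCode, Nat.pair_eq_pair, Nat.add_right_cancel_iff, true_and, and_true] at h
      exact ⟨ts 0, ts 1, h.1, h.2, fun x => pathValue_timesMul _ _⟩
    | inv =>
      rw [termCode_inv] at h
      simp [mulCode, invCode] at h
    | one =>
      rw [termCode_one] at h
      simp [mulCode, oneCode] at h

theorem termPathValue_of_termCode_eq_oneCode {α : Type} {u : α → ℕ} {t : groupLang.Term α}
    (h : termCode u t = oneCode) (x : α → (timesPresentation p).Path) :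
    termPathValue x t = 0 := by
  cases t with
  | var a => simp [termCode, oneCode] at h
  | func f ts =>
    cases f with
    | mul =>
      rw [termCode_mul] at h
      simp [mulCode, oneCode] at h
    | inv =>
      rw [termCode_inv] at h
      simp [oneCode, invCode] at h
    | one => exact pathValue_timesOne

theorem termPathValue_of_termCode_eq_var {t : groupLang.Term (Fin n ⊕ Fin 0)} {i : ℕ}
    (h : termCode varCode t = Nat.pair 0 (2 * i)) (xs : Fin 0 → (timesPresentation p).Path) :
    termPathValue (Sum.elim v xs) t = pathValue (extendTuple v i) := by
  cases t with
  | var s =>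
    cases s with
    | inl j =>
      simp [termCode, varCode] at h
      subst h
      exact congrArg pathValue (extendTuple_val v j).symm
    | inr j => exact j.elim0
  | func f ts => simp [termCode] at h

theorem termPathValue_of_termCode_eq_powCode {i e : ℕ} (xs : Fin 0 → (timesPresentation p).Path) :
    ∀ {t : groupLang.Term (Fin n ⊕ Fin 0)}, termCode varCode t = powCode i e →
      termPathValue (Sum.elim v xs) t = (e : ℤ) • pathValue (extendTuple v i) := by
  induction e with
  | zero =>
    intro t h
    rw [termPathValue_of_termCode_eq_oneCode h]
    simp
  | succ e ih =>
    intro t h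
    obtain ⟨t₀, t₁, h₀, h₁, h⟩ := exists_of_termCode_eq_mulCode (p := p) h
    rw [h, ih h₀, termPathValue_of_termCode_eq_var h₁ xs]
    push_cast
    rw [add_smul, one_smul]

theorem termPathValue_of_termCode_eq_prodCode {r B w m : ℕ}
    (xs : Fin 0 → (timesPresentation p).Path) :
    ∀ {t : groupLang.Term (Fin n ⊕ Fin 0)}, termCode varCode t = prodCode r B w m →
      termPathValue (Sum.elim v xs) t =
        ∑ i ∈ range m, (r * digit B w i : ℤ) • pathValue (extendTuple v i) := by
  induction m with
  | zero =>
    intro t h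
    rw [termPathValue_of_termCode_eq_oneCode h]
    simp
  | succ m ih =>
    intro t h
    obtain ⟨t₀, t₁, h₀, h₁, h⟩ := exists_of_termCode_eq_mulCode (p := p) h
    rw [h, ih h₀, termPathValue_of_termCode_eq_powCode xs h₁, sum_range_succ]
    push_cast
    rfl

theorem exists_termCode_eq_powCode (i : Fin n) (e : ℕ) :
    ∃ t : groupLang.Term (Fin n ⊕ Fin 0), termCode varCode t = powCode i e := by
  induction e with
  | zero =>
    exact ⟨Term.func (L := groupLang) GroupFunc.one Fin.elim0, termCode_one _ _⟩
  | succ e ih =>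
    obtain ⟨t, ht⟩ := ih
    refine ⟨Term.func (L := groupLang) GroupFunc.mul ![t, Term.var (.inl i)], ?_⟩
    rw [termCode_mul]
    simp [powCode, ht, termCode, varCode]

theorem exists_termCode_eq_prodCode (r B w : ℕ) {m : ℕ} (hm : m ≤ n) :
    ∃ t : groupLang.Term (Fin n ⊕ Fin 0), termCode varCode t = prodCode r B w m := by
  induction m with
  | zero =>
    exact ⟨Term.func (L := groupLang) GroupFunc.one Fin.elim0, termCode_one _ _⟩
  | succ m ih =>
    obtain ⟨t, ht⟩ := ih (by omega)
    obtain ⟨s, hs⟩ := exists_termCode_eq_powCode (n := n) ⟨m, hm⟩ (r * digit B w m)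
    refine ⟨Term.func (L := groupLang) GroupFunc.mul ![t, s], ?_⟩
    rw [termCode_mul]
    simp [prodCode, ht, hs]

/-- The number of the equation `∏ xᵢ ^ (r * dᵢ) = ∏ xᵢ ^ (r * d'ᵢ)` is in the positive atomic
diagram only if the equation is true. -/
theorem sum_eq_sum_of_mem_diagram {r B w w' m : ℕ}
    (h : Nat.pair 1 (Nat.pair (prodCode r B w m) (prodCode r B w' m)) ∈
      (timesPresentation p).positiveAtomicDiagram v) :
    ∑ i ∈ range m, (r * digit B w i : ℤ) • pathValue (extendTuple v i) =
      ∑ i ∈ range m, (r * digit B w' i : ℤ) • pathValue (extendTuple v i) := by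
  obtain ⟨α, hα, hr, hc⟩ := h
  cases hα with
  | equal t s =>
    have hc' := (formulaCode_equal t s).symm.trans hc
    simp only [Nat.pair_eq_pair, true_and] at hc'
    rw [← termPathValue_of_termCode_eq_prodCode default hc'.1,
      ← termPathValue_of_termCode_eq_prodCode default hc'.2]
    have h : t.realize (M := (timesPresentation p).Path) (Sum.elim v default) =
        s.realize (M := (timesPresentation p).Path) (Sum.elim v default) :=
      (BoundedFormula.realize_bdEqual t s).1 hr
    exact congrArg (pathValue (p := p)) h
  | rel R ts => exact isEmptyElim R

/-- The product runs over exactly the `n` available variables, so its code is the code of a genuine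
term; in the opposite direction the number of factors may be arbitrary. -/
theorem mem_diagram_of_sum_eq_sum {r B w w' : ℕ}
    (h : ∑ i ∈ range n, (r * digit B w i : ℤ) • pathValue (extendTuple v i) =
      ∑ i ∈ range n, (r * digit B w' i : ℤ) • pathValue (extendTuple v i)) :
    Nat.pair 1 (Nat.pair (prodCode r B w n) (prodCode r B w' n)) ∈
      (timesPresentation p).positiveAtomicDiagram v := by
  obtain ⟨t, ht⟩ := exists_termCode_eq_prodCode (n := n) r B w le_rfl
  obtain ⟨s, hs⟩ := exists_termCode_eq_prodCode (n := n) r B w' le_rfl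
  refine ⟨t.bdEqual s, .equal t s, (BoundedFormula.realize_bdEqual t s).2 ?_, ?_⟩
  · refine pathValue_injective ?_
    rw [← termPathValue_of_termCode_eq_prodCode default ht,
      ← termPathValue_of_termCode_eq_prodCode default hs] at h
    exact h
  · rw [← ht, ← hs]
    exact formulaCode_equal t s

end Codes

end Verification

/-! ### Verification against the joined oracle -/

section OracleCheck

open Finset FirstOrder.Language

variable {p : ℕ} [hp : Fact p.Prime]

theorem join_two_mul (f g : ℕ → ℕ) (m : ℕ) : join f g (2 * m) = f m := by
  simp [join]

theorem join_two_mul_add_one (f g : ℕ → ℕ) (m : ℕ) : join f g (2 * m + 1) = g m := by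
  have h1 : (2 * m + 1) % 2 ≠ 0 := by omega
  have h2 : (2 * m + 1) / 2 = m := by omega
  rw [join, if_neg h1, h2]

theorem getD_map_range (g : ℕ → ℕ) {s m : ℕ} (h : m < s) :
    ((List.range s).map g).getD m 0 = g m := by
  simp [List.getD_eq_getElem?_getD, h]

/-- Multiples of the torsion order annihilate the finite factor, and that order is a nonzero, hence
cancellable, element of `ℤ_p`. So the equations in the diagram speak about the `ℤ_p`-parts alone. -/
theorem torsionOrder_combination_eq_iff (m : ℕ) (d d' : ℕ → ℕ)
    (X : ℕ → ZMod (torsionOrder p) × ℤ_[p]) :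
    ∑ i ∈ range m, (torsionOrder p * d i : ℤ) • X i =
        ∑ i ∈ range m, (torsionOrder p * d' i : ℤ) • X i ↔
      ∑ i ∈ range m, (((d i : ℤ) - d' i : ℤ) : ℤ_[p]) * (X i).2 = 0 := by
  have h1 : (torsionOrder p : ℤ_[p]) ≠ 0 := Nat.cast_ne_zero.2 (torsionOrder_pos p).ne'
  have h2 : ∀ f : ℕ → ℕ, (∑ i ∈ range m, (torsionOrder p * f i : ℤ) • X i).1 = 0 := fun f => by
    rw [Prod.fst_sum]
    exact sum_eq_zero fun i _ => by simp
  have h3 : ∀ f : ℕ → ℕ, (∑ i ∈ range m, (torsionOrder p * f i : ℤ) • X i).2 =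
      torsionOrder p * ∑ i ∈ range m, (f i : ℤ_[p]) * (X i).2 := fun f => by
    rw [Prod.snd_sum, mul_sum]
    refine sum_congr rfl fun i _ => ?_
    rw [Prod.smul_snd, zsmul_eq_mul]
    push_cast
    ring
  rw [Prod.ext_iff, h2, h2, h3, h3, mul_right_inj' h1, ← sub_eq_zero (a := ∑ i ∈ range m, _),
    ← sum_sub_distrib]
  simp only [true_and]
  refine Iff.of_eq (congrArg (· = 0) (sum_congr rfl fun i _ => ?_))
  push_cast
  ring

variable {n : ℕ} {v : Fin n → (timesPresentation p).Path} {D : Set ℕ}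

/-- The values of the paths `v`, extended by the identity. -/
noncomputable def tupleValue (v : Fin n → (timesPresentation p).Path) (i : ℕ) :
    ZMod (torsionOrder p) × ℤ_[p] := pathValue (extendTuple v i)

/-- The oracle that consists of the paths `v` and the set `D`. -/
noncomputable def tupleOracle (v : Fin n → (timesPresentation p).Path) (D : Set ℕ) : ℕ → ℕ :=
  join (joinTuple fun i => (v i).1) (charFun D)

theorem tupleOracle_pair (i k : ℕ) : tupleOracle v D (2 * Nat.pair i k) = (extendTuple v i).1 k := by
  rw [tupleOracle, join_two_mul, joinTuple_pair]

theorem tupleOracle_odd_eq_one_iff (m : ℕ) : tupleOracle v D (2 * m + 1) = 1 ↔ m ∈ D := by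
  rw [tupleOracle, join_two_mul_add_one, charFun]
  split_ifs with h <;> simp [h]

theorem toZModPow_tupleValue (i k : ℕ) :
    PadicInt.toZModPow (k + 1) (tupleValue v i).2 =
      ((extendTuple v i).1 (k + 1) : ZMod (p ^ (k + 1))) :=
  toZModPow_pathValue _ _

/-- Coordinate 0 of a path is the torsion part; only from level 1 on does a coordinate give a
residue in `ℤ_p`, whence `0 < N`. -/
theorem pow_dvd_sub_intCast_iff {N : ℕ} (hN : 0 < N) (i : ℕ) (a : Raw) :
    (p : ℤ_[p]) ^ N ∣ (tupleValue v i).2 - (a.toInt : ℤ_[p]) ↔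
      a.2.1 % p ^ N = ((extendTuple v i).1 N + a.2.2) % p ^ N := by
  obtain ⟨k, rfl⟩ := Nat.exists_eq_add_of_lt hN
  rw [zero_add, ← Ideal.mem_span_singleton, ← PadicInt.ker_toZModPow, RingHom.mem_ker, map_sub,
    toZModPow_tupleValue, map_intCast, Raw.toInt, ← ZMod.natCast_eq_natCast_iff']
  push_cast
  constructor <;> intro h
  · linear_combination -h
  · linear_combination -h

theorem coordinatesAgree_iff {N : ℕ} (hN : 0 < N) (E : List Raw) (s : ℕ) :
    CoordinatesAgree p N E ((List.range s).map (tupleOracle v D)) ↔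
      ∀ i < E.length, (2 * Nat.pair i N < s ∧ 2 * Nat.pair i 0 < s) ∧
        (tupleValue v i).1 = (rawValue p (envEntry E i)).1 ∧
        (p : ℤ_[p]) ^ N ∣ (tupleValue v i).2 - ((envEntry E i).toInt : ℤ_[p]) := by
  refine forall₂_congr fun i _ => ?_
  rw [List.length_map, List.length_range]
  refine and_congr_right fun h => ?_
  rw [getD_map_range _ h.1, getD_map_range _ h.2, tupleOracle_pair, tupleOracle_pair,
    pow_dvd_sub_intCast_iff hN]
  refine and_congr_left fun _ => ?_
  rw [eq_comm, ← ZMod.natCast_eq_natCast_iff']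
  rfl

theorem toZModPow_sum_digit (B w m s k : ℕ) (h : ∀ i < m, 2 * Nat.pair i (k + 1) < s) :
    PadicInt.toZModPow (k + 1) (∑ i ∈ range m, (digit B w i : ℤ_[p]) * (tupleValue v i).2) =
      (digitSum B w (oracleRow ((List.range s).map (tupleOracle v D)) m (k + 1)) :
        ZMod (p ^ (k + 1))) := by
  rw [digitSum_eq_sum, map_sum, Nat.cast_sum, oracleRow, List.length_map, List.length_range]
  refine sum_congr rfl fun i hi => ?_
  rw [mem_range] at hi
  rw [map_mul, map_natCast, toZModPow_tupleValue, getD_map_range _ hi, getD_map_range _ (h i hi),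
    tupleOracle_pair, Nat.cast_mul]

theorem relationRefuted_iff (B m s w w' : ℕ) :
    RelationRefuted p B m ((List.range s).map (tupleOracle v D)) w w' ↔
      ∃ k < s, (∀ i < m, 2 * Nat.pair i (k + 1) < s) ∧
        PadicInt.toZModPow (k + 1) (∑ i ∈ range m, (digit B w i : ℤ_[p]) * (tupleValue v i).2) ≠
        PadicInt.toZModPow (k + 1)
          (∑ i ∈ range m, (digit B w' i : ℤ_[p]) * (tupleValue v i).2) := by
  rw [RelationRefuted, List.length_map, List.length_range]
  refine exists_congr fun k => and_congr_right fun _ => and_congr_right fun h => ?_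
  rw [toZModPow_sum_digit (D := D) B w m s k h, toZModPow_sum_digit (D := D) B w' m s k h, Ne, Ne,
    ZMod.natCast_eq_natCast_iff']

theorem sum_digit_sub_eq_zero_iff (B w w' m : ℕ) (X : ℕ → ℤ_[p]) :
    ∑ i ∈ range m, (((digit B w i : ℤ) - digit B w' i : ℤ) : ℤ_[p]) * X i = 0 ↔
      ∑ i ∈ range m, (digit B w i : ℤ_[p]) * X i = ∑ i ∈ range m, (digit B w' i : ℤ_[p]) * X i := by
  rw [← sub_eq_zero (b := ∑ i ∈ range m, (digit B w' i : ℤ_[p]) * X i), ← sum_sub_distrib]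
  refine Iff.of_eq (congrArg (· = 0) (sum_congr rfl fun i _ => ?_))
  push_cast
  ring

/-- A relation that has been enumerated is true. -/
theorem sum_eq_zero_of_relationSeen
    (hD : IsEnumeration D ((timesPresentation p).positiveAtomicDiagram v)) {B m s w w' : ℕ}
    (h : RelationSeen (torsionOrder p) B m ((List.range s).map (tupleOracle v D)) w w') :
    ∑ i ∈ range m, (((digit B w i : ℤ) - digit B w' i : ℤ) : ℤ_[p]) * (tupleValue v i).2 = 0 := by
  obtain ⟨t, -, h⟩ := h
  set c := 2 * Nat.pair (Nat.pair 1 (Nat.pair (prodCode (torsionOrder p) B w m)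
    (prodCode (torsionOrder p) B w' m))) t + 1
  by_cases hs : c < s
  · rw [getD_map_range _ hs, tupleOracle_odd_eq_one_iff] at h
    refine (torsionOrder_combination_eq_iff m (digit B w) (digit B w') (tupleValue v)).1
      (sum_eq_sum_of_mem_diagram ?_)
    rw [hD]
    exact ⟨t, h⟩
  -- A position beyond the prefix reads as the default 0, so it cannot pass for an enumerated
  -- equation.
  · rw [List.getD_eq_default _ _ (by simpa using hs)] at h
    exact absurd h zero_ne_one

theorem sum_ne_zero_of_relationRefuted {B m s w w' : ℕ}
    (h : RelationRefuted p B m ((List.range s).map (tupleOracle v D)) w w') :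
    ∑ i ∈ range m, (((digit B w i : ℤ) - digit B w' i : ℤ) : ℤ_[p]) * (tupleValue v i).2 ≠ 0 := by
  obtain ⟨k, -, -, h⟩ := (relationRefuted_iff _ _ _ _ _).1 h
  rw [Ne, sum_digit_sub_eq_zero_iff]
  exact fun e => h (congrArg _ e)

theorem relationHolds_iff_sum_padicInt (B : ℕ) (E : List Raw) (w w' : ℕ) :
    RelationHolds B E w w' ↔ ∑ i ∈ range E.length,
      (((digit B w i : ℤ) - digit B w' i : ℤ) : ℤ_[p]) * ((envEntry E i).toInt : ℤ_[p]) = 0 := by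
  rw [relationHolds_iff, ← Int.cast_inj (α := ℤ_[p])]
  push_cast
  rfl

/-- Soundness needs no assumption on the length of `E`: missing paths count as the identity, and
both kinds of evidence are reliable for any length. -/
theorem Verified.approximates
    (hD : IsEnumeration D ((timesPresentation p).positiveAtomicDiagram v)) {N s : ℕ} (hN : 0 < N)
    {E : List Raw} (h : Verified p N E ((List.range s).map (tupleOracle v D))) :
    Approximates N (tupleValue v) E := by
  obtain ⟨h1, h2⟩ := h
  rw [coordinatesAgree_iff hN] at h1
  refine ⟨fun i hi => (h1 i hi).2.1, fun i hi => (h1 i hi).2.2, fun a ha => ?_⟩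
  -- Signed coefficients are split into positive and negative parts, each of which fits into a digit
  -- to the base `N + 1`.
  obtain ⟨w, hw, hwa⟩ := exists_digits N.succ_pos (d := fun i => (a i).toNat)
    (fun i => by have := abs_le.1 (ha i); omega) E.length
  obtain ⟨w', hw', hwa'⟩ := exists_digits N.succ_pos (d := fun i => (-a i).toNat)
    (fun i => by have := abs_le.1 (ha i); omega) E.length
  have key : ∀ y : ℕ → ℤ_[p], ∑ i ∈ range E.length, (a i : ℤ_[p]) * y i = ∑ i ∈ range E.length,
      (((digit (N + 1) w i : ℤ) - digit (N + 1) w' i : ℤ) : ℤ_[p]) * y i := fun y => by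
    refine sum_congr rfl fun i hi => ?_
    rw [mem_range] at hi
    rw [hwa i hi, hwa' i hi, Int.toNat_sub_toNat_neg]
  rw [key, key, ← relationHolds_iff_sum_padicInt]
  rcases h2 w hw w' hw' with ⟨h3, h4⟩ | ⟨h3, h4⟩
  · exact iff_of_true (sum_eq_zero_of_relationSeen hD h4) h3
  · exact iff_of_false (sum_ne_zero_of_relationRefuted h4) h3

theorem eventually_relationSeen
    (hD : IsEnumeration D ((timesPresentation p).positiveAtomicDiagram v)) {B w w' : ℕ}
    (h : ∑ i ∈ range n, (((digit B w i : ℤ) - digit B w' i : ℤ) : ℤ_[p]) * (tupleValue v i).2 = 0) :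
    ∀ᶠ s in Filter.atTop,
      RelationSeen (torsionOrder p) B n ((List.range s).map (tupleOracle v D)) w w' := by
  have h1 := mem_diagram_of_sum_eq_sum
    ((torsionOrder_combination_eq_iff n (digit B w) (digit B w') (tupleValue v)).2 h)
  rw [hD] at h1
  obtain ⟨t, ht⟩ := h1
  filter_upwards [Filter.eventually_gt_atTop t, Filter.eventually_gt_atTop
    (2 * Nat.pair (Nat.pair 1 (Nat.pair (prodCode (torsionOrder p) B w n)
      (prodCode (torsionOrder p) B w' n))) t + 1)] with s hs hs'
  refine ⟨t, by simpa using hs, ?_⟩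
  rw [getD_map_range _ hs', tupleOracle_odd_eq_one_iff]
  exact ht

theorem eventually_relationRefuted {B m w w' : ℕ}
    (h : ∑ i ∈ range m, (((digit B w i : ℤ) - digit B w' i : ℤ) : ℤ_[p]) * (tupleValue v i).2 ≠ 0) :
    ∀ᶠ s in Filter.atTop,
      RelationRefuted p B m ((List.range s).map (tupleOracle v D)) w w' := by
  rw [Ne, sum_digit_sub_eq_zero_iff, ← PadicInt.ext_of_toZModPow, not_forall] at h
  obtain ⟨k, hk⟩ := h
  -- A difference at level `k` persists at level `k + 1`, and the latter is certainly a coordinate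
  -- of the `ℤ_p`-part.
  have hk' : ∃ k, PadicInt.toZModPow (k + 1)
        (∑ i ∈ range m, (digit B w i : ℤ_[p]) * (tupleValue v i).2) ≠
      PadicInt.toZModPow (k + 1)
        (∑ i ∈ range m, (digit B w' i : ℤ_[p]) * (tupleValue v i).2) :=
    ⟨k, fun e => hk (toZModPow_eq_of_le k.le_succ e)⟩
  obtain ⟨k, hk⟩ := hk'
  filter_upwards [Filter.eventually_gt_atTop k, (Set.finite_lt_nat m).eventually_all.2 fun i _ =>
    Filter.eventually_gt_atTop (2 * Nat.pair i (k + 1))] with s hs hs'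
  exact (relationRefuted_iff _ _ _ _ _).2 ⟨k, hs, hs', hk⟩

/-- Only finitely many facts are to be confirmed, and each one holds on all sufficiently long
prefixes: true relations by enumeration, false ones by a differing coordinate. -/
theorem Approximates.eventually_verified
    (hD : IsEnumeration D ((timesPresentation p).positiveAtomicDiagram v)) {N : ℕ} (hN : 0 < N)
    {E : List Raw} (hE : E.length = n) (h : Approximates N (tupleValue v) E) :
    ∀ᶠ s in Filter.atTop, Verified p N E ((List.range s).map (tupleOracle v D)) := by
  have h1 : ∀ᶠ s in Filter.atTop,
      CoordinatesAgree p N E ((List.range s).map (tupleOracle v D)) := by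
    simp only [coordinatesAgree_iff hN]
    refine (Set.finite_lt_nat E.length).eventually_all.2 fun i hi => ?_
    filter_upwards [Filter.eventually_gt_atTop (2 * Nat.pair i N),
      Filter.eventually_gt_atTop (2 * Nat.pair i 0)] with s hs hs'
    exact ⟨⟨hs, hs'⟩, h.fst_eq i hi, h.similar.congr i hi⟩
  refine h1.and ((Set.finite_lt_nat _).eventually_all.2 fun w _ =>
    (Set.finite_lt_nat _).eventually_all.2 fun w' _ => ?_)
  have h2 := h.similar.relations
    (fun i => (digit (N + 1) w i : ℤ) - digit (N + 1) w' i) fun i => by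
      have := digit_lt (Nat.add_one_pos N) w i
      have := digit_lt (Nat.add_one_pos N) w' i
      rw [abs_le]
      omega
  rw [← relationHolds_iff_sum_padicInt] at h2
  by_cases h3 : RelationHolds (N + 1) E w w'
  · rw [hE] at h2 ⊢
    exact (eventually_relationSeen hD (h2.2 h3)).mono fun s hs => .inl ⟨h3, hs⟩
  · exact (eventually_relationRefuted fun e => h3 (h2.1 e)).mono fun s hs => .inr ⟨h3, hs⟩

/-! ### The decision procedure -/

/-- The test that the decision procedure applies to a candidate.  The candidate consists of a truth
value, of the number of an environment, and of the length of an initial segment of the oracle. -/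
def Accepts (p c m : ℕ) (σ : List ℕ) : Prop :=
  Verified p (precision c) ((Encodable.decode (α := List Raw) m.unpair.1.unpair.2).getD []) σ ∧
    truthValue p ((Encodable.decode (α := List Raw) m.unpair.1.unpair.2).getD []).length c
      ((Encodable.decode (α := List Raw) m.unpair.1.unpair.2).getD []) =
        some (decide (m.unpair.1.unpair.1 = 1)) ∧
    m.unpair.1.unpair.1 ≤ 1

theorem primrecPred_accepts (p : ℕ) :
    PrimrecPred fun x : ℕ × ℕ × List ℕ => Accepts p x.1 x.2.1 x.2.2 := by
  have hm : Primrec fun x : ℕ × ℕ × List ℕ => x.2.1.unpair.1 :=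
    primrec_unpair_fst.comp (Primrec.fst.comp Primrec.snd)
  have hb : Primrec fun x : ℕ × ℕ × List ℕ => x.2.1.unpair.1.unpair.1 := primrec_unpair_fst.comp hm
  have hE : Primrec fun x : ℕ × ℕ × List ℕ =>
      (Encodable.decode (α := List Raw) x.2.1.unpair.1.unpair.2).getD [] :=
    Primrec.option_getD.comp (Primrec.decode.comp (primrec_unpair_snd.comp hm)) (Primrec.const [])
  refine (primrecPred_verified p (primrec_precision.comp Primrec.fst) hE
    (Primrec.snd.comp Primrec.snd)).and (PrimrecPred.and ?_ (Primrec.nat_le.comp hb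
      (Primrec.const 1)))
  exact Primrec.eq.comp ((primrec_truthValue p).comp (Primrec.pair (Primrec.pair
    (Primrec.list_length.comp hE) hE) Primrec.fst)) (Primrec.option_some.comp
      (Primrec.eq.comp hb (Primrec.const 1)).decide)

theorem agree_tupleValue (v : Fin n → (timesPresentation p).Path) (n₀ : ℕ) :
    Agree n₀
      (Sum.elim v (default : Fin 0 → (timesPresentation p).Path)) (tupleValue v) :=
  ⟨fun i _ => congrArg pathValue (extendTuple_val v i), fun j => j.elim0⟩

/-- The length of the candidate environment plays the role of the unknown number of parameters. A
wrong guess does no harm: a free variable without an entry makes the evaluator undefined, so a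
defined truth value relies on verified entries only. -/
theorem Accepts.iff_realize
    (hD : IsEnumeration D ((timesPresentation p).positiveAtomicDiagram v))
    {α : groupLang.Formula (Fin n)} {m s : ℕ}
    (h : Accepts p (formulaCode α) m ((List.range s).map (tupleOracle v D))) :
    m.unpair.1.unpair.1 = 1 ↔ α.Realize v := by
  obtain ⟨h1, h2, -⟩ := h
  have h3 := truthValue_correct α v default _ _ _ rfl
    (h1.approximates hD ((Nat.succ_pos _).trans_le (add_two_le_precision _)))
    (agree_tupleValue v _) h2
  rwa [decide_eq_true_iff] at h3

theorem exists_accepts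
    (hD : IsEnumeration D ((timesPresentation p).positiveAtomicDiagram v))
    (α : groupLang.Formula (Fin n)) :
    ∃ m, Accepts p (formulaCode α) m ((List.range m.unpair.2).map (tupleOracle v D)) := by
  obtain ⟨E, hE, h⟩ := exists_approximates (tupleValue v) n (precision (formulaCode α))
  obtain ⟨s, hs⟩ := (h.eventually_verified hD
    ((Nat.succ_pos _).trans_le (add_two_le_precision _)) hE).exists
  obtain ⟨b, hb⟩ := exists_truthValue_eq_some (p := p) α E hE
  -- The candidate carries the length `s` of the prefix that verifies it, so a single unbounded
  -- search covers environments, answers and use of the oracle.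
  refine ⟨Nat.pair (Nat.pair b.toNat (Encodable.encode E)) s, ?_⟩
  simp only [Accepts, Nat.unpair_pair, Encodable.encodek, Option.getD_some]
  refine ⟨hs, ?_, b.toNat_le⟩
  rw [hE, hb]
  cases b <;> rfl

/-- The presentation of `ℤ_pˣ` is tree-decidable. -/
theorem timesPresentation_treeDecidable : (timesPresentation p).TreeDecidable := by
  classical
  obtain ⟨Φ, hΦ⟩ := exists_search_program (check := fun x => decide (Accepts p x.1 x.2.1 x.2.2))
    (out := fun _ m => m.unpair.1.unpair.1) (primrecPred_accepts p).decide.to_comp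
    (primrec_unpair_fst.comp (primrec_unpair_fst.comp Primrec.snd)).to_comp
  simp only [decide_eq_true_iff] at hΦ
  refine ⟨Φ, fun n α v D hD => ?_⟩
  obtain ⟨m, hm, he⟩ := hΦ (tupleOracle v D) (formulaCode α) (exists_accepts hD α)
  have h := hm.iff_realize hD
  -- The bound on the guessed truth value turns "not 1" into the output 0.
  have hle := hm.2.2
  refine ⟨fun hα => he.trans (congrArg Part.some (h.2 hα)),
    fun hα => he.trans (congrArg Part.some ?_)⟩
  have := mt h.1 hα
  omega

end OracleCheck

end TreePres

theorem mainTheorem4 (p : ℕ) [Fact p.Prime] :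
    (TreePres.timesPresentation p).IsComputablePresentation ∧
    (∃ e : (TreePres.timesPresentation p).Path ≃[TreePres.groupLang] ℤ_[p]ˣ,
      ∀ (X : (TreePres.timesPresentation p).Path) (n : ℕ), 1 ≤ n →
        PadicInt.toZModPow n (e X : ℤ_[p]) = TreePres.label p X.1 n) ∧
    (TreePres.timesPresentation p).TreeDecidable :=
  ⟨TreePres.timesPresentation_isComputablePresentation, TreePres.exists_equiv_label p,
    TreePres.timesPresentation_treeDecidable⟩
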